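/- **Conventions.** $M$ is a connected, finite-dimensional smooth ($C^\infty$) manifold, Hausdorff and second countable, without boundary, and $n\ge 0$ is an integer. *Higher tangent bundle.* $T^nM=J^n_0(\mathbb R,M)$ is the manifold of $n$-jets $[\alpha]_n$ at $0$ of curves $\alpha$ in $M$ that are smooth near $0$, with the adapted coordinates $(x,\dot x,\dots,x^{(n)})$, $x^{(k)}([\alpha]_n)=\frac{d^k}{dt^k}\big|_{0}x(\alpha(t))$, induced by charts $x$ of $M$. The jet $[\alpha]_n$ *vanishes* if $x^{(k)}([\alpha]_n)=0$ for $k=1,\dots,n$. The semigroup $(\mathbb R_{\ge0},\cdot)$ acts on $T^nM$ by $t.[\alpha]_n=[s\mapsto\alpha(ts)]_n$. *Homogeneity structure.* A homogeneity structure of degree $n$ on $M$ is a map $h:[0,\infty)\times M\to M$, $h_t=h(t,\cdot)$, that extends to a smooth map on $(-\varepsilon,\infty)\times M$ for some $\varepsilon>0$, satisfies $h_t\circ h_s=h_{ts}$ for all $s,t\ge 0$ ($h_1=\mathrm{id}$ is not assumed), and is such that, for $\varphi_n:M\to T^nM$, $\varphi_n(p)=[t\mapsto h_t(p)]_n$,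 the jet $\varphi_n(p)$ vanishes if and only if $p\in M_0:=h_0(M)$. *Graded bundle.* For $d=(d_1,\dots,d_n)\in\mathbb N^n$, let $\mathbb R^{d}$ be $\mathbb R^{d_1+\dots+d_n}$ with $d_j$ coordinates of degree $j$ for each $j$, and with the homotheties $t.y=(t^{w_i}y^i)_i$, where $w_i$ is the degree of $y^i$. A graded bundle structure of degree $n$ and rank $d$ on a map $\pi:M\to B$ to a smooth manifold $B$ is a maximal atlas of smooth local trivializations $\pi^{-1}(U)\cong U\times\mathbb R^{d}$, with the sets $U$ covering $B$, whose changes of trivialization commute in each fibre with the homotheties of $\mathbb R^{d}$. Its homotheties are the maps of $M$ given in these trivializations by $(x,y)\mapsto(x,t.y)$, $t\ge0$. *Homogeneous coordinates and graded subbundles.* Homogeneous coordinates on a manifold with an action $h$ of $(\mathbb R_{\ge0},\cdot)$ are a smooth chart $(\chi^i)$ whose domain $D$ is invariant under all $h_t$ and equals $h_0^{-1}(D)$, with $\chi^i\circ h_t=t^{w_i}\chi^i$ for some integers $0\le w_i\le n$, and whose image is $W\times\mathbb R^N$, where $W$ is an open set in the space of the coordinates of degree $0$. A graded subbundle is a subset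 that, near each of its points, is defined in the domain of some homogeneous coordinates by the vanishing of some of these coordinates. **Theorem.** Let $h$ be a homogeneity structure of degree $n$ on $M$. Then: 1. $M_0$ is an embedded submanifold of $M$, and there are a rank $d$ and a graded bundle structure of degree $n$ and rank $d$ on $\pi=h_0:M\to M_0$ whose homotheties are the maps $h_t$, $t\ge 0$. This structure is unique: if a map $\pi':M\to B'$ onto any smooth manifold $B'$ carries a graded bundle structure of degree $n$ and rank $d'$ with homotheties $h_t$, then $d'=d$ and there is a unique diffeomorphism $\Phi:M_0\to B'$ such that $\Phi\circ h_0=\pi'$ and $\Phi$ identifies the two maximal atlases of local trivializations. 2. $M$ has an atlas of homogeneous coordinates for $h$, consisting of $\dim M_0$ coordinates of degree $0$ and $d_j$ coordinates of degree $j$ for $j=1,\dots,n$. 3. The map $\varphi_n:M\to T^nM$ is a smooth embedding, satisfies $\varphi_n(h_t(p))=t.\varphi_n(p)$ for all $t\ge0$ and $p\in M$, and its image is a graded subbundle of $T^nM$. Thus $\varphi_n$ is an isomorphism of the graded bundle $M$ with a graded subbundle of $T^nM$. -/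

import Mathlib

open Set Filter Topology Manifold
open scoped ContDiff NNReal

universe u v

/-! ### Jets of curves and the higher tangent bundle -/

namespace GradedGeometry

section Jets

variable (E : Type v) [NormedAddCommGroup E] [NormedSpace ℝ E]
variable (M : Type u) [TopologicalSpace M] [ChartedSpace E M]

/-- Curves in `M` that are defined and smooth around `0`.  Only the germ at `0` matters for jets,
so the values far from `0` are arbitrary. -/
structure CurveAtZero : Type u where
  /-- the underlying map -/
  toFun : ℝ → M
  smoothAt : ContMDiffAt 𝓘(ℝ, ℝ) 𝓘(ℝ, E) ∞ toFun 0

/-- Two curves have the same `n`-jet at `0` if for each smooth function `f` on `M` the difference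
`f ∘ α - f ∘ β` vanishes at `0` up to order `n`, i.e. all derivatives of order `0, …, n` agree. -/
def jetSetoid (n : ℕ) : Setoid (CurveAtZero E M) where
  r α β := ∀ f : M → ℝ, ContMDiff 𝓘(ℝ, E) 𝓘(ℝ, ℝ) ∞ f →
    ∀ k ≤ n, iteratedDeriv k (f ∘ α.toFun) 0 = iteratedDeriv k (f ∘ β.toFun) 0
  iseqv :=
    { refl := fun _ _ _ _ _ => rfl
      symm := fun h f hf k hk => (h f hf k hk).symm
      trans := fun h h' f hf k hk => (h f hf k hk).trans (h' f hf k hk) }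

/-- The `n`-th tangent bundle `TⁿM = J₀ⁿ(ℝ, M)`: the set of `n`-jets at `0` of curves in `M`. -/
def HigherTangent (n : ℕ) : Type u := Quotient (jetSetoid E M n)

variable {E M}

/-- The `n`-jet `[α]ₙ`. -/
def CurveAtZero.jet (n : ℕ) (α : CurveAtZero E M) : HigherTangent E M n :=
  Quotient.mk (jetSetoid E M n) α

theorem CurveAtZero.jet_eq_iff {n : ℕ} {α β : CurveAtZero E M} :
    α.jet n = β.jet n ↔ ∀ f : M → ℝ, ContMDiff 𝓘(ℝ, E) 𝓘(ℝ, ℝ) ∞ f →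
      ∀ k ≤ n, iteratedDeriv k (f ∘ α.toFun) 0 = iteratedDeriv k (f ∘ β.toFun) 0 :=
  ⟨fun h => Quotient.exact h, fun h => Quotient.sound (s := jetSetoid E M n) h⟩

theorem iteratedDeriv_comp_eq_of_eq {F G : Type*} [NormedAddCommGroup F] [NormedSpace ℝ F]
    [NormedAddCommGroup G] [NormedSpace ℝ G] {g : F → G} {γ δ : ℝ → F} {n : ℕ}
    (hg : ContDiffAt ℝ ∞ g (γ 0)) (hγ : ContDiffAt ℝ ∞ γ 0) (hδ : ContDiffAt ℝ ∞ δ 0)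
    (h : ∀ k ≤ n, iteratedDeriv k γ 0 = iteratedDeriv k δ 0) {k : ℕ} (hk : k ≤ n) :
    iteratedDeriv k (g ∘ γ) 0 = iteratedDeriv k (g ∘ δ) 0 := by
  have h0 : γ 0 = δ 0 := by simpa using h 0 (Nat.zero_le n)
  have hle : (k : ℕ∞ω) ≤ ∞ := by exact_mod_cast le_top
  rw [iteratedDeriv_vcomp_eq_sum_orderedFinpartition hg hγ hle,
    iteratedDeriv_vcomp_eq_sum_orderedFinpartition (h0 ▸ hg) hδ hle, h0]
  refine Finset.sum_congr rfl fun c _ => ?_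
  congr 1
  funext j
  exact h _ ((c.partSize_le j).trans hk)

/-- A vector-valued map that is smooth near `α 0` has the same derivatives along curves with the
same jet. -/
theorem iteratedDeriv_comp_eq_of_jet_eq [FiniteDimensional ℝ E] [T2Space M]
    [IsManifold 𝓘(ℝ, E) ∞ M] {F : Type*} [NormedAddCommGroup F] [NormedSpace ℝ F]
    {n : ℕ} {α β : CurveAtZero E M} (h : α.jet n = β.jet n) (h0 : α.toFun 0 = β.toFun 0)
    {U : Set M} (hU : IsOpen U) (hα : α.toFun 0 ∈ U) {g : M → F}
    (hg : ContMDiffOn 𝓘(ℝ, E) 𝓘(ℝ, F) ∞ g U) {k : ℕ} (hk : k ≤ n) :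
    iteratedDeriv k (g ∘ α.toFun) 0 = iteratedDeriv k (g ∘ β.toFun) 0 := by
  rw [CurveAtZero.jet_eq_iff] at h
  have hle : (k : ℕ∞ω) ≤ ∞ := by exact_mod_cast le_top
  have hgα : ∀ γ : CurveAtZero E M, γ.toFun 0 ∈ U → ContDiffAt ℝ ∞ (g ∘ γ.toFun) 0 := fun γ hγ =>
    (((hg.contMDiffAt (hU.mem_nhds hγ)).comp (0 : ℝ) γ.smoothAt) : ContMDiffAt _ _ _ _ _).contDiffAt
  obtain ⟨ρ, hρ⟩ : ∃ ρ : SmoothBumpFunction 𝓘(ℝ, E) (α.toFun 0), tsupport ρ ⊆ U := by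
    obtain ⟨ρ, -, hρ⟩ := (SmoothBumpFunction.nhds_basis_tsupport (I := 𝓘(ℝ, E))
      (α.toFun 0)).mem_iff.1 (hU.mem_nhds hα)
    exact ⟨ρ, hρ⟩
  rw [SeparatingDual.eq_iff_forall_dual_eq (R := ℝ)]
  intro l
  have key : ∀ γ : CurveAtZero E M, γ.toFun 0 = α.toFun 0 →
      l (iteratedDeriv k (g ∘ γ.toFun) 0) =
        iteratedDeriv k ((fun x => ρ x * l (g x)) ∘ γ.toFun) 0 := by
    intro γ hγ
    have e1 : ((fun x => ρ x * l (g x)) ∘ γ.toFun) =ᶠ[𝓝 0] (l ∘ (g ∘ γ.toFun)) := by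
      have : ∀ᶠ x in 𝓝 (γ.toFun 0), ρ x = 1 := by rw [hγ]; exact ρ.eventuallyEq_one
      filter_upwards [γ.smoothAt.continuousAt.eventually this] with s hs
      simp [hs]
    rw [e1.iteratedDeriv_eq]
    simp only [iteratedDeriv_eq_iteratedFDeriv]
    rw [l.iteratedFDeriv_comp_left (hgα γ (hγ ▸ hα)) hle]
    rfl
  rw [key α rfl, key β h0.symm]
  refine h _ ?_ k hk
  refine contMDiff_of_tsupport fun x hx => ?_
  have hxU : x ∈ U := hρ (closure_mono (fun y hy => by
    simp only [Function.mem_support] at hy ⊢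
    exact left_ne_zero_of_mul hy) hx)
  have h1 : ContMDiffAt 𝓘(ℝ, E) 𝓘(ℝ, ℝ) ∞ (fun x => l (g x)) x :=
    l.contMDiff.contMDiffAt.comp x (hg.contMDiffAt (hU.mem_nhds hxU))
  exact ρ.contMDiff.contMDiffAt.mul h1

theorem base_eq_of_jet_eq [FiniteDimensional ℝ E] [T2Space M]
    [IsManifold 𝓘(ℝ, E) ∞ M] {n : ℕ} {α β : CurveAtZero E M} (h : α.jet n = β.jet n) :
    α.toFun 0 = β.toFun 0 := by
  rw [CurveAtZero.jet_eq_iff] at h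
  by_contra hne
  obtain ⟨ρ, -, hρ⟩ := (SmoothBumpFunction.nhds_basis_tsupport (I := 𝓘(ℝ, E))
      (α.toFun 0)).mem_iff.1 (isOpen_compl_singleton.mem_nhds (show α.toFun 0 ∈ ({β.toFun 0}ᶜ : Set M) from hne))
  have h1 := h ρ ρ.contMDiff 0 (Nat.zero_le n)
  simp only [iteratedDeriv_zero, Function.comp_apply, ρ.eq_one] at h1
  have h2 : β.toFun 0 ∈ tsupport ρ := subset_closure (by
    rw [Function.mem_support, ← h1]; exact one_ne_zero)
  exact hρ h2 rfl


theorem HigherTangent.exists_jet {n : ℕ} (j : HigherTangent E M n) :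
    ∃ α : CurveAtZero E M, α.jet n = j := Quotient.exists_rep j

theorem iteratedDeriv_comp_mul (t : ℝ) (g : ℝ → ℝ) (k : ℕ) :
    iteratedDeriv k (fun s => g (t * s)) = fun s => t ^ k * iteratedDeriv k g (t * s) := by
  induction k with
  | zero => simp
  | succ k ih =>
    funext s
    rw [iteratedDeriv_succ, ih, deriv_const_mul_field, deriv_comp_mul_left t (iteratedDeriv k g),
      iteratedDeriv_succ, smul_eq_mul, pow_succ, mul_assoc]

/-- The reparametrized curve `(t.α)(s) = α(t s)`. -/
def CurveAtZero.scale (t : ℝ≥0) (α : CurveAtZero E M) : CurveAtZero E M where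
  toFun s := α.toFun (t * s)
  smoothAt := by
    have h1 : ContMDiffAt 𝓘(ℝ, ℝ) 𝓘(ℝ, E) ∞ α.toFun ((t : ℝ) * 0) := by
      rw [mul_zero]; exact α.smoothAt
    have h2 : ContDiff ℝ ∞ (fun s : ℝ => (t : ℝ) * s) := by fun_prop
    exact h1.comp (0 : ℝ) h2.contDiffAt.contMDiffAt

/-- The canonical action of `(ℝ≥0, ·)` on `TⁿM`: `t.[α]ₙ = [t.α]ₙ`. -/
def HigherTangent.scale {n : ℕ} (t : ℝ≥0) : HigherTangent E M n → HigherTangent E M n :=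
  Quotient.map' (s₁ := jetSetoid E M n) (s₂ := jetSetoid E M n) (CurveAtZero.scale t)
    (fun α β hab f hf k hk => by
      have e : ∀ γ : CurveAtZero E M, iteratedDeriv k (f ∘ (γ.scale t).toFun) 0 =
          (t : ℝ) ^ k * iteratedDeriv k (f ∘ γ.toFun) 0 := fun γ => by
        have := congrFun (iteratedDeriv_comp_mul t (f ∘ γ.toFun) k) 0
        rw [mul_zero] at this
        exact this
      rw [e α, e β]
      congr 1
      exact hab f hf k hk)

theorem CurveAtZero.scale_jet {n : ℕ} (t : ℝ≥0) (α : CurveAtZero E M) :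
    (α.jet n).scale t = (α.scale t).jet n := rfl

theorem contDiffAt_chart_comp [IsManifold 𝓘(ℝ, E) ∞ M] (x : M) (α : CurveAtZero E M)
    (hα : α.toFun 0 ∈ (chartAt E x).source) : ContDiffAt ℝ ∞ (chartAt E x ∘ α.toFun) 0 :=
  (((contMDiffOn_chart (I := 𝓘(ℝ, E)) (n := ∞) (H := E) (x := x)).contMDiffAt
    ((chartAt E x).open_source.mem_nhds hα)).comp (0 : ℝ) α.smoothAt :
      ContMDiffAt _ _ _ _ _).contDiffAt

theorem jet_eq_of_chart [IsManifold 𝓘(ℝ, E) ∞ M] {n : ℕ} {x : M} {α β : CurveAtZero E M}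
    (hα : α.toFun 0 ∈ (chartAt E x).source) (hβ : β.toFun 0 ∈ (chartAt E x).source)
    (h : ∀ k ≤ n, iteratedDeriv k (chartAt E x ∘ α.toFun) 0 = iteratedDeriv k (chartAt E x ∘ β.toFun) 0) :
    α.jet n = β.jet n := by
  rw [CurveAtZero.jet_eq_iff]
  intro f hf k hk
  have hcongr : ∀ γ : CurveAtZero E M, γ.toFun 0 ∈ (chartAt E x).source →
      (f ∘ γ.toFun) =ᶠ[𝓝 0] ((f ∘ (chartAt E x).symm) ∘ (chartAt E x ∘ γ.toFun)) := by
    intro γ hγ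
    filter_upwards [γ.smoothAt.continuousAt.eventually ((chartAt E x).open_source.mem_nhds hγ)] with s hs
    simp only [Function.comp_apply]
    rw [(chartAt E x).left_inv hs]
  rw [(hcongr α hα).iteratedDeriv_eq, (hcongr β hβ).iteratedDeriv_eq]
  refine iteratedDeriv_comp_eq_of_eq ?_ (contDiffAt_chart_comp x α hα)
    (contDiffAt_chart_comp x β hβ) h hk
  have h1 : ContMDiffAt 𝓘(ℝ, E) 𝓘(ℝ, E) ∞ (chartAt E x).symm (chartAt E x (α.toFun 0)) :=
    (contMDiffOn_chart_symm (I := 𝓘(ℝ, E)) (n := ∞) (H := E) (x := x)).contMDiffAt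
      ((chartAt E x).open_target.mem_nhds ((chartAt E x).map_source hα))
  exact ((hf.contMDiffAt.comp (chartAt E x (α.toFun 0)) h1 :
    ContMDiffAt _ _ _ _ _)).contDiffAt

/-- The polynomial curve `t ↦ ∑ₖ tᵏ / k! • vₖ` with prescribed derivatives at `0`. -/
noncomputable def taylorCurve {n : ℕ} (v : Fin (n + 1) → E) (t : ℝ) : E :=
  ∑ k : Fin (n + 1), (t ^ (k : ℕ) / (Nat.factorial k : ℝ)) • v k

theorem contDiff_taylorCurve {n : ℕ} :
    ContDiff ℝ ∞ (fun p : (Fin (n + 1) → E) × ℝ => taylorCurve p.1 p.2) := by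
  unfold taylorCurve
  fun_prop

theorem taylorCurve_zero {n : ℕ} (v : Fin (n + 1) → E) : taylorCurve v 0 = v 0 := by
  unfold taylorCurve
  rw [Finset.sum_eq_single 0]
  · simp
  · intro k _ hk
    have : (k : ℕ) ≠ 0 := fun h => hk (Fin.ext h)
    simp [this]
  · simp

theorem iteratedDeriv_taylorCurve {n : ℕ} (v : Fin (n + 1) → E) (k : Fin (n + 1)) :
    iteratedDeriv (k : ℕ) (taylorCurve v) 0 = v k := by
  unfold taylorCurve
  rw [iteratedDeriv_fun_sum (fun i _ => by fun_prop)]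
  rw [Finset.sum_eq_single k]
  · rw [iteratedDeriv_smul_const (by fun_prop)]
    simp_rw [div_eq_inv_mul]
    rw [iteratedDeriv_const_mul_field, iteratedDeriv_fun_pow_zero, if_pos rfl,
      inv_mul_cancel₀ (by positivity), one_smul]
  · intro i _ hi
    rw [iteratedDeriv_smul_const (by fun_prop)]
    simp_rw [div_eq_inv_mul]
    rw [iteratedDeriv_const_mul_field, iteratedDeriv_fun_pow_zero,
      if_neg (fun h => hi (Fin.ext h.symm)), Nat.cast_zero, mul_zero, zero_smul]
  · simp

theorem contDiffAt_iteratedDeriv_param {V F : Type*} [NormedAddCommGroup V] [NormedSpace ℝ V]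
    [NormedAddCommGroup F] [NormedSpace ℝ F] {f : V × ℝ → F} {v : V} (t : ℝ)
    (hf : ContDiffAt ℝ ∞ f (v, t)) (k : ℕ) :
    ContDiffAt ℝ ∞ (fun p : V × ℝ => iteratedDeriv k (fun s => f (p.1, s)) p.2) (v, t) := by
  induction k with
  | zero => simpa using hf
  | succ k ih =>
    simp only [iteratedDeriv_succ]
    have h1 : ContDiffAt ℝ ∞ (Function.uncurry fun (p : V × ℝ) (s : ℝ) =>
        iteratedDeriv k (fun s => f (p.1, s)) s) ((v, t), ((v, t) : V × ℝ).2) := by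
      have : ContDiffAt ℝ ∞ (fun q : (V × ℝ) × ℝ => (q.1.1, q.2)) ((v, t), t) := by fun_prop
      exact ContDiffAt.comp ((v, t), t) (g := fun p : V × ℝ =>
        iteratedDeriv k (fun s => f (p.1, s)) p.2) ih this
    have h2 := ContDiffAt.fderiv (m := ∞) h1 contDiffAt_snd (by simp)
    exact h2.clm_apply contDiffAt_const

theorem contMDiffAt_symm_taylorCurve [IsManifold 𝓘(ℝ, E) ∞ M] {n : ℕ} (x : M)
    {v : Fin (n + 1) → E} (hv : v 0 ∈ (chartAt E x).target) :
    ContMDiffAt 𝓘(ℝ, ℝ) 𝓘(ℝ, E) ∞ (fun t => (chartAt E x).symm (taylorCurve v t)) 0 := by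
  have h1 : ContMDiffAt 𝓘(ℝ, E) 𝓘(ℝ, E) ∞ (chartAt E x).symm (taylorCurve v 0) :=
    (contMDiffOn_chart_symm (I := 𝓘(ℝ, E)) (n := ∞) (H := E) (x := x)).contMDiffAt
      ((chartAt E x).open_target.mem_nhds (by rwa [taylorCurve_zero]))
  have h2 : ContDiffAt ℝ ∞ (fun t => taylorCurve v t) (0 : ℝ) :=
    (contDiff_taylorCurve.comp (contDiff_const.prodMk contDiff_id)).contDiffAt
  exact h1.comp (0 : ℝ) h2.contMDiffAt

theorem contDiffAt_chart_transition [IsManifold 𝓘(ℝ, E) ∞ M] {x y : M} {w : E} (hw : w ∈ (chartAt E x).target)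
    (hy : (chartAt E x).symm w ∈ (chartAt E y).source) :
    ContDiffAt ℝ ∞ (chartAt E y ∘ (chartAt E x).symm) w := by
  have h1 : ContMDiffAt 𝓘(ℝ, E) 𝓘(ℝ, E) ∞ (chartAt E x).symm w :=
    (contMDiffOn_chart_symm (I := 𝓘(ℝ, E)) (n := ∞) (H := E) (x := x)).contMDiffAt
      ((chartAt E x).open_target.mem_nhds hw)
  have h2 : ContMDiffAt 𝓘(ℝ, E) 𝓘(ℝ, E) ∞ (chartAt E y) ((chartAt E x).symm w) :=
    (contMDiffOn_chart (I := 𝓘(ℝ, E)) (n := ∞) (H := E) (x := y)).contMDiffAt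
      ((chartAt E y).open_source.mem_nhds hy)
  exact (h2.comp w h1 : ContMDiffAt _ _ _ _ _).contDiffAt

theorem contDiffAt_iteratedDeriv_taylorCurve {n : ℕ} {G : E → E} {v : Fin (n + 1) → E}
    (hG : ContDiffAt ℝ ∞ G (v 0)) (k : ℕ) :
    ContDiffAt ℝ ∞ (fun w : Fin (n + 1) → E =>
      iteratedDeriv k (fun s => G (taylorCurve w s)) 0) v := by
  have hf : ContDiffAt ℝ ∞ (fun p : (Fin (n + 1) → E) × ℝ => G (taylorCurve p.1 p.2)) (v, 0) :=
    ContDiffAt.comp (g := G) (v, (0 : ℝ)) (by rwa [taylorCurve_zero])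
      contDiff_taylorCurve.contDiffAt
  have h3 := contDiffAt_iteratedDeriv_param 0 hf k
  exact ContDiffAt.comp (g := fun p : (Fin (n + 1) → E) × ℝ => iteratedDeriv k (fun s =>
      G (taylorCurve p.1 s)) p.2) v h3 (contDiffAt_id.prodMk contDiffAt_const)

open Classical in
/-- The jet with prescribed adapted coordinates (with a dummy value when the coordinates are out
of range). -/
noncomputable def HigherTangent.ofCoord [IsManifold 𝓘(ℝ, E) ∞ M] {n : ℕ} (x : M) (v : Fin (n + 1) → E) : HigherTangent E M n :=
  if hv : v 0 ∈ (chartAt E x).target then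
    CurveAtZero.jet n ⟨_, contMDiffAt_symm_taylorCurve x hv⟩
  else CurveAtZero.jet n ⟨fun _ => x, contMDiffAt_const⟩

theorem HigherTangent.ofCoord_of_mem [IsManifold 𝓘(ℝ, E) ∞ M] {n : ℕ} {x : M} {v : Fin (n + 1) → E}
    (hv : v 0 ∈ (chartAt E x).target) :
    HigherTangent.ofCoord x v = CurveAtZero.jet n ⟨_, contMDiffAt_symm_taylorCurve x hv⟩ :=
  dif_pos hv

theorem chart_symm_taylorCurve_zero_mem {n : ℕ} {x : M} {v : Fin (n + 1) → E}
    (hv : v 0 ∈ (chartAt E x).target) :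
    (chartAt E x).symm (taylorCurve v 0) ∈ (chartAt E x).source := by
  rw [taylorCurve_zero]
  exact (chartAt E x).map_target hv

section Manifold

variable [FiniteDimensional ℝ E] [T2Space M] [IsManifold 𝓘(ℝ, E) ∞ M] {n : ℕ}

/-- The projection `TⁿM → M`, `[α]ₙ ↦ α(0)`. -/
def HigherTangent.base (j : HigherTangent E M n) : M :=
  Quotient.lift (s := jetSetoid E M n) (fun α => α.toFun 0)
    (fun _ _ h => base_eq_of_jet_eq (CurveAtZero.jet_eq_iff.2 h)) j

theorem CurveAtZero.base_jet (α : CurveAtZero E M) : (α.jet n).base = α.toFun 0 := rfl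

open Classical in
/-- The adapted coordinates `(x, ẋ, ẍ, …, x⁽ⁿ⁾)` on `TⁿM` induced by the chart of `M` at `x`:
`x⁽ᵏ⁾([α]ₙ)` is the `k`-th derivative at `0` of the curve `α` read in the chart.  They are
meaningful over the domain of the chart; elsewhere they get the value `0`. -/
noncomputable def HigherTangent.coord (x : M) (j : HigherTangent E M n) : Fin (n + 1) → E :=
  Quotient.lift (s := jetSetoid E M n)
    (fun α k => if α.toFun 0 ∈ (chartAt E x).source then
      iteratedDeriv (k : ℕ) (chartAt E x ∘ α.toFun) 0 else 0)
    (fun α β h => by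
      have h' : α.jet n = β.jet n := CurveAtZero.jet_eq_iff.2 h
      have h0 := base_eq_of_jet_eq h'
      funext k
      simp only [← h0]
      split_ifs with hα
      · exact iteratedDeriv_comp_eq_of_jet_eq h' h0 (chartAt E x).open_source hα
          (contMDiffOn_chart (I := 𝓘(ℝ, E)) (n := ∞) (H := E) (x := x))
          (Nat.lt_succ_iff.1 k.2)
      · rfl) j

theorem CurveAtZero.coord_jet {x : M} {α : CurveAtZero E M}
    (hα : α.toFun 0 ∈ (chartAt E x).source) (k : Fin (n + 1)) :
    (α.jet n).coord x k = iteratedDeriv (k : ℕ) (chartAt E x ∘ α.toFun) 0 := by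
  exact if_pos hα

theorem HigherTangent.base_ofCoord {x : M} {v : Fin (n + 1) → E}
    (hv : v 0 ∈ (chartAt E x).target) :
    (HigherTangent.ofCoord x v).base = (chartAt E x).symm (v 0) := by
  rw [HigherTangent.ofCoord_of_mem hv, CurveAtZero.base_jet]
  simp only [taylorCurve_zero]

theorem HigherTangent.coord_zero {x : M} {j : HigherTangent E M n}
    (hj : j.base ∈ (chartAt E x).source) : j.coord x 0 = chartAt E x j.base := by
  obtain ⟨α, rfl⟩ := j.exists_jet
  rw [CurveAtZero.coord_jet hj]
  simp [CurveAtZero.base_jet]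

theorem HigherTangent.coord_ofCoord {x : M} {v : Fin (n + 1) → E}
    (hv : v 0 ∈ (chartAt E x).target) : (HigherTangent.ofCoord x v).coord x = v := by
  funext k
  rw [HigherTangent.ofCoord_of_mem hv, CurveAtZero.coord_jet (chart_symm_taylorCurve_zero_mem hv)]
  rw [← iteratedDeriv_taylorCurve v k]
  refine Filter.EventuallyEq.iteratedDeriv_eq _ ?_
  have hc : ContinuousAt (taylorCurve v) 0 :=
    (contDiff_taylorCurve.comp (contDiff_const.prodMk contDiff_id)).continuous.continuousAt
  filter_upwards [hc.eventually ((chartAt E x).open_target.mem_nhds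
    (show taylorCurve v 0 ∈ (chartAt E x).target by rwa [taylorCurve_zero]))] with s hs
  simp only [Function.comp_apply]
  rw [(chartAt E x).right_inv hs]

/-- The chart of `TⁿM` given by adapted coordinates, defined over the domain of a chart of `M`. -/
noncomputable def HigherTangent.chart (n : ℕ) (x : M) :
    PartialEquiv (HigherTangent E M n) (Fin (n + 1) → E) where
  toFun := HigherTangent.coord x
  invFun := HigherTangent.ofCoord x
  source := {j | j.base ∈ (chartAt E x).source}
  target := {v | v 0 ∈ (chartAt E x).target}
  map_source' j hj := by
    simp only [mem_ofPred_eq] at hj ⊢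
    rw [HigherTangent.coord_zero hj]
    exact (chartAt E x).map_source hj
  map_target' v hv := by
    simp only [mem_ofPred_eq] at hv ⊢
    rw [HigherTangent.base_ofCoord hv]
    exact (chartAt E x).map_target hv
  left_inv' j hj := by
    simp only [mem_ofPred_eq] at hj
    have hv : j.coord x 0 ∈ (chartAt E x).target := by
      rw [HigherTangent.coord_zero hj]
      exact (chartAt E x).map_source hj
    have h1 := HigherTangent.coord_ofCoord hv
    obtain ⟨α, rfl⟩ := j.exists_jet
    rw [HigherTangent.ofCoord_of_mem hv] at h1 ⊢
    refine jet_eq_of_chart (x := x) (chart_symm_taylorCurve_zero_mem hv) hj fun k hk => ?_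
    have h2 := congrFun h1 ⟨k, Nat.lt_succ_iff.2 hk⟩
    rw [CurveAtZero.coord_jet (chart_symm_taylorCurve_zero_mem hv)] at h2
    rw [CurveAtZero.coord_jet hj] at h2
    exact h2
  right_inv' v hv := HigherTangent.coord_ofCoord hv

theorem HigherTangent.coord_ofCoord_eq {x y : M} {w : Fin (n + 1) → E}
    (hw : w 0 ∈ (chartAt E x).target)
    (hy : (chartAt E x).symm (w 0) ∈ (chartAt E y).source) (k : Fin (n + 1)) :
    (HigherTangent.ofCoord x w).coord y k =
      iteratedDeriv (k : ℕ) (fun s => (chartAt E y ∘ (chartAt E x).symm) (taylorCurve w s)) 0 := by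
  rw [HigherTangent.ofCoord_of_mem hw, CurveAtZero.coord_jet (by simpa [taylorCurve_zero] using hy)]
  rfl

theorem HigherTangent.contDiffOn_transition (x y : M) :
    ContDiffOn ℝ ∞ ((HigherTangent.chart (E := E) n x).symm.trans (HigherTangent.chart n y))
      ((HigherTangent.chart (E := E) n x).symm.trans (HigherTangent.chart n y)).source := by
  rintro v ⟨hv, hv'⟩
  replace hv : v 0 ∈ (chartAt E x).target := hv
  replace hv' : (HigherTangent.ofCoord (n := n) x v).base ∈ (chartAt E y).source := hv'
  rw [HigherTangent.base_ofCoord hv] at hv'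
  refine ContDiffAt.contDiffWithinAt ?_
  rw [contDiffAt_pi]
  intro k
  have h4 := contDiffAt_iteratedDeriv_taylorCurve (contDiffAt_chart_transition hv hv') (k : ℕ)
  refine h4.congr_of_eventuallyEq ?_
  have ho : ∀ᶠ w in 𝓝 v, w 0 ∈ (chartAt E x).target :=
    (continuous_apply 0).continuousAt.eventually ((chartAt E x).open_target.mem_nhds hv)
  have ho' : ∀ᶠ w in 𝓝 v, (chartAt E x).symm (w 0) ∈ (chartAt E y).source :=
    (((chartAt E x).continuousAt_symm hv).comp (f := fun w : Fin (n + 1) → E => w 0)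
      (continuous_apply 0).continuousAt).eventually ((chartAt E y).open_source.mem_nhds hv')
  filter_upwards [ho, ho'] with w hw hw'
  exact HigherTangent.coord_ofCoord_eq hw hw' k

theorem HigherTangent.isOpen_transition_source (x y : M) :
    IsOpen ((HigherTangent.chart (E := E) n x).symm.trans (HigherTangent.chart n y)).source := by
  have : ((HigherTangent.chart (E := E) n x).symm.trans (HigherTangent.chart n y)).source =
      (fun v : Fin (n + 1) → E => v 0) ⁻¹'
        ((chartAt E x).target ∩ (chartAt E x).symm ⁻¹' (chartAt E y).source) := by
    ext v
    simp only [PartialEquiv.trans_source, PartialEquiv.symm_source, mem_inter_iff, mem_preimage]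
    refine and_congr_right fun hv => ?_
    change (HigherTangent.ofCoord (n := n) x v).base ∈ (chartAt E y).source ↔ _
    rw [HigherTangent.base_ofCoord hv]
  rw [this]
  exact ((chartAt E x).isOpen_inter_preimage_symm (chartAt E y).open_source).preimage
    (continuous_apply 0)

variable (E M n) in
/-- The smooth atlas of `TⁿM` consisting of all adapted coordinate systems. -/
noncomputable def HigherTangent.core :
    ChartedSpaceCore (Fin (n + 1) → E) (HigherTangent E M n) where
  atlas := Set.range (HigherTangent.chart n)
  chartAt j := HigherTangent.chart n j.base
  mem_chart_source j := mem_chart_source E j.base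
  chart_mem_atlas j := mem_range_self _
  open_source := by
    rintro _ _ ⟨x, rfl⟩ ⟨y, rfl⟩
    exact HigherTangent.isOpen_transition_source x y
  continuousOn_toFun := by
    rintro _ _ ⟨x, rfl⟩ ⟨y, rfl⟩
    exact (HigherTangent.contDiffOn_transition x y).continuousOn

noncomputable instance HigherTangent.instTopologicalSpace :
    TopologicalSpace (HigherTangent E M n) := (HigherTangent.core E M n).toTopologicalSpace

noncomputable instance HigherTangent.instChartedSpace :
    ChartedSpace (Fin (n + 1) → E) (HigherTangent E M n) := (HigherTangent.core E M n).toChartedSpace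

instance HigherTangent.instIsManifold :
    IsManifold 𝓘(ℝ, Fin (n + 1) → E) ∞ (HigherTangent E M n) := by
  refine isManifold_of_contDiffOn _ _ _ ?_
  intro e e' he he'
  obtain ⟨_, ⟨_, rfl⟩, ⟨_, ⟨⟨x, rfl⟩, rfl⟩, rfl⟩⟩ := he
  obtain ⟨_, ⟨_, rfl⟩, ⟨_, ⟨⟨y, rfl⟩, rfl⟩, rfl⟩⟩ := he'
  have := HigherTangent.contDiffOn_transition (E := E) (n := n) x y
  simp only [modelWithCornersSelf_coe, modelWithCornersSelf_coe_symm, Function.id_comp,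
    Function.comp_id, preimage_id, range_id, inter_univ]
  exact this

/-- The jet `[α]ₙ` vanishes if its Taylor coefficients `x⁽ⁱ⁾([α]ₙ)`, `i = 1, …, n`, are zero; this
does not depend on the local coordinates, and we use the chart at `α(0)`. -/
def HigherTangent.Vanishes (j : HigherTangent E M n) : Prop :=
  ∀ i : Fin (n + 1), i ≠ 0 → j.coord j.base i = 0

end Manifold

end Jets

/-! ### Homogeneity structures -/

section Actions

variable (E : Type v) [NormedAddCommGroup E] [NormedSpace ℝ E]
variable (M : Type u) [TopologicalSpace M] [ChartedSpace E M]

/-- A smooth action `h : [0, ∞) × M → M` of the multiplicative semigroup `(ℝ≥0, ·)`.  It is not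
required that `h 1 = id`.  Smoothness means that `h` extends to a smooth map on `(-ε, ∞) × M` for
some `ε > 0`. -/
structure SmoothAction where
  /-- the maps `h t` -/
  toFun : ℝ≥0 → M → M
  map_mul : ∀ s t p, toFun (s * t) p = toFun s (toFun t p)
  smooth : ∃ ε : ℝ, 0 < ε ∧ ∃ H : ℝ × M → M,
    ContMDiffOn (𝓘(ℝ, ℝ).prod 𝓘(ℝ, E)) 𝓘(ℝ, E) ∞ H (Ioi (-ε) ×ˢ univ) ∧
    ∀ (t : ℝ≥0) (p : M), H ((t : ℝ), p) = toFun t p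

namespace SmoothAction

variable {E M} (h : SmoothAction E M)

theorem exists_orbitCurve (p : M) :
    ∃ α : CurveAtZero E M, ∀ t : ℝ≥0, α.toFun t = h.toFun t p := by
  obtain ⟨ε, hε, H, hH, hHh⟩ := h.smooth
  refine ⟨⟨fun t => H (t, p), ?_⟩, fun t => hHh t p⟩
  have h1 : ContMDiffAt (𝓘(ℝ, ℝ).prod 𝓘(ℝ, E)) 𝓘(ℝ, E) ∞ H ((0 : ℝ), p) :=
    hH.contMDiffAt (prod_mem_nhds (Ioi_mem_nhds (by linarith)) univ_mem)
  exact h1.comp (0 : ℝ) (contMDiffAt_id.prodMk contMDiffAt_const)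

/-- The `n`-jet of a curve that is smooth around `0` depends only on its values at `t ≥ 0`. -/
theorem jet_eq_of_eqOn_nonneg (n : ℕ) {α β : CurveAtZero E M}
    (hab : ∀ t : ℝ≥0, α.toFun t = β.toFun t) : α.jet n = β.jet n := by
  rw [CurveAtZero.jet_eq_iff]
  intro f hf k _
  have hle : (k : ℕ∞ω) ≤ ∞ := by exact_mod_cast le_top
  have hd : ∀ γ : CurveAtZero E M, ContDiffAt ℝ k (f ∘ γ.toFun) 0 := fun γ =>
    ((hf.contMDiffAt.comp (0 : ℝ) γ.smoothAt : ContMDiffAt _ _ _ _ _).contDiffAt).of_le hle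
  have h0 : (0 : ℝ) ∈ Ici (0 : ℝ) := self_mem_Ici
  rw [← iteratedDerivWithin_eq_iteratedDeriv (uniqueDiffOn_Ici 0) (hd α) h0,
    ← iteratedDerivWithin_eq_iteratedDeriv (uniqueDiffOn_Ici 0) (hd β) h0]
  refine iteratedDerivWithin_congr (fun t ht => ?_) h0
  exact congrArg f (hab ⟨t, ht⟩)

/-- The curve `α_p : t ↦ h t p`, extended smoothly to a neighbourhood of `0`. -/
noncomputable def orbitCurve (p : M) : CurveAtZero E M := (h.exists_orbitCurve p).choose

/-- The map `φₙ : M → TⁿM`, `p ↦ [t ↦ h t p]ₙ`. -/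
noncomputable def orbitJet (n : ℕ) (p : M) : HigherTangent E M n := (h.orbitCurve p).jet n

theorem orbitJet_eq (n : ℕ) (p : M) (α : CurveAtZero E M)
    (hα : ∀ t : ℝ≥0, α.toFun t = h.toFun t p) : h.orbitJet n p = α.jet n :=
  jet_eq_of_eqOn_nonneg n fun t => ((h.exists_orbitCurve p).choose_spec t).trans (hα t).symm

/-- The set `M₀ = h 0 (M)`. -/
def base : Set M := Set.range (h.toFun 0)

/-- The projection `M → M₀` given by `h 0`. -/
def proj (p : M) : h.base := ⟨h.toFun 0 p, mem_range_self p⟩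

/-- `h` is a homogeneity structure of degree `n`: the `n`-jet `φₙ(p)` vanishes exactly when
`p ∈ M₀`. -/
def IsHomogeneityStructure [FiniteDimensional ℝ E] [T2Space M] [IsManifold 𝓘(ℝ, E) ∞ M]
    (n : ℕ) : Prop :=
  ∀ p : M, (h.orbitJet n p).Vanishes ↔ p ∈ h.base

end SmoothAction

end Actions

/-! ### Graded spaces and graded bundles -/

/-- The standard graded space `ℝᵈ` of rank `d = (d₁, …, dₙ)`.  The coordinate with index `⟨j, a⟩`
has degree `j + 1` because `j : Fin n` starts from `0`, so that `d j` is the number of coordinates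
of degree `j + 1`. -/
abbrev GradedSpace (n : ℕ) (d : Fin n → ℕ) : Type := ((j : Fin n) × Fin (d j)) → ℝ

/-- The homotheties of the standard graded space. -/
def GradedSpace.dilation {n : ℕ} {d : Fin n → ℕ} (t : ℝ≥0) (y : GradedSpace n d) :
    GradedSpace n d :=
  fun i => (t : ℝ) ^ ((i.1 : ℕ) + 1) * y i

section Bundles

/-- The change of local trivializations from `e` to `e'` is in each fibre an automorphism of the
standard graded space, i.e. it commutes with the homotheties (for smooth trivializations it is
automatically a diffeomorphism in each fibre). -/
def IsGradedTransition {M B : Type*} [TopologicalSpace M] [TopologicalSpace B] {π : M → B}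
    {n : ℕ} {d : Fin n → ℕ} (e e' : Bundle.Trivialization (GradedSpace n d) π) : Prop :=
  ∀ b ∈ e.baseSet ∩ e'.baseSet, ∀ (t : ℝ≥0) (y : GradedSpace n d),
    (e' (e.toOpenPartialHomeomorph.symm (b, GradedSpace.dilation t y))).2 =
      GradedSpace.dilation t (e' (e.toOpenPartialHomeomorph.symm (b, y))).2

/-- A smooth local trivialization: a diffeomorphism `π⁻¹(U) → U × ℝᵈ` over `U`. -/
def IsSmoothTrivialization (E EB : Type*) [NormedAddCommGroup E] [NormedSpace ℝ E]
    [NormedAddCommGroup EB] [NormedSpace ℝ EB]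
    {M B : Type*} [TopologicalSpace M] [ChartedSpace E M] [TopologicalSpace B] [ChartedSpace EB B]
    {π : M → B} {n : ℕ} {d : Fin n → ℕ} (e : Bundle.Trivialization (GradedSpace n d) π) : Prop :=
  ContMDiffOn 𝓘(ℝ, E) (𝓘(ℝ, EB).prod 𝓘(ℝ, GradedSpace n d)) ∞ e e.source ∧
  ContMDiffOn (𝓘(ℝ, EB).prod 𝓘(ℝ, GradedSpace n d)) 𝓘(ℝ, E) ∞
    e.toOpenPartialHomeomorph.symm e.target

/-- The structure of a graded bundle of degree `n` and rank `d` on a map `π : M → B` of smooth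
manifolds: a maximal atlas of smooth local trivializations with typical fibre `ℝᵈ` whose changes
are in each fibre automorphisms of the graded space `ℝᵈ`. -/
structure GradedBundle (n : ℕ) (d : Fin n → ℕ) (E EB : Type*) [NormedAddCommGroup E]
    [NormedSpace ℝ E] [NormedAddCommGroup EB] [NormedSpace ℝ EB]
    {M B : Type*} [TopologicalSpace M] [ChartedSpace E M] [TopologicalSpace B] [ChartedSpace EB B]
    (π : M → B) where
  /-- the graded local trivializations -/
  atlas : Set (Bundle.Trivialization (GradedSpace n d) π)
  smooth : ∀ e ∈ atlas, IsSmoothTrivialization E EB e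
  cover : ∀ b : B, ∃ e ∈ atlas, b ∈ e.baseSet
  compatible : ∀ e ∈ atlas, ∀ e' ∈ atlas, IsGradedTransition e e'
  maximal : ∀ e : Bundle.Trivialization (GradedSpace n d) π, IsSmoothTrivialization E EB e →
    (∀ e' ∈ atlas, IsGradedTransition e e') → e ∈ atlas

namespace GradedBundle

variable {n : ℕ} {d : Fin n → ℕ} {E EB EB' : Type*} [NormedAddCommGroup E] [NormedSpace ℝ E]
  [NormedAddCommGroup EB] [NormedSpace ℝ EB] [NormedAddCommGroup EB'] [NormedSpace ℝ EB']
  {M B B' : Type*} [TopologicalSpace M] [ChartedSpace E M]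
  [TopologicalSpace B] [ChartedSpace EB B] [TopologicalSpace B'] [ChartedSpace EB' B']
  {π : M → B} {π' : M → B'}

/-- The canonical action of `(ℝ≥0, ·)` by homotheties on a graded bundle: in a graded local
trivialization it is `(x, y) ↦ (x, t.y)`. -/
noncomputable def homothety (G : GradedBundle n d E EB π) (t : ℝ≥0) (p : M) : M :=
  let e := (G.cover (π p)).choose
  e.toOpenPartialHomeomorph.symm (π p, GradedSpace.dilation t (e p).2)

/-- The homotheties have the standard form in every graded local trivialization. -/
theorem apply_homothety (G : GradedBundle n d E EB π) {e : Bundle.Trivialization (GradedSpace n d) π}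
    (he : e ∈ G.atlas) {p : M} (hp : π p ∈ e.baseSet) (t : ℝ≥0) :
    e (G.homothety t p) = (π p, GradedSpace.dilation t (e p).2) := by
  obtain ⟨he₀, hp₀⟩ := (G.cover (π p)).choose_spec
  have hcomp := G.compatible _ he₀ _ he (π p) ⟨hp₀, hp⟩ t
    ((G.cover (π p)).choose p).2
  have hproj : π (G.homothety t p) = π p := (G.cover (π p)).choose.proj_symm_apply' hp₀
  refine Prod.ext ?_ ?_
  · rw [e.coe_fst' (by rw [hproj]; exact hp), hproj]
  · have h1 : (G.cover (π p)).choose.toOpenPartialHomeomorph.symm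
        (π p, ((G.cover (π p)).choose p).2) = p :=
      (G.cover (π p)).choose.symm_apply_mk_proj
        ((G.cover (π p)).choose.mem_source.2 hp₀)
    rw [h1] at hcomp
    exact hcomp

/-- Two graded bundle structures on the same total space coincide under the identification
`Φ : B → B'` of their bases: the corresponding local trivializations over `U` and `Φ(U)` are graded
with respect to the first structure if and only if they are so for the second one. -/
def SameStructure (Φ : B → B') (G : GradedBundle n d E EB π) (G' : GradedBundle n d E EB' π') :
    Prop :=
  ∀ (e : Bundle.Trivialization (GradedSpace n d) π) (e' : Bundle.Trivialization (GradedSpace n d) π'),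
    e'.baseSet = Φ '' e.baseSet → (∀ p ∈ e.source, e' p = (Φ (e p).1, (e p).2)) →
    (e ∈ G.atlas ↔ e' ∈ G'.atlas)

end GradedBundle

/-! ### Homogeneous coordinates and graded subbundles -/

/-- The weight vector of homogeneous coordinates `(xᵃ, yⁱ)`: the `m` base coordinates `xᵃ` have
degree `0`, the fibre coordinates have their degrees in the graded space `ℝᵈ`. -/
def weightVector (m : ℕ) {n : ℕ} (d : Fin n → ℕ) : Fin m ⊕ ((j : Fin n) × Fin (d j)) → ℕ :=
  Sum.elim (fun _ => 0) (fun i => (i.1 : ℕ) + 1)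

/-- Homogeneous coordinates of degrees `w i ≤ n` on a manifold `F` with an action `h` of
`(ℝ≥0, ·)`: a smooth chart `χ` whose domain is the preimage of its part in the base `h 0 (F)`,
whose coordinate functions are homogeneous, `χⁱ ∘ h t = t ^ (w i) χⁱ`, and whose image has the
form `W × ℝᴺ` with `W` in the space of the coordinates of degree `0`. -/
structure IsHomogeneousChart {EF : Type*} [NormedAddCommGroup EF] [NormedSpace ℝ EF]
    {F : Type*} [TopologicalSpace F] [ChartedSpace EF F] (n : ℕ) (h : ℝ≥0 → F → F)
    {ι : Type} [Fintype ι] (w : ι → ℕ) (χ : OpenPartialHomeomorph F (ι → ℝ)) : Prop where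
  smooth : ContMDiffOn 𝓘(ℝ, EF) 𝓘(ℝ, ι → ℝ) ∞ χ χ.source
  smooth_symm : ContMDiffOn 𝓘(ℝ, ι → ℝ) 𝓘(ℝ, EF) ∞ χ.symm χ.target
  weight_le : ∀ i, w i ≤ n
  saturated : ∀ p, h 0 p ∈ χ.source ↔ p ∈ χ.source
  mapsTo : ∀ t, ∀ p ∈ χ.source, h t p ∈ χ.source
  homogeneous : ∀ t, ∀ p ∈ χ.source, ∀ i, χ (h t p) i = (t : ℝ) ^ (w i) * χ p i
  cylinder : ∀ y ∈ χ.target, ∀ z : ι → ℝ, (∀ i, w i = 0 → z i = y i) → z ∈ χ.target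

/-- A graded subbundle of a graded bundle `F` of degree `n` with homotheties `h`: a subset which is
locally defined by the vanishing of some homogeneous coordinates. -/
def IsGradedSubbundle {EF : Type*} [NormedAddCommGroup EF] [NormedSpace ℝ EF]
    {F : Type*} [TopologicalSpace F] [ChartedSpace EF F] (n : ℕ) (h : ℝ≥0 → F → F)
    (S : Set F) : Prop :=
  ∀ q ∈ S, ∃ (ι : Type) (_ : Fintype ι) (w : ι → ℕ) (χ : OpenPartialHomeomorph F (ι → ℝ))
    (A : Set ι), IsHomogeneousChart (EF := EF) n h w χ ∧ q ∈ χ.source ∧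
      S ∩ χ.source = {p ∈ χ.source | ∀ i ∈ A, χ p i = 0}

end Bundles

end GradedGeometry

open GradedGeometry

/-!
The proof linearizes the action near each point of the base `M₀ = h 0 (M)` and extends the
linearizing coordinates along the fibres of `h 0`, where they become homogeneous coordinates.

**Linearization.**  Near `a ∈ M₀`, write the action in a chart as `f (y, t)` and let
`D k y = ∂ₜᵏ f (y, 0)`.  Multiplicativity gives `D k (f (y, s)) = s ^ k • D k y`
(`IsLocalAction.timeDeriv_apply`), and differentiating this at the fixed point `a`, first in `y` and
then in `s`, shows that the maps `P k = (D k)'(a) / k!` are idempotents with `P k ∘ P j = 0` for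
`k ≠ j` (`IsLocalAction.weightProj_comp`).  The map `F = ∑ₖ P k (D k / k!)`, `k = 0, …, n`, has the
derivative `∑ₖ P k` at `a`, and its component of weight `k` is homogeneous of degree `k`.

The hypothesis on vanishing jets enters through `IsLocalAction.sum_weightProj`, which says that
`∑ₖ P k = id`.  If `F y = F a`, then `f (y, 0) = a`, and the first nonzero `D k y` with `k ≥ 1` would
be a vector of weight `k` with `P k (D k y) = 0`; so the jet of `y` vanishes, `y` lies in the base, and
`y = f (y, 0) = a`.  Thus `F` is injective at `a`.  As `F` takes values in the range of its own
derivative `∑ₖ P k` at `a`, a nontrivial kernel of the latter would give a curve in a fibre of `F`.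
Hence `F` is a local diffeomorphism, and in a basis adapted to the `P k` it consists of homogeneous
functions (`SmoothAction.IsHomogeneityStructure.exists_linearization`).

**Homogeneous coordinates.**  The maps `D k` only involve the orbit near time `0`, so `F` makes sense
on the whole preimage under `h 0` of a neighbourhood of `a`.  For small `s > 0` the map `h s` moves a
point of this preimage to where `F` is a chart; it commutes with `F` up to a dilation, and it is
invertible if `h 1 = id`, so that `F` is a chart there too
(`SmoothAction.exists_isHomogeneousChart`).  To see that `h 1 = id`, note that the smooth retraction
`h 1` is the identity near `M₀` by linearization, and that the interior of its set of fixed points is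
closed, because a smooth retraction with identical derivative is locally the identity; then use that
`M` is connected (`SmoothAction.IsHomogeneityStructure.apply_one`).  The trace of the differential of
`h t` at a point of `M₀` is the sum of the powers `t ^ w` of `t` over the weights `w` of any
homogeneous coordinates, so the rank is well defined and locally constant, and `M₀` is connected
(`SmoothAction.rank_eq`, `SmoothAction.IsHomogeneityStructure.exists_charts`).

**The graded bundle.**  The coordinates of degree `0` are charts of `M₀`, and the other ones give local
trivializations of `h 0`.  A maximal graded atlas consists of all smooth trivializations in which the
homotheties have the standard form (`GradedBundle.mem_atlas_iff`), so it is determined by the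
homotheties.  If `π' : M → B'` is another graded bundle with the homotheties `h t`, then its zero
section is `M₀`, so `π'` restricts to a diffeomorphism `M₀ → B'`
(`HasHomogeneousBaseCharts.exists_diffeomorph`); and its trivializations give homogeneous coordinates
of `M`, so it has the same rank.

**The embedding.**  In homogeneous coordinates the `i`-th component of the orbit of `p` is the curve
`t ^ (w i) * χⁱ(p)`, so that in the adapted coordinates of `TⁿM` induced by `χ` the map `φₙ` is
linear: `(x⁽ᵏ⁾)ⁱ` is `k! * χⁱ(p)` if `k = w i`, and `0` otherwise
(`IsHomogeneousChart.chartCoord_orbitJet`).  All claims about `φₙ` can be read off from this.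
-/

namespace GradedGeometry

/-! ### Derivatives of one-parameter families -/

section Calculus

variable {V F G : Type*} [NormedAddCommGroup V] [NormedSpace ℝ V]
  [NormedAddCommGroup F] [NormedSpace ℝ F] [NormedAddCommGroup G] [NormedSpace ℝ G]

theorem one_le_infty : (1 : ℕ∞ω) ≤ ∞ := by exact_mod_cast le_top

theorem two_le_infty : (2 : ℕ∞ω) ≤ ∞ :=
  WithTop.coe_le_coe.2 (le_top : (2 : ℕ∞) ≤ ⊤)

/-- Derivatives at `0` are determined by the values on a right neighbourhood of `0`.  This is what
makes the identities for `t ≥ 0` in the definition of an action sufficient. -/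
theorem iteratedDeriv_eq_of_eventuallyEq_nonneg {f g : ℝ → F} (hf : ContDiffAt ℝ ∞ f 0)
    (hg : ContDiffAt ℝ ∞ g 0) (hfg : f =ᶠ[𝓝[≥] 0] g) (k : ℕ) :
    iteratedDeriv k f 0 = iteratedDeriv k g 0 := by
  have h0 : (0 : ℝ) ∈ Ici (0 : ℝ) := self_mem_Ici
  have hle : (k : ℕ∞ω) ≤ ∞ := by exact_mod_cast le_top
  rw [← iteratedDerivWithin_eq_iteratedDeriv (uniqueDiffOn_Ici 0) (hf.of_le hle) h0,
    ← iteratedDerivWithin_eq_iteratedDeriv (uniqueDiffOn_Ici 0) (hg.of_le hle) h0]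
  exact hfg.iteratedDerivWithin_eq (hfg.self_of_nhdsWithin h0)

theorem contDiffAt_deriv {f : ℝ → F} {t : ℝ} (hf : ContDiffAt ℝ ∞ f t) :
    ContDiffAt ℝ ∞ (deriv f) t := by
  have h : ContDiffAt ℝ ∞ (fun s => fderiv ℝ f s 1) t :=
    (hf.fderiv_right (m := ∞) (by simp)).clm_apply contDiffAt_const
  simpa only [fderiv_apply_one_eq_deriv] using h

theorem iteratedDeriv_comp_mul_left (t : ℝ) (g : ℝ → F) (k : ℕ) :
    iteratedDeriv k (fun s => g (t * s)) = fun s => t ^ k • iteratedDeriv k g (t * s) := by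
  induction k with
  | zero => simp
  | succ k ih =>
    funext s
    rw [iteratedDeriv_succ, ih]
    have := deriv_const_smul_field (x := s) (t ^ k) (fun s => iteratedDeriv k g (t * s))
    rw [show (fun s => t ^ k • iteratedDeriv k g (t * s)) =
      t ^ k • (fun s => iteratedDeriv k g (t * s)) from rfl, this,
      deriv_comp_mul_left t (iteratedDeriv k g), iteratedDeriv_succ, smul_smul, pow_succ]

theorem iteratedDeriv_clm_apply_const (L : F →L[ℝ] G) {f : ℝ → F} {t : ℝ}
    (hf : ContDiffAt ℝ ∞ f t) (k : ℕ) :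
    iteratedDeriv k (fun s => L (f s)) t = L (iteratedDeriv k f t) := by
  have hle : (k : ℕ∞ω) ≤ ∞ := by exact_mod_cast le_top
  simp only [iteratedDeriv_eq_iteratedFDeriv]
  rw [show (fun s => L (f s)) = L ∘ f from rfl, L.iteratedFDeriv_comp_left hf hle]
  rfl

theorem fderiv_deriv_comm {f : V × ℝ → F} {v : V} {t : ℝ} (hf : ContDiffAt ℝ 2 f (v, t)) :
    fderiv ℝ (fun w => deriv (fun s => f (w, s)) t) v =
      deriv (fun s => fderiv ℝ (fun w => f (w, s)) v) t := by
  have hev : ∀ᶠ p in 𝓝 (v, t), DifferentiableAt ℝ f p :=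
    (hf.eventually (by simp)).mono fun p hp => hp.differentiableAt (by simp)
  have hD : HasFDerivAt (fderiv ℝ f) (fderiv ℝ (fderiv ℝ f) (v, t)) (v, t) :=
    ((hf.fderiv_right (m := 1) (by norm_num)).differentiableAt (by simp)).hasFDerivAt
  have e1 : (fun w => deriv (fun s => f (w, s)) t) =ᶠ[𝓝 v]
      fun w => fderiv ℝ f (w, t) (0, 1) := by
    have hc : Tendsto (fun w : V => (w, t)) (𝓝 v) (𝓝 (v, t)) :=
      (Continuous.prodMk_left t).continuousAt
    filter_upwards [hc.eventually hev] with w hw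
    have h1 : HasDerivAt (fun s : ℝ => (w, s)) ((0 : V), (1 : ℝ)) t :=
      (hasDerivAt_const t w).prodMk (hasDerivAt_id t)
    exact (hw.hasFDerivAt.comp_hasDerivAt t h1).deriv
  have e2 : (fun s => fderiv ℝ (fun w => f (w, s)) v) =ᶠ[𝓝 t]
      fun s => (fderiv ℝ f (v, s)).comp (ContinuousLinearMap.inl ℝ V ℝ) := by
    have hc : Tendsto (fun s : ℝ => (v, s)) (𝓝 t) (𝓝 (v, t)) :=
      (Continuous.prodMk_right v).continuousAt
    filter_upwards [hc.eventually hev] with s hs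
    exact (hs.hasFDerivAt.comp v (hasFDerivAt_prodMk_left v s)).fderiv
  rw [e1.fderiv_eq, e2.deriv_eq]
  ext u
  have h1 : HasFDerivAt (fun w => fderiv ℝ f (w, t))
      ((fderiv ℝ (fderiv ℝ f) (v, t)).comp (ContinuousLinearMap.inl ℝ V ℝ)) v :=
    hD.comp v (hasFDerivAt_prodMk_left v t)
  have h2 : HasDerivAt (fun s => fderiv ℝ f (v, s)) (fderiv ℝ (fderiv ℝ f) (v, t) (0, 1)) t :=
    hD.comp_hasDerivAt t ((hasDerivAt_const t v).prodMk (hasDerivAt_id t))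
  have h3 := (h1.clm_apply (hasFDerivAt_const ((0 : V), (1 : ℝ)) v)).fderiv
  have h4 := (((ContinuousLinearMap.compL ℝ V (V × ℝ) F).flip
    (ContinuousLinearMap.inl ℝ V ℝ)).hasFDerivAt.comp_hasDerivAt t h2).deriv
  have h5 : deriv (fun s => (fderiv ℝ f (v, s)).comp (ContinuousLinearMap.inl ℝ V ℝ)) t =
      (fderiv ℝ (fderiv ℝ f) (v, t) (0, 1)).comp (ContinuousLinearMap.inl ℝ V ℝ) := h4
  rw [h3, h5]
  have hs : IsSymmSndFDerivAt ℝ f (v, t) := hf.isSymmSndFDerivAt (by simp)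
  simpa using hs.eq (u, 0) (0, 1)

/-- Derivatives with respect to the parameter `t` commute with the differential in the space
variable. -/
theorem fderiv_iteratedDeriv_comm {f : V × ℝ → F} {v : V} {t : ℝ}
    (hf : ContDiffAt ℝ ∞ f (v, t)) (k : ℕ) :
    fderiv ℝ (fun w => iteratedDeriv k (fun s => f (w, s)) t) v =
      iteratedDeriv k (fun s => fderiv ℝ (fun w => f (w, s)) v) t := by
  induction k generalizing f with
  | zero => simp
  | succ k ih =>
    simp only [iteratedDeriv_succ']
    have hg : ContDiffAt ℝ ∞ (fun p : V × ℝ => deriv (fun s => f (p.1, s)) p.2) (v, t) := by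
      simpa only [iteratedDeriv_one] using contDiffAt_iteratedDeriv_param t hf 1
    have h1 := ih hg
    rw [h1]
    refine Filter.EventuallyEq.iteratedDeriv_eq _ ?_
    have hc : Tendsto (fun s : ℝ => (v, s)) (𝓝 t) (𝓝 (v, t)) :=
      (Continuous.prodMk_right v).continuousAt
    filter_upwards [hc.eventually ((hf.of_le two_le_infty).eventually (by simp))] with s hs
    exact fderiv_deriv_comm hs

/-- The Leibniz rule for a factor which vanishes up to order `m`. -/
theorem iteratedDeriv_clm_apply_of_vanish {B : ℝ → F →L[ℝ] G} {w : ℝ → F} {m : ℕ}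
    (hB : ContDiffAt ℝ ∞ B 0) (hw : ContDiffAt ℝ ∞ w 0) (h : ∀ i < m, iteratedDeriv i w 0 = 0) :
    iteratedDeriv m (fun t => B t (w t)) 0 = B 0 (iteratedDeriv m w 0) := by
  induction m generalizing B w with
  | zero => simp
  | succ m ih =>
    have hle : (m : ℕ∞ω) ≤ ∞ := by exact_mod_cast le_top
    have e : deriv (fun t => B t (w t)) =ᶠ[𝓝 0]
        (fun t => deriv B t (w t)) + fun t => B t (deriv w t) := by
      filter_upwards [(hB.of_le one_le_infty).eventually (by simp),
        (hw.of_le one_le_infty).eventually (by simp)] with t h1 h2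
      exact ((h1.differentiableAt (by simp)).hasDerivAt.clm_apply
        (h2.differentiableAt (by simp)).hasDerivAt).deriv
    have hB' := contDiffAt_deriv hB
    have hw' := contDiffAt_deriv hw
    rw [iteratedDeriv_succ', e.iteratedDeriv_eq, iteratedDeriv_add
      ((hB'.clm_apply hw).of_le hle) ((hB.clm_apply hw').of_le hle),
      ih hB' hw (fun i hi => h i (by omega)), ih hB hw' fun i hi => by
        rw [← iteratedDeriv_succ']; exact h (i + 1) (by omega)]
    rw [h m (by omega), map_zero, zero_add, ← iteratedDeriv_succ']

/-- The leading coefficient of a composition: if the first nonvanishing derivative of `γ` has order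
at least `k`, then in the chain rule for the `k`-th derivative only the linear term survives. -/
theorem iteratedDeriv_comp_of_vanish {g : F → G} {γ : ℝ → F} {k : ℕ} (hk : 1 ≤ k)
    (hg : ContDiffAt ℝ ∞ g (γ 0)) (hγ : ContDiffAt ℝ ∞ γ 0)
    (h : ∀ i, 1 ≤ i → i < k → iteratedDeriv i γ 0 = 0) :
    iteratedDeriv k (fun t => g (γ t)) 0 = fderiv ℝ g (γ 0) (iteratedDeriv k γ 0) := by
  obtain ⟨m, rfl⟩ : ∃ m, k = m + 1 := ⟨k - 1, by omega⟩
  have e : deriv (fun t => g (γ t)) =ᶠ[𝓝 0] fun t => fderiv ℝ g (γ t) (deriv γ t) := by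
    filter_upwards [(hγ.of_le one_le_infty).eventually (by simp),
      hγ.continuousAt.eventually ((hg.of_le one_le_infty).eventually (by simp))]
      with t h1 h2
    exact ((h2.differentiableAt (by simp)).hasFDerivAt.comp_hasDerivAt t
      (h1.differentiableAt (by simp)).hasDerivAt).deriv
  rw [iteratedDeriv_succ', e.iteratedDeriv_eq,
    iteratedDeriv_clm_apply_of_vanish (B := fun t => fderiv ℝ g (γ t))
      (ContDiffAt.comp (0 : ℝ) (hg.fderiv_right (m := ∞) (by simp)) hγ) (contDiffAt_deriv hγ)
      (fun i hi => by rw [← iteratedDeriv_succ']; exact h (i + 1) (by omega) (by omega)),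
    ← iteratedDeriv_succ']

end Calculus

/-! ### The linear part of a local action at a fixed point -/

section LocalAction

variable {V : Type*} [NormedAddCommGroup V] [NormedSpace ℝ V]

/-- The `k`-th derivative at time `0` of the curves `t ↦ f (v, t)`, as a function of `v`. -/
noncomputable def timeDeriv (f : V × ℝ → V) (k : ℕ) (v : V) : V :=
  iteratedDeriv k (fun t => f (v, t)) 0

/-- The germ at `(a, 0)` of an action of `([0, ∞), ·)`, where `a` is a point of the base.  The
time is allowed to be negative in order to have derivatives at `0`, but the multiplicativity is
only assumed for nonnegative times. -/
structure IsLocalAction (f : V × ℝ → V) (a : V) : Prop where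
  smooth : ∀ᶠ p in 𝓝 (a, (0 : ℝ)), ContDiffAt ℝ ∞ f p
  fixed : f (a, 0) = a
  mul : ∀ᶠ q : V × (ℝ × ℝ) in 𝓝 a ×ˢ (𝓝[≥] 0 ×ˢ 𝓝[≥] 0),
    f (f (q.1, q.2.1), q.2.2) = f (q.1, q.2.1 * q.2.2)

theorem contDiffAt_timeDeriv {f : V × ℝ → V} {v : V} (hf : ContDiffAt ℝ ∞ f (v, 0)) (k : ℕ) :
    ContDiffAt ℝ ∞ (timeDeriv f k) v :=
  ContDiffAt.comp (g := fun p : V × ℝ => iteratedDeriv k (fun s => f (p.1, s)) p.2) v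
    (contDiffAt_iteratedDeriv_param 0 hf k) (contDiffAt_id.prodMk contDiffAt_const)

theorem contDiffAt_curve {f : V × ℝ → V} {v : V} {t : ℝ} (hf : ContDiffAt ℝ ∞ f (v, t)) :
    ContDiffAt ℝ ∞ (fun s => f (v, s)) t :=
  ContDiffAt.comp t hf (contDiffAt_const.prodMk contDiffAt_id)

theorem contDiffAt_slice {f : V × ℝ → V} {v : V} {t : ℝ} (hf : ContDiffAt ℝ ∞ f (v, t)) :
    ContDiffAt ℝ ∞ (fun w => f (w, t)) v :=
  ContDiffAt.comp v hf (contDiffAt_id.prodMk contDiffAt_const)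

/-- The linear part at `a` of the map at time `s`. -/
noncomputable def linearPart (f : V × ℝ → V) (a : V) (s : ℝ) : V →L[ℝ] V :=
  fderiv ℝ (fun y => f (y, s)) a

theorem iteratedDeriv_pow_smul {F : Type*} [NormedAddCommGroup F] [NormedSpace ℝ F]
    (j k : ℕ) (v : F) :
    iteratedDeriv j (fun s : ℝ => s ^ k • v) 0 = if j = k then (k.factorial : ℝ) • v else 0 := by
  rw [iteratedDeriv_smul_const (by fun_prop), iteratedDeriv_fun_pow_zero]
  split_ifs <;> simp_all

namespace IsLocalAction

variable {f : V × ℝ → V} {a : V}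

theorem smooth_at (hf : IsLocalAction f a) : ContDiffAt ℝ ∞ f (a, 0) := hf.smooth.self_of_nhds

theorem tendsto_zero (hf : IsLocalAction f a) :
    Tendsto (fun y => f (y, 0)) (𝓝 a) (𝓝 a) := by
  have h := (contDiffAt_slice hf.smooth_at).continuousAt
  rwa [ContinuousAt, hf.fixed] at h

theorem eventually_smooth_slice (hf : IsLocalAction f a) :
    ∀ᶠ s in 𝓝[≥] (0 : ℝ), ContDiffAt ℝ ∞ f (a, s) :=
  nhdsWithin_le_nhds
    (((Continuous.prodMk_right a).continuousAt : Tendsto (fun s : ℝ => (a, s)) (𝓝 0) _).eventually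
      hf.smooth)

theorem eventually_fixed (hf : IsLocalAction f a) : ∀ᶠ s in 𝓝[≥] (0 : ℝ), f (a, s) = a := by
  have h1 := hf.mul.curry.self_of_nhds.curry.self_of_nhdsWithin self_mem_Ici
  filter_upwards [h1] with s hs
  simpa [hf.fixed] using hs

theorem timeDeriv_self (hf : IsLocalAction f a) {k : ℕ} (hk : 1 ≤ k) : timeDeriv f k a = 0 := by
  have h1 : iteratedDeriv k (fun t => f (a, t)) 0 = iteratedDeriv k (fun _ : ℝ => a) 0 :=
    iteratedDeriv_eq_of_eventuallyEq_nonneg (contDiffAt_curve hf.smooth_at) contDiffAt_const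
      hf.eventually_fixed k
  rw [timeDeriv, h1, iteratedDeriv_const, if_neg (by omega)]

/-- The time derivatives are homogeneous. -/
theorem timeDeriv_apply (hf : IsLocalAction f a) (k : ℕ) :
    ∀ᶠ s in 𝓝[≥] (0 : ℝ), ∀ᶠ y in 𝓝 a,
      timeDeriv f k (f (y, s)) = s ^ k • timeDeriv f k y := by
  have hm : ∀ᶠ p : V × ℝ in 𝓝 a ×ˢ 𝓝[≥] 0, ∀ᶠ t in 𝓝[≥] (0 : ℝ),
      f (f p, t) = f (p.1, p.2 * t) :=
    (tendsto_prodAssoc.eventually hf.mul).curry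
  have hle : 𝓝 a ×ˢ 𝓝[≥] (0 : ℝ) ≤ 𝓝 (a, 0) := by
    rw [nhds_prod_eq]; exact prod_mono le_rfl nhdsWithin_le_nhds
  have hc : Tendsto (fun p => (f p, (0 : ℝ))) (𝓝 (a, 0)) (𝓝 (a, 0)) := by
    have h1 : Tendsto f (𝓝 (a, 0)) (𝓝 a) := by
      have := hf.smooth_at.continuousAt
      rwa [ContinuousAt, hf.fixed] at this
    exact h1.prodMk_nhds tendsto_const_nhds
  have hc' : Tendsto (fun p : V × ℝ => (p.1, (0 : ℝ))) (𝓝 (a, 0)) (𝓝 (a, 0)) :=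
    (continuous_fst.tendsto (a, (0 : ℝ))).prodMk_nhds tendsto_const_nhds
  have key : ∀ᶠ p : V × ℝ in 𝓝 a ×ˢ 𝓝[≥] 0,
      timeDeriv f k (f p) = p.2 ^ k • timeDeriv f k p.1 := by
    filter_upwards [hm, hle (hc.eventually hf.smooth), hle (hc'.eventually hf.smooth)]
      with p h1 h2 h3
    have h4 : ContDiffAt ℝ ∞ (fun t => f (p.1, p.2 * t)) 0 := by
      have h5 : ContDiffAt ℝ ∞ f (p.1, p.2 * 0) := by rwa [mul_zero]
      have h6 : ContDiffAt ℝ ∞ (fun t : ℝ => (p.1, p.2 * t)) 0 := by fun_prop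
      exact ContDiffAt.comp (0 : ℝ) h5 h6
    rw [timeDeriv, iteratedDeriv_eq_of_eventuallyEq_nonneg (contDiffAt_curve h2) h4 h1,
      iteratedDeriv_comp_mul_left p.2 (fun t => f (p.1, t))]
    simp only [mul_zero]
    rfl
  exact (tendsto_prod_swap.eventually key).curry

theorem contDiffAt_linearPart (hf : IsLocalAction f a) : ContDiffAt ℝ ∞ (linearPart f a) 0 := by
  have h1 : ContDiffAt ℝ ∞ (Function.uncurry fun (s : ℝ) (y : V) => f (y, s)) ((0 : ℝ), a) := by
    have : ContDiffAt ℝ ∞ (fun q : ℝ × V => (q.2, q.1)) ((0 : ℝ), a) := by fun_prop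
    exact ContDiffAt.comp ((0 : ℝ), a) (g := f) hf.smooth_at this
  exact ContDiffAt.fderiv (m := ∞) h1 contDiffAt_const (by simp)

theorem iteratedDeriv_linearPart (hf : IsLocalAction f a) (j : ℕ) :
    iteratedDeriv j (linearPart f a) 0 = fderiv ℝ (timeDeriv f j) a :=
  (fderiv_iteratedDeriv_comm hf.smooth_at j).symm

theorem fderiv_timeDeriv_comp_linearPart (hf : IsLocalAction f a) (k : ℕ) :
    ∀ᶠ s in 𝓝[≥] (0 : ℝ), (fderiv ℝ (timeDeriv f k) a).comp (linearPart f a s) =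
      s ^ k • fderiv ℝ (timeDeriv f k) a := by
  filter_upwards [hf.timeDeriv_apply k, hf.eventually_fixed, hf.eventually_smooth_slice]
    with s h1 h2 h3
  have hd : DifferentiableAt ℝ (timeDeriv f k) a :=
    (contDiffAt_timeDeriv hf.smooth_at k).differentiableAt (by simp)
  have hs : HasFDerivAt (fun y => f (y, s)) (linearPart f a s) a :=
    ((contDiffAt_slice h3).differentiableAt (by simp)).hasFDerivAt
  have e1 : HasFDerivAt (fun y => timeDeriv f k (f (y, s)))
      ((fderiv ℝ (timeDeriv f k) a).comp (linearPart f a s)) a := by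
    have hd' : HasFDerivAt (timeDeriv f k) (fderiv ℝ (timeDeriv f k) a) (f (a, s)) := by
      rw [h2]; exact hd.hasFDerivAt
    exact hd'.comp a hs
  rw [← e1.fderiv, Filter.EventuallyEq.fderiv_eq h1]
  exact (hd.hasFDerivAt.const_smul (s ^ k)).fderiv

/-- The differentials of the time derivatives are orthogonal idempotents up to factorials. -/
theorem fderiv_timeDeriv_comp (hf : IsLocalAction f a) (k j : ℕ) :
    (fderiv ℝ (timeDeriv f k) a).comp (fderiv ℝ (timeDeriv f j) a) =
      if j = k then (k.factorial : ℝ) • fderiv ℝ (timeDeriv f k) a else 0 := by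
  rw [← iteratedDeriv_pow_smul, ← hf.iteratedDeriv_linearPart j]
  have h1 := iteratedDeriv_clm_apply_const
    (ContinuousLinearMap.compL ℝ V V V (fderiv ℝ (timeDeriv f k) a)) hf.contDiffAt_linearPart j
  refine h1.symm.trans (iteratedDeriv_eq_of_eventuallyEq_nonneg
    (ContDiffAt.comp (0 : ℝ) (ContinuousLinearMap.contDiff _).contDiffAt hf.contDiffAt_linearPart)
    (by fun_prop) ?_ j)
  exact hf.fderiv_timeDeriv_comp_linearPart k

/-- If an orbit over the base point `a` has vanishing time derivatives of orders `1, …, k - 1`, then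
its `k`-th derivative is an eigenvector of weight `k` of the linear part. -/
theorem fderiv_timeDeriv_apply_timeDeriv (hf : IsLocalAction f a) {k : ℕ} (hk : 1 ≤ k) :
    ∀ᶠ y in 𝓝 a, f (y, 0) = a → (∀ i, 1 ≤ i → i < k → timeDeriv f i y = 0) →
      fderiv ℝ (timeDeriv f k) a (timeDeriv f k y) = (k.factorial : ℝ) • timeDeriv f k y := by
  have hc' : Tendsto (fun y : V => (y, (0 : ℝ))) (𝓝 a) (𝓝 (a, 0)) :=
    (Continuous.prodMk_left (0 : ℝ)).continuousAt
  filter_upwards [hf.mul.curry, hc'.eventually hf.smooth] with y h1 h2 h3 h4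
  have key : ∀ᶠ s in 𝓝[≥] (0 : ℝ),
      linearPart f a s (timeDeriv f k y) = s ^ k • timeDeriv f k y := by
    filter_upwards [(tendsto_prod_swap.eventually h1).curry, hf.eventually_smooth_slice]
      with s h5 h6
    have hγ := contDiffAt_curve h2
    have h7 : ContDiffAt ℝ ∞ (fun w => f (w, s)) (f (y, 0)) := by
      rw [h3]; exact contDiffAt_slice h6
    have h8 := iteratedDeriv_comp_of_vanish hk h7 hγ h4
    rw [h3] at h8
    have h9 : ContDiffAt ℝ ∞ (fun t => f (y, s * t)) 0 := by
      have h5 : ContDiffAt ℝ ∞ f (y, s * 0) := by rwa [mul_zero]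
      have h6 : ContDiffAt ℝ ∞ (fun t : ℝ => (y, s * t)) 0 := by fun_prop
      exact ContDiffAt.comp (0 : ℝ) h5 h6
    have h10 : iteratedDeriv k (fun t => f (f (y, t), s)) 0 =
        iteratedDeriv k (fun t => f (y, s * t)) 0 := by
      refine iteratedDeriv_eq_of_eventuallyEq_nonneg (ContDiffAt.comp (0 : ℝ) h7 hγ) h9 ?_ k
      filter_upwards [h5] with t ht
      simpa [mul_comm] using ht
    rw [iteratedDeriv_comp_mul_left s (fun t => f (y, t))] at h10
    simp only [mul_zero] at h10
    exact h8.symm.trans h10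
  have h5 := iteratedDeriv_clm_apply_const
    (ContinuousLinearMap.apply ℝ V (timeDeriv f k y)) hf.contDiffAt_linearPart k
  have h6 := iteratedDeriv_pow_smul k k (timeDeriv f k y)
  rw [if_pos rfl] at h6
  rw [← h6, ← hf.iteratedDeriv_linearPart k]
  exact h5.symm.trans (iteratedDeriv_eq_of_eventuallyEq_nonneg
    (hf.contDiffAt_linearPart.clm_apply contDiffAt_const) (by fun_prop) key k)

variable (f a) in
/-- The projection of the tangent space at `a` onto the vectors of weight `k`. -/
noncomputable def weightProj (k : ℕ) : V →L[ℝ] V :=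
  (k.factorial : ℝ)⁻¹ • fderiv ℝ (timeDeriv f k) a

theorem weightProj_comp (hf : IsLocalAction f a) (k j : ℕ) :
    (weightProj f a k).comp (weightProj f a j) = if k = j then weightProj f a k else 0 := by
  have hne : (k.factorial : ℝ) ≠ 0 := by positivity
  rw [weightProj, weightProj, ContinuousLinearMap.comp_smul, ContinuousLinearMap.smul_comp,
    hf.fderiv_timeDeriv_comp]
  by_cases h : k = j
  · subst h
    rw [if_pos rfl, if_pos rfl, inv_smul_smul₀ hne]
  · rw [if_neg h, if_neg (Ne.symm h), smul_zero, smul_zero]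

theorem weightProj_apply (hf : IsLocalAction f a) (k j : ℕ) (v : V) :
    weightProj f a k (weightProj f a j v) = if k = j then weightProj f a k v else 0 := by
  have h := DFunLike.congr_fun (hf.weightProj_comp k j) v
  split_ifs at h ⊢ <;> exact h

variable (f a) in
/-- The map which is going to linearize the action near `a`: its component of weight `k` is the
component of weight `k` of the `k`-th Taylor coefficient of the orbit. -/
noncomputable def linearizer (n : ℕ) (y : V) : V :=
  ∑ k ∈ Finset.range (n + 1), weightProj f a k ((k.factorial : ℝ)⁻¹ • timeDeriv f k y)

theorem weightProj_linearizer (hf : IsLocalAction f a) {n k : ℕ} (hk : k ≤ n) (y : V) :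
    weightProj f a k (linearizer f a n y) =
      weightProj f a k ((k.factorial : ℝ)⁻¹ • timeDeriv f k y) := by
  rw [linearizer, map_sum, Finset.sum_eq_single_of_mem k (Finset.mem_range.2 (by omega))]
  · rw [hf.weightProj_apply, if_pos rfl]
  · intro j _ hj
    rw [hf.weightProj_apply, if_neg hj.symm]

theorem contDiffAt_linearizer {n : ℕ} {y : V} (h : ContDiffAt ℝ ∞ f (y, 0)) :
    ContDiffAt ℝ ∞ (linearizer f a n) y :=
  ContDiffAt.sum fun k _ => ContDiffAt.comp y (ContinuousLinearMap.contDiff _).contDiffAt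
    (contDiffAt_const.smul (contDiffAt_timeDeriv h k))

theorem hasFDerivAt_linearizer (hf : IsLocalAction f a) (n : ℕ) :
    HasFDerivAt (linearizer f a n) (∑ k ∈ Finset.range (n + 1), weightProj f a k) a := by
  refine HasFDerivAt.fun_sum fun k _ => ?_
  have h1 : HasFDerivAt (timeDeriv f k) (fderiv ℝ (timeDeriv f k) a) a :=
    ((contDiffAt_timeDeriv hf.smooth_at k).differentiableAt (by simp)).hasFDerivAt
  have h2 := (weightProj f a k).hasFDerivAt.comp a (h1.const_smul (k.factorial : ℝ)⁻¹)
  have h3 := hf.weightProj_comp k k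
  rw [if_pos rfl] at h3
  have h4 : HasFDerivAt (fun y => weightProj f a k ((k.factorial : ℝ)⁻¹ • timeDeriv f k y))
      ((weightProj f a k).comp (weightProj f a k)) a := h2
  rwa [h3] at h4

section Complete

variable [CompleteSpace V]

theorem eventually_eq_of_hasStrictFDerivAt_id {F : V → V} {a : V}
    (hF : HasStrictFDerivAt F (ContinuousLinearMap.id ℝ V) a) :
    ∀ᶠ y in 𝓝 a, F y = F a → y = a := by
  have hF' : HasStrictFDerivAt F ((ContinuousLinearEquiv.refl ℝ V : V ≃L[ℝ] V) : V →L[ℝ] V) a := hF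
  filter_upwards [hF'.eventually_left_inverse] with y hy h
  rw [← hy, h, hF'.localInverse_apply_image]

/-- Near `a`, the map `y ↦ f (y, 0)` is a retraction, hence the fixed points of it are determined by
their component of weight `0`. -/
theorem eventually_apply_zero_eq (hf : IsLocalAction f a) :
    ∀ᶠ y in 𝓝 a, weightProj f a 0 (f (y, 0)) = weightProj f a 0 a → f (y, 0) = a := by
  have h0 : HasStrictFDerivAt (fun y => f (y, 0)) (weightProj f a 0) a := by
    have h1 : ContDiffAt ℝ ∞ (fun y => f (y, 0)) a := contDiffAt_slice hf.smooth_at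
    have h2 := h1.hasStrictFDerivAt (by simp)
    have h3 : weightProj f a 0 = fderiv ℝ (fun y => f (y, 0)) a := by
      have h4 : timeDeriv f 0 = fun y => f (y, 0) := by funext y; simp [timeDeriv]
      simp [weightProj, h4]
    rwa [h3]
  have h1 : HasStrictFDerivAt (fun z => weightProj f a 0 z + (z - f (z, 0)))
      (ContinuousLinearMap.id ℝ V) a := by
    have := (weightProj f a 0).hasStrictFDerivAt (x := a) |>.add ((hasStrictFDerivAt_id a).sub h0)
    rwa [add_sub_cancel] at this
  have h2 := hf.mul.curry
  filter_upwards [hf.tendsto_zero.eventually (eventually_eq_of_hasStrictFDerivAt_id h1), h2]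
    with y h3 h4 h5
  have h6 : f (f (y, 0), 0) = f (y, 0) := by
    simpa using (h4.curry.self_of_nhdsWithin self_mem_Ici).self_of_nhdsWithin self_mem_Ici
  apply h3
  rw [h6, h5, hf.fixed]
  simp

/-- If only the base consists of points with vanishing `n`-jet, then the point `a` is isolated in
the fibre of the linearizer. -/
theorem eventually_eq_of_linearizer_eq (hf : IsLocalAction f a) {n : ℕ}
    (hvan : ∀ᶠ y in 𝓝 a, (∀ k, 1 ≤ k → k ≤ n → timeDeriv f k y = 0) → f (y, 0) = y) :
    ∀ᶠ y in 𝓝 a, linearizer f a n y = linearizer f a n a → y = a := by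
  have h1 : ∀ᶠ y in 𝓝 a, ∀ k ∈ Finset.Icc 1 n, f (y, 0) = a →
      (∀ i, 1 ≤ i → i < k → timeDeriv f i y = 0) →
      fderiv ℝ (timeDeriv f k) a (timeDeriv f k y) = (k.factorial : ℝ) • timeDeriv f k y := by
    rw [Finset.eventually_all]
    exact fun k hk => hf.fderiv_timeDeriv_apply_timeDeriv (Finset.mem_Icc.1 hk).1
  filter_upwards [hvan, hf.eventually_apply_zero_eq, h1] with y h2 h3 h4 h5
  have h6 : ∀ k ≤ n, weightProj f a k (timeDeriv f k y) = weightProj f a k (timeDeriv f k a) := by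
    intro k hk
    have h7 := congrArg (weightProj f a k) h5
    rw [hf.weightProj_linearizer hk, hf.weightProj_linearizer hk, map_smul, map_smul] at h7
    exact smul_right_injective V (inv_ne_zero (by positivity : (k.factorial : ℝ) ≠ 0)) h7
  have h7 : f (y, 0) = a := by
    apply h3
    have := h6 0 (Nat.zero_le n)
    simpa [timeDeriv, hf.fixed] using this
  rw [← h7]
  refine (h2 ?_).symm
  intro k
  induction k using Nat.strong_induction_on with
  | _ k ih =>
    intro hk hkn
    have h8 := h4 k (Finset.mem_Icc.2 ⟨hk, hkn⟩) h7 fun i hi hik => ih i hik hi (by omega)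
    have h9 := h6 k hkn
    rw [hf.timeDeriv_self hk, map_zero, weightProj, smul_apply, h8,
      inv_smul_smul₀ (by positivity)] at h9
    exact h9

/-- The weights of the linear part at `a` are `0, …, n`, and the projections onto the vectors of
these weights decompose the identity.  Otherwise there would be a curve `y (τ)` through `a` in the
common kernel of the projections along which the linearizer is constant. -/
theorem sum_weightProj (hf : IsLocalAction f a) {n : ℕ}
    (hvan : ∀ᶠ y in 𝓝 a, (∀ k, 1 ≤ k → k ≤ n → timeDeriv f k y = 0) → f (y, 0) = y) :
    ∑ k ∈ Finset.range (n + 1), weightProj f a k = ContinuousLinearMap.id ℝ V := by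
  set S := ∑ k ∈ Finset.range (n + 1), weightProj f a k with hS
  have hproj : ∀ k ≤ n, ∀ v, S (weightProj f a k v) = weightProj f a k v := by
    intro k hk v
    rw [hS, sum_apply,
      Finset.sum_eq_single_of_mem k (Finset.mem_range.2 (by omega))]
    · rw [hf.weightProj_apply, if_pos rfl]
    · intro j _ hj
      rw [hf.weightProj_apply, if_neg hj]
  have hSS : ∀ v, S (S v) = S v := by
    intro v
    have hSv : S v = ∑ k ∈ Finset.range (n + 1), weightProj f a k v := by rw [hS, sum_apply]
    rw [hSv, map_sum]
    exact Finset.sum_congr rfl fun k hk => hproj k (by have := Finset.mem_range.1 hk; omega) v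
  have hSF : ∀ y, S (linearizer f a n y) = linearizer f a n y := by
    intro y
    rw [linearizer, map_sum]
    exact Finset.sum_congr rfl fun k hk => hproj k (by have := Finset.mem_range.1 hk; omega) _
  have hkey : ∀ v, S v = 0 → v = 0 := by
    intro v hv
    have hΨ : HasStrictFDerivAt (fun y => linearizer f a n y + (y - S y))
        ((ContinuousLinearEquiv.refl ℝ V : V ≃L[ℝ] V) : V →L[ℝ] V) a := by
      have h1 : HasStrictFDerivAt (linearizer f a n) S a :=
        (contDiffAt_linearizer hf.smooth_at).hasStrictFDerivAt' (hf.hasFDerivAt_linearizer n)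
          (by simp)
      have := h1.add ((hasStrictFDerivAt_id a).sub (S.hasStrictFDerivAt (x := a)))
      rwa [add_sub_cancel] at this
    set Ψ := fun y => linearizer f a n y + (y - S y) with hΨdef
    have hSΨ : ∀ y, S (Ψ y) = linearizer f a n y := by
      intro y
      simp [hΨdef, hSF, hSS]
    have hc : Tendsto (fun τ : ℝ => Ψ a + τ • v) (𝓝 0) (𝓝 (Ψ a)) := by
      have : Continuous fun τ : ℝ => Ψ a + τ • v := by fun_prop
      simpa using this.tendsto 0
    have h2 := hc.eventually hΨ.eventually_right_inverse
    have h3 := (hΨ.localInverse_tendsto.comp hc).eventually (hf.eventually_eq_of_linearizer_eq hvan)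
    obtain ⟨τ, ⟨h4, h5⟩, hτ⟩ := (((h2.and h3).filter_mono nhdsWithin_le_nhds).and
      (self_mem_nhdsWithin : ({0}ᶜ : Set ℝ) ∈ 𝓝[≠] (0 : ℝ))).exists
    have h6 := h5 (by
      rw [← hSΨ, ← hSΨ]
      simp only [Function.comp_apply]
      rw [h4, map_add, map_smul, hv, smul_zero, add_zero])
    simp only [Function.comp_apply] at h6
    rw [h6] at h4
    have h7 : τ • v = 0 := by simpa using h4.symm
    exact (smul_eq_zero.1 h7).resolve_left hτ
  ext v
  have := hkey (v - S v) (by rw [map_sub, hSS, sub_self])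
  simpa using (sub_eq_zero.1 this).symm

end Complete

end IsLocalAction

end LocalAction

/-! ### Smooth actions and the jets of their orbits -/

section Actions

variable {E : Type v} [NormedAddCommGroup E] [NormedSpace ℝ E]
variable {M : Type u} [TopologicalSpace M] [ChartedSpace E M]

namespace SmoothAction

variable (h : SmoothAction E M)

theorem apply_zero_apply (t : ℝ≥0) (p : M) : h.toFun 0 (h.toFun t p) = h.toFun 0 p := by
  rw [← h.map_mul, zero_mul]

theorem apply_apply_zero (t : ℝ≥0) (p : M) : h.toFun t (h.toFun 0 p) = h.toFun 0 p := by
  rw [← h.map_mul, mul_zero]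

theorem mem_base_iff {p : M} : p ∈ h.base ↔ h.toFun 0 p = p :=
  ⟨by rintro ⟨q, rfl⟩; exact h.apply_zero_apply 0 q, fun hp => ⟨p, hp⟩⟩

theorem apply_of_mem_base {p : M} (hp : p ∈ h.base) (t : ℝ≥0) : h.toFun t p = p := by
  rw [← h.mem_base_iff.1 hp, h.apply_apply_zero]

theorem apply_one_apply_one (p : M) : h.toFun 1 (h.toFun 1 p) = h.toFun 1 p := by
  rw [← h.map_mul, mul_one]

theorem contMDiff (t : ℝ≥0) : ContMDiff 𝓘(ℝ, E) 𝓘(ℝ, E) ∞ (h.toFun t) := by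
  obtain ⟨ε, hε, H, hH, hHh⟩ := h.smooth
  intro p
  have h1 : ContMDiffAt (𝓘(ℝ, ℝ).prod 𝓘(ℝ, E)) 𝓘(ℝ, E) ∞ H ((t : ℝ), p) :=
    hH.contMDiffAt (prod_mem_nhds (Ioi_mem_nhds (by linarith [t.2])) univ_mem)
  have h2 : ContMDiffAt 𝓘(ℝ, E) 𝓘(ℝ, E) ∞ (fun q => H ((t : ℝ), q)) p :=
    h1.comp p (contMDiffAt_const.prodMk contMDiffAt_id)
  simpa only [hHh] using h2

theorem continuous (t : ℝ≥0) : Continuous (h.toFun t) := (h.contMDiff t).continuous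

theorem continuous_time (p : M) : Continuous fun t : ℝ≥0 => h.toFun t p := by
  obtain ⟨ε, hε, H, hH, hHh⟩ := h.smooth
  rw [continuous_iff_continuousAt]
  intro t
  have h1 : ContinuousAt H ((t : ℝ), p) :=
    hH.continuousOn.continuousAt (prod_mem_nhds (Ioi_mem_nhds (by linarith [t.2])) univ_mem)
  have h2 : ContinuousAt (fun s : ℝ≥0 => H ((s : ℝ), p)) t :=
    ContinuousAt.comp (f := fun s : ℝ≥0 => ((s : ℝ), p)) h1 (by fun_prop)
  simpa only [hHh] using h2

/-- A smooth extension of an action to small negative times. -/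
structure IsExtension (H : ℝ × M → M) : Prop where
  smooth : ∀ (t : ℝ≥0) (p : M), ∀ᶠ q in 𝓝 ((t : ℝ), p),
    ContMDiffAt (𝓘(ℝ, ℝ).prod 𝓘(ℝ, E)) 𝓘(ℝ, E) ∞ H q
  apply_eq : ∀ (t : ℝ≥0) (p : M), H ((t : ℝ), p) = h.toFun t p

theorem exists_isExtension : ∃ H, h.IsExtension H := by
  obtain ⟨ε, hε, H, hH, hHh⟩ := h.smooth
  refine ⟨H, fun t p => ?_, hHh⟩
  have ho : IsOpen (Ioi (-ε) ×ˢ (univ : Set M)) := isOpen_Ioi.prod isOpen_univ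
  filter_upwards [ho.mem_nhds (show ((t : ℝ), p) ∈ Ioi (-ε) ×ˢ (univ : Set M) from
    ⟨by simp only [mem_Ioi]; linarith [t.2], mem_univ _⟩)] with q hq
  exact hH.contMDiffAt (ho.mem_nhds hq)

theorem IsExtension.smooth_zero {h : SmoothAction E M} {H : ℝ × M → M} (hH : h.IsExtension H)
    (p : M) : ∀ᶠ q in 𝓝 ((0 : ℝ), p),
      ContMDiffAt (𝓘(ℝ, ℝ).prod 𝓘(ℝ, E)) 𝓘(ℝ, E) ∞ H q := by
  simpa using hH.smooth 0 p

theorem IsExtension.apply_zero {h : SmoothAction E M} {H : ℝ × M → M} (hH : h.IsExtension H)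
    (p : M) : H (0, p) = h.toFun 0 p := by
  simpa using hH.apply_eq 0 p

/-- The extended action, written in the charts at `p` (source) and `x` (target). -/
def localRep (H : ℝ × M → M) (x p : M) (q : E × ℝ) : E :=
  chartAt E x (H (q.2, (chartAt E p).symm q.1))

theorem orbitJet_apply (n : ℕ) (t : ℝ≥0) (p : M) :
    h.orbitJet n (h.toFun t p) = (h.orbitJet n p).scale t := by
  obtain ⟨α, hα⟩ := h.exists_orbitCurve p
  rw [h.orbitJet_eq n p α hα, CurveAtZero.scale_jet]
  refine h.orbitJet_eq n _ _ fun s => ?_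
  have h1 := hα (t * s)
  rw [NNReal.coe_mul] at h1
  rw [← h.map_mul, mul_comm s t]
  exact h1

section Manifold

variable [IsManifold 𝓘(ℝ, E) ∞ M]

theorem contDiffAt_localRep {H : ℝ × M → M} {x p : M} {q : E × ℝ}
    (hq : q.1 ∈ (chartAt E p).target)
    (hH : ContMDiffAt (𝓘(ℝ, ℝ).prod 𝓘(ℝ, E)) 𝓘(ℝ, E) ∞ H (q.2, (chartAt E p).symm q.1))
    (hx : H (q.2, (chartAt E p).symm q.1) ∈ (chartAt E x).source) :
    ContDiffAt ℝ ∞ (localRep H x p) q := by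
  have h1 : ContMDiffAt 𝓘(ℝ, E) 𝓘(ℝ, E) ∞ (chartAt E p).symm q.1 :=
    (contMDiffOn_chart_symm (I := 𝓘(ℝ, E)) (n := ∞) (H := E) (x := p)).contMDiffAt
      ((chartAt E p).open_target.mem_nhds hq)
  have h2 : ContMDiffAt 𝓘(ℝ, E) 𝓘(ℝ, E) ∞ (chartAt E x) (H (q.2, (chartAt E p).symm q.1)) :=
    (contMDiffOn_chart (I := 𝓘(ℝ, E)) (n := ∞) (H := E) (x := x)).contMDiffAt
      ((chartAt E x).open_source.mem_nhds hx)
  have h3 : ContMDiffAt 𝓘(ℝ, E × ℝ) 𝓘(ℝ, E) ∞ (fun q : E × ℝ => q.1) q :=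
    contDiff_fst.contDiffAt.contMDiffAt
  have h4 : ContMDiffAt 𝓘(ℝ, E × ℝ) 𝓘(ℝ, ℝ) ∞ (fun q : E × ℝ => q.2) q :=
    contDiff_snd.contDiffAt.contMDiffAt
  have h5 : ContMDiffAt 𝓘(ℝ, E × ℝ) (𝓘(ℝ, ℝ).prod 𝓘(ℝ, E)) ∞
      (fun q : E × ℝ => (q.2, (chartAt E p).symm q.1)) q :=
    h4.prodMk (ContMDiffAt.comp q h1 h3)
  exact (ContMDiffAt.comp q h2 (ContMDiffAt.comp q hH h5)).contDiffAt

theorem IsExtension.eventually_localRep {h : SmoothAction E M} {H : ℝ × M → M}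
    (hH : h.IsExtension H) {x p : M} (hx : h.toFun 0 p ∈ (chartAt E x).source) :
    ∀ᶠ q in 𝓝 (chartAt E p p, (0 : ℝ)), q.1 ∈ (chartAt E p).target ∧
      ContDiffAt ℝ ∞ (localRep H x p) q ∧
      H (q.2, (chartAt E p).symm q.1) ∈ (chartAt E x).source := by
  have hp := mem_chart_source E p
  have hc : Tendsto (fun q : E × ℝ => (q.2, (chartAt E p).symm q.1))
      (𝓝 (chartAt E p p, (0 : ℝ))) (𝓝 (0, p)) := by
    have h1 : Tendsto (fun q : E × ℝ => (chartAt E p).symm q.1)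
        (𝓝 (chartAt E p p, (0 : ℝ))) (𝓝 p) := by
      have h2 := (chartAt E p).continuousAt_symm ((chartAt E p).map_source hp)
      rw [ContinuousAt, (chartAt E p).left_inv hp] at h2
      exact h2.comp (continuous_fst.tendsto _)
    exact (continuous_snd.tendsto _).prodMk_nhds h1
  have h3 : Tendsto H (𝓝 (0, p)) (𝓝 (h.toFun 0 p)) := by
    have := (hH.smooth_zero p).self_of_nhds.continuousAt
    rwa [ContinuousAt, hH.apply_zero] at this
  have h4 : ∀ᶠ q : E × ℝ in 𝓝 (chartAt E p p, (0 : ℝ)), q.1 ∈ (chartAt E p).target :=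
    (continuous_fst.tendsto _).eventually
      ((chartAt E p).open_target.mem_nhds ((chartAt E p).map_source hp))
  filter_upwards [h4, hc.eventually (hH.smooth_zero p),
    (h3.comp hc).eventually ((chartAt E x).open_source.mem_nhds hx)] with q h5 h6 h7
  exact ⟨h5, contDiffAt_localRep h5 h6 h7, h7⟩

variable [FiniteDimensional ℝ E] [T2Space M]

/-- The adapted coordinates of the jet of an orbit are the time derivatives of the action. -/
theorem IsExtension.coord_orbitJet {h : SmoothAction E M} {H : ℝ × M → M}
    (hH : h.IsExtension H) {n : ℕ} {x p q : M} (hq : q ∈ (chartAt E p).source)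
    (hx : h.toFun 0 q ∈ (chartAt E x).source) (k : Fin (n + 1)) :
    (h.orbitJet n q).coord x k = timeDeriv (localRep H x p) k (chartAt E p q) := by
  have h1 : ContMDiffAt 𝓘(ℝ, ℝ) 𝓘(ℝ, E) ∞ (fun t : ℝ => H (t, q)) 0 :=
    (hH.smooth_zero q).self_of_nhds.comp (0 : ℝ) (contMDiffAt_id.prodMk contMDiffAt_const)
  rw [h.orbitJet_eq n q ⟨fun t => H (t, q), h1⟩ fun t => hH.apply_eq t q,
    CurveAtZero.coord_jet (by simpa only [hH.apply_zero] using hx)]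
  simp only [timeDeriv, localRep, (chartAt E p).left_inv hq]
  rfl

theorem base_orbitJet (n : ℕ) (p : M) : (h.orbitJet n p).base = h.toFun 0 p := by
  obtain ⟨α, hα⟩ := h.exists_orbitCurve p
  rw [h.orbitJet_eq n p α hα, CurveAtZero.base_jet]
  simpa using hα 0

theorem contMDiffAt_coord_orbitJet (n : ℕ) {x p : M} (hx : h.toFun 0 p ∈ (chartAt E x).source)
    (k : Fin (n + 1)) :
    ContMDiffAt 𝓘(ℝ, E) 𝓘(ℝ, E) ∞ (fun q => (h.orbitJet n q).coord x k) p := by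
  obtain ⟨H, hH⟩ := h.exists_isExtension
  have h1 := contDiffAt_timeDeriv (hH.eventually_localRep hx).self_of_nhds.2.1 k
  have h2 : ContMDiffAt 𝓘(ℝ, E) 𝓘(ℝ, E) ∞ (chartAt E p) p :=
    (contMDiffOn_chart (I := 𝓘(ℝ, E)) (n := ∞) (H := E) (x := p)).contMDiffAt
      (chart_source_mem_nhds E p)
  refine (ContMDiffAt.comp p h1.contMDiffAt h2).congr_of_eventuallyEq ?_
  filter_upwards [chart_source_mem_nhds E p,
    ((h.continuous 0).continuousAt).eventually ((chartAt E x).open_source.mem_nhds hx)]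
    with q h3 h4
  exact hH.coord_orbitJet h3 h4 k

end Manifold

end SmoothAction

theorem HigherTangent.coord_scale [FiniteDimensional ℝ E] [T2Space M] [IsManifold 𝓘(ℝ, E) ∞ M]
    {n : ℕ} (x : M) (t : ℝ≥0) (j : HigherTangent E M n) (k : Fin (n + 1)) :
    (j.scale t).coord x k = (t : ℝ) ^ (k : ℕ) • j.coord x k := by
  obtain ⟨α, rfl⟩ := j.exists_jet
  rw [CurveAtZero.scale_jet]
  have h0 : (α.scale t).toFun 0 = α.toFun 0 := congrArg α.toFun (mul_zero (t : ℝ))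
  by_cases hα : α.toFun 0 ∈ (chartAt E x).source
  · rw [CurveAtZero.coord_jet hα, CurveAtZero.coord_jet (h0 ▸ hα)]
    have h1 := congrFun (iteratedDeriv_comp_mul_left (t : ℝ) (chartAt E x ∘ α.toFun) k) 0
    simp only [mul_zero] at h1
    exact h1
  · have h1 : (α.jet n).coord x k = 0 := if_neg hα
    have h2 : ((α.scale t).jet n).coord x k = 0 := if_neg (h0 ▸ hα)
    rw [h1, h2, smul_zero]

/-- A jet vanishes as soon as its derivatives vanish in some chart. -/
theorem HigherTangent.vanishes_of_coord [FiniteDimensional ℝ E] [T2Space M]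
    [IsManifold 𝓘(ℝ, E) ∞ M] {n : ℕ} {x : M} {j : HigherTangent E M n}
    (hj : j.base ∈ (chartAt E x).source) (h : ∀ k : Fin (n + 1), k ≠ 0 → j.coord x k = 0) :
    j.Vanishes := by
  have hc : ∀ y z : M, y ∈ (chartAt E z).source → ∀ k : Fin (n + 1), k ≠ 0 →
      (CurveAtZero.jet n (⟨fun _ => y, contMDiffAt_const⟩ : CurveAtZero E M)).coord z k = 0 := by
    intro y z hy k hk
    have hk' : (k : ℕ) ≠ 0 := fun h => hk (Fin.ext h)
    rw [CurveAtZero.coord_jet hy]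
    exact (iteratedDeriv_const (n := (k : ℕ)) (c := chartAt E z y)).trans (if_neg hk')
  have h1 : j = CurveAtZero.jet n ⟨fun _ => j.base, contMDiffAt_const⟩ := by
    refine (HigherTangent.chart n x).injOn hj hj (funext fun k => ?_)
    by_cases hk : k = 0
    · subst hk
      exact (HigherTangent.coord_zero hj).trans (HigherTangent.coord_zero
        (j := CurveAtZero.jet n ⟨fun _ => j.base, contMDiffAt_const⟩) hj).symm
    · exact (h k hk).trans (hc _ _ hj k hk).symm
  intro k hk
  have h2 := hc j.base j.base (mem_chart_source E _) k hk
  rwa [← h1] at h2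

end Actions

/-! ### Linearization near a point of the base -/

section LinearAlgebra

variable {V : Type*} [NormedAddCommGroup V] [NormedSpace ℝ V] [FiniteDimensional ℝ V]

theorem weightVector_le (m : ℕ) {n : ℕ} (d : Fin n → ℕ)
    (i : Fin m ⊕ ((j : Fin n) × Fin (d j))) : weightVector m d i ≤ n := by
  rcases i with _ | ⟨j, _⟩
  · exact Nat.zero_le n
  · exact j.2

/-- A decomposition of the identity into orthogonal projections `P 0, …, P n` is diagonal in suitable
linear coordinates, in which `P k` selects the coordinates of weight `k`. -/
theorem exists_adapted_coordinates {n : ℕ} {P : ℕ → V →L[ℝ] V}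
    (hP : ∀ k j v, P k (P j v) = if k = j then P k v else 0)
    (hsum : ∑ k ∈ Finset.range (n + 1), P k = ContinuousLinearMap.id ℝ V) :
    ∃ (m : ℕ) (d : Fin n → ℕ) (L : V ≃L[ℝ] (Fin m ⊕ ((j : Fin n) × Fin (d j)) → ℝ)),
      ∀ k v i, L (P k v) i = if weightVector m d i = k then L v i else 0 := by
  let W : ℕ → Submodule ℝ V := fun k => LinearMap.range (P k : V →ₗ[ℝ] V)
  let B : ∀ k, Module.Basis (Fin (Module.finrank ℝ (W k))) ℝ (W k) := fun k =>
    Module.finBasis ℝ (W k)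
  let R : ∀ k, V →ₗ[ℝ] (Fin (Module.finrank ℝ (W k)) → ℝ) := fun k =>
    (B k).equivFun.toLinearMap ∘ₗ (P k : V →ₗ[ℝ] V).rangeRestrict
  have hR : ∀ k j v, R k (P j v) = if k = j then R k v else 0 := by
    intro k j v
    have h1 : (P k : V →ₗ[ℝ] V).rangeRestrict (P j v) =
        if k = j then (P k : V →ₗ[ℝ] V).rangeRestrict v else 0 := by
      apply Subtype.ext
      have := hP k j v
      split_ifs at this ⊢ <;> exact this
    simp only [R, LinearMap.comp_apply]
    rw [h1]
    split_ifs <;> simp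
  have hRsymm : ∀ k j (y : Fin (Module.finrank ℝ (W j)) → ℝ),
      R k ((B j).equivFun.symm y : W j) = if h : k = j then h ▸ y else 0 := by
    intro k j y
    obtain ⟨v, hv⟩ := ((B j).equivFun.symm y).2
    have h1 : R k (P j v) = R k ((B j).equivFun.symm y : W j) := congrArg (R k) hv
    rw [← h1, hR]
    split_ifs with h
    · subst h
      have h2 : (P k : V →ₗ[ℝ] V).rangeRestrict v = (B k).equivFun.symm y := Subtype.ext hv
      simp only [R, LinearMap.comp_apply]
      rw [h2]
      exact (B k).equivFun.apply_symm_apply y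
    · rfl
  have hzero : ∀ v, (∀ k ≤ n, R k v = 0) → v = 0 := by
    intro v hv
    have h1 := DFunLike.congr_fun hsum v
    rw [sum_apply] at h1
    rw [← ContinuousLinearMap.id_apply (R₁ := ℝ) v, ← h1]
    refine Finset.sum_eq_zero fun k hk => ?_
    have h2 := hv k (by have := Finset.mem_range.1 hk; omega)
    have h3 : (P k : V →ₗ[ℝ] V).rangeRestrict v = 0 := by
      simpa [R] using h2
    exact congrArg Subtype.val h3
  let d : Fin n → ℕ := fun j => Module.finrank ℝ (W (j + 1))
  let L₀ : V →ₗ[ℝ] (Fin (Module.finrank ℝ (W 0)) ⊕ ((j : Fin n) × Fin (d j)) → ℝ) :=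
    LinearMap.pi (Sum.elim (fun a => LinearMap.proj a ∘ₗ R 0)
      fun i => LinearMap.proj i.2 ∘ₗ R (i.1 + 1))
  have hinj : Function.Injective L₀ := by
    rw [← LinearMap.ker_eq_bot, LinearMap.ker_eq_bot']
    intro v hv
    refine hzero v fun k hk => ?_
    rcases k with _ | k
    · exact funext fun a => congrFun hv (Sum.inl a)
    · exact funext fun a => congrFun hv (Sum.inr ⟨⟨k, hk⟩, a⟩)
  have hsurj : Function.Surjective L₀ := by
    intro y
    refine ⟨((B 0).equivFun.symm fun a => y (Sum.inl a) : W 0) +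
      ∑ j : Fin n, ((B (j + 1)).equivFun.symm fun a => y (Sum.inr ⟨j, a⟩) : W (j + 1)), ?_⟩
    funext i
    rcases i with a | ⟨j, a⟩
    · change R 0 _ a = _
      rw [map_add, map_sum, hRsymm, Finset.sum_eq_zero]
      · simp
      · intro j _
        rw [hRsymm, dif_neg (by omega)]
    · change R (j + 1) _ a = _
      rw [map_add, map_sum, hRsymm, dif_neg (by omega), Finset.sum_eq_single j]
      · rw [hRsymm, dif_pos rfl]; simp
      · intro j' _ hj
        rw [hRsymm, dif_neg]
        intro h
        exact hj (Fin.ext (by omega))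
      · simp
  refine ⟨Module.finrank ℝ (W 0), d,
    (LinearEquiv.ofBijective L₀ ⟨hinj, hsurj⟩).toContinuousLinearEquiv, ?_⟩
  intro k v i
  change L₀ (P k v) i = if _ then L₀ v i else 0
  rcases i with a | ⟨j, a⟩
  · change R 0 (P k v) a = if 0 = k then R 0 v a else 0
    rw [hR]
    split_ifs <;> rfl
  · change R (j + 1) (P k v) a = if (j : ℕ) + 1 = k then R (j + 1) v a else 0
    rw [hR]
    split_ifs <;> rfl

/-- The inverse function theorem for a map tangent to the identity, with a smooth inverse on a whole
neighbourhood. -/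
theorem exists_openPartialHomeomorph_of_hasFDerivAt_id {F : V → V} {a : V}
    (hs : ∀ᶠ y in 𝓝 a, ContDiffAt ℝ ∞ F y)
    (hF : HasFDerivAt F (ContinuousLinearMap.id ℝ V) a) {N : Set V} (hN : N ∈ 𝓝 a) :
    ∃ e : OpenPartialHomeomorph V V, a ∈ e.source ∧ e.source ⊆ N ∧ (∀ y, e y = F y) ∧
      ContDiffOn ℝ ∞ e.symm e.target := by
  have : CompleteSpace V := FiniteDimensional.complete ℝ V
  have hF' : HasFDerivAt F ((ContinuousLinearEquiv.refl ℝ V : V ≃L[ℝ] V) : V →L[ℝ] V) a := hF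
  have hsa := hs.self_of_nhds
  have hstrict := hsa.hasStrictFDerivAt' hF' (by simp)
  have hinv : ∀ᶠ y in 𝓝 a, ∃ F' : V ≃L[ℝ] V, (F' : V →L[ℝ] V) = fderiv ℝ F y := by
    have h1 : ContinuousAt (fderiv ℝ F) a :=
      (hsa.fderiv_right (m := 0) (by simp)).continuousAt
    rw [ContinuousAt, hF'.fderiv] at h1
    exact h1.eventually (ContinuousLinearEquiv.nhds _)
  obtain ⟨O, hO, hOo, haO⟩ := eventually_nhds_iff.1 ((hs.and hinv).and hN)
  refine ⟨(hstrict.toOpenPartialHomeomorph F).restrOpen O hOo,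
    ⟨hstrict.mem_toOpenPartialHomeomorph_source, haO⟩, fun y hy => (hO y hy.2).2, fun y => rfl, ?_⟩
  intro z hz
  set e := (hstrict.toOpenPartialHomeomorph F).restrOpen O hOo
  obtain ⟨⟨h1, F', hF'⟩, -⟩ := hO (e.symm z) (e.map_target hz).2
  refine (e.contDiffAt_symm (f₀' := F') hz ?_ h1).contDiffWithinAt
  rw [hF']
  exact (h1.differentiableAt (by simp)).hasFDerivAt

end LinearAlgebra

section Linearization

variable {E : Type v} [NormedAddCommGroup E] [NormedSpace ℝ E]
variable {M : Type u} [TopologicalSpace M] [ChartedSpace E M] [IsManifold 𝓘(ℝ, E) ∞ M]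

namespace SmoothAction

variable {h : SmoothAction E M}

theorem IsExtension.isLocalAction {H : ℝ × M → M} (hH : h.IsExtension H) {x : M}
    (hx : x ∈ h.base) : IsLocalAction (localRep H x x) (chartAt E x x) := by
  have hx0 : h.toFun 0 x = x := h.mem_base_iff.1 hx
  have hxs := mem_chart_source E x
  have hev := hH.eventually_localRep (x := x) (p := x) (by rwa [hx0])
  refine ⟨hev.mono fun q hq => hq.2.1, ?_, ?_⟩
  · simp only [localRep, (chartAt E x).left_inv hxs, hH.apply_zero, hx0]
  · have hle : 𝓝 (chartAt E x x) ×ˢ (𝓝[≥] (0 : ℝ) ×ˢ 𝓝[≥] (0 : ℝ)) ≤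
        𝓝 (chartAt E x x) ×ˢ (𝓝 0 ×ˢ 𝓝 0) :=
      prod_mono le_rfl (prod_mono nhdsWithin_le_nhds nhdsWithin_le_nhds)
    have hc : Tendsto (fun q : E × (ℝ × ℝ) => (q.1, q.2.1))
        (𝓝 (chartAt E x x) ×ˢ (𝓝 0 ×ˢ 𝓝 0)) (𝓝 (chartAt E x x, 0)) := by
      rw [nhds_prod_eq]
      exact tendsto_fst.prodMk (tendsto_fst.comp tendsto_snd)
    have hnn : ∀ᶠ q : E × (ℝ × ℝ) in 𝓝 (chartAt E x x) ×ˢ (𝓝[≥] 0 ×ˢ 𝓝[≥] 0),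
        0 ≤ q.2.1 ∧ 0 ≤ q.2.2 :=
      ((tendsto_fst.comp tendsto_snd).eventually (self_mem_nhdsWithin : Ici (0 : ℝ) ∈ _)).and
        ((tendsto_snd.comp tendsto_snd).eventually (self_mem_nhdsWithin : Ici (0 : ℝ) ∈ _))
    filter_upwards [hle (hc.eventually hev), hnn] with q h1 ⟨h2, h3⟩
    simp only [localRep]
    rw [(chartAt E x).left_inv h1.2.2]
    congr 1
    obtain ⟨s, hs⟩ : ∃ s : ℝ≥0, (s : ℝ) = q.2.1 := ⟨⟨_, h2⟩, rfl⟩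
    obtain ⟨t, ht⟩ : ∃ t : ℝ≥0, (t : ℝ) = q.2.2 := ⟨⟨_, h3⟩, rfl⟩
    rw [← hs, ← ht, hH.apply_eq, hH.apply_eq, ← h.map_mul, mul_comm, ← NNReal.coe_mul, hH.apply_eq]

variable [FiniteDimensional ℝ E] [T2Space M]

/-- Near a point `x` of the base the action is linear and diagonal in suitable coordinates.  These
coordinates come from a function `F` which is defined and homogeneous on the preimage of a
neighbourhood `U` of `x` under `h 0`. -/
theorem IsHomogeneityStructure.exists_linearization {n : ℕ} (hh : h.IsHomogeneityStructure n)
    {x : M} (hx : x ∈ h.base) :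
    ∃ (m : ℕ) (d : Fin n → ℕ) (F : M → Fin m ⊕ ((j : Fin n) × Fin (d j)) → ℝ)
      (χ : OpenPartialHomeomorph M (Fin m ⊕ ((j : Fin n) × Fin (d j)) → ℝ)) (U : Set M),
      x ∈ χ.source ∧ χ.source ⊆ U ∧ EqOn χ F χ.source ∧
      ContMDiffOn 𝓘(ℝ, Fin m ⊕ ((j : Fin n) × Fin (d j)) → ℝ) 𝓘(ℝ, E) ∞ χ.symm χ.target ∧
      (∀ p, h.toFun 0 p ∈ U →
        ContMDiffAt 𝓘(ℝ, E) 𝓘(ℝ, Fin m ⊕ ((j : Fin n) × Fin (d j)) → ℝ) ∞ F p) ∧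
      ∀ t p i, F (h.toFun t p) i = (t : ℝ) ^ weightVector m d i * F p i := by
  obtain ⟨H, hH⟩ := h.exists_isExtension
  have hx0 : h.toFun 0 x = x := h.mem_base_iff.1 hx
  have hxs := mem_chart_source E x
  have hf : IsLocalAction (SmoothAction.localRep H x x) (chartAt E x x) := hH.isLocalAction hx
  set κ := chartAt E x with hκ
  set f : E × ℝ → E := SmoothAction.localRep H x x with hfdef
  have hcomplete : CompleteSpace E := FiniteDimensional.complete ℝ E
  have hsymm : Tendsto κ.symm (𝓝 (κ x)) (𝓝 x) := by
    have h2 := κ.continuousAt_symm (κ.map_source hxs)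
    rwa [ContinuousAt, κ.left_inv hxs] at h2
  -- the points whose orbit starts in the domain of the chart at `x`
  have hnear : ∀ᶠ y in 𝓝 (κ x), y ∈ κ.target ∧ h.toFun 0 (κ.symm y) ∈ κ.source := by
    exact Filter.Eventually.and (κ.open_target.mem_nhds (κ.map_source hxs))
      ((((h.continuous 0).tendsto x).comp hsymm).eventually
        (κ.open_source.mem_nhds (by rwa [hx0])))
  have hcoord : ∀ y, y ∈ κ.target → h.toFun 0 (κ.symm y) ∈ κ.source → ∀ k : Fin (n + 1),
      (h.orbitJet n (κ.symm y)).coord x k = timeDeriv f k y := by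
    intro y hy hy0 k
    have := hH.coord_orbitJet (n := n) (x := x) (p := x) (κ.map_target hy) hy0 k
    rwa [κ.right_inv hy] at this
  have hvan : ∀ᶠ y in 𝓝 (κ x), (∀ k, 1 ≤ k → k ≤ n → timeDeriv f k y = 0) → f (y, 0) = y := by
    filter_upwards [hnear] with y ⟨hy, hy0⟩ hk
    have h1 : (h.orbitJet n (κ.symm y)).Vanishes := by
      refine HigherTangent.vanishes_of_coord (x := x) (by rwa [h.base_orbitJet]) fun k hk0 => ?_
      rw [hcoord y hy hy0]
      have : (k : ℕ) ≠ 0 := fun h => hk0 (Fin.ext h)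
      exact hk k (by omega) (by omega)
    have h2 := h.mem_base_iff.1 ((hh _).1 h1)
    simp only [hfdef, localRep, hH.apply_zero]
    rw [h2, κ.right_inv hy]
  have hsum := hf.sum_weightProj hvan
  obtain ⟨m, d, L, hL⟩ := exists_adapted_coordinates hf.weightProj_apply hsum
  set w := weightVector m d with hw
  have hwn : ∀ i, w i ≤ n := weightVector_le m d
  let F : M → Fin m ⊕ ((j : Fin n) × Fin (d j)) → ℝ := fun p i =>
    ((w i).factorial : ℝ)⁻¹ * L ((h.orbitJet n p).coord x ⟨w i, Nat.lt_succ_iff.2 (hwn i)⟩) i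
  have hLF : ∀ y, y ∈ κ.target → h.toFun 0 (κ.symm y) ∈ κ.source →
      L (IsLocalAction.linearizer f (κ x) n y) = F (κ.symm y) := by
    intro y hy hy0
    funext i
    rw [IsLocalAction.linearizer, map_sum, Finset.sum_apply,
      Finset.sum_eq_single_of_mem (w i) (Finset.mem_range.2 (by have := hwn i; omega))]
    · rw [hL, if_pos rfl, map_smul]
      simp only [F, hcoord y hy hy0]
      rfl
    · intro k _ hk
      rw [hL, if_neg hk.symm]
  have hder := hf.hasFDerivAt_linearizer n
  rw [hsum] at hder
  have hsm : ∀ᶠ y in 𝓝 (κ x), ContDiffAt ℝ ∞ (IsLocalAction.linearizer f (κ x) n) y :=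
    (((Continuous.prodMk_left (0 : ℝ)).continuousAt :
      Tendsto (fun y : E => (y, (0 : ℝ))) (𝓝 (κ x)) _).eventually hf.smooth).mono
      fun y hy => IsLocalAction.contDiffAt_linearizer hy
  obtain ⟨e, hxe, heN, heF, hesymm⟩ :=
    exists_openPartialHomeomorph_of_hasFDerivAt_id hsm hder hnear
  let χ := (κ.trans e).trans L.toHomeomorph.toOpenPartialHomeomorph
  have hχs : ∀ p, p ∈ χ.source ↔ p ∈ κ.source ∧ κ p ∈ e.source := by
    intro p; simp [χ]
  have hχt : ∀ z, z ∈ χ.target ↔ L.symm z ∈ e.target ∧ e.symm (L.symm z) ∈ κ.target := by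
    intro z; simp [χ]
  refine ⟨m, d, F, χ, κ.source, (hχs x).2 ⟨hxs, hxe⟩, fun p hp => ((hχs p).1 hp).1, ?_, ?_, ?_, ?_⟩
  · intro p hp
    obtain ⟨h1, h2⟩ := (hχs p).1 hp
    have h3 := heN h2
    have h4 := hLF (κ p) h3.1 h3.2
    rw [κ.left_inv h1] at h4
    rw [← h4, ← heF]
    rfl
  · have h1 : ContMDiffOn 𝓘(ℝ, Fin m ⊕ ((j : Fin n) × Fin (d j)) → ℝ) 𝓘(ℝ, E) ∞
        (fun z => e.symm (L.symm z)) χ.target :=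
      (hesymm.comp L.symm.contDiff.contDiffOn fun z hz => ((hχt z).1 hz).1).contMDiffOn
    exact (contMDiffOn_chart_symm (I := 𝓘(ℝ, E)) (n := ∞) (H := E) (x := x)).comp h1
      fun z hz => ((hχt z).1 hz).2
  · intro p hp
    rw [contMDiffAt_pi_space]
    intro i
    have h1 := h.contMDiffAt_coord_orbitJet n hp ⟨w i, Nat.lt_succ_iff.2 (hwn i)⟩
    have h2 : ContDiff ℝ ∞ (fun v : E => ((w i).factorial : ℝ)⁻¹ * L v i) := by
      have : ContDiff ℝ ∞ (fun v : E => L v i) := contDiff_pi.1 L.contDiff i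
      exact contDiff_const.mul this
    exact h2.contDiffAt.contMDiffAt.comp p h1
  · intro t p i
    simp only [F]
    rw [h.orbitJet_apply, HigherTangent.coord_scale, map_smul, Pi.smul_apply, smul_eq_mul]
    ring

end SmoothAction

end Linearization

/-! ### Homogeneous coordinates -/

section HomogeneousCharts

variable {E : Type v} [NormedAddCommGroup E] [NormedSpace ℝ E]
variable {M : Type u} [TopologicalSpace M] [ChartedSpace E M]

/-- An idempotent smooth map which is the identity on a set accumulating at `a` is the identity near
`a`. -/
theorem eventually_eq_of_isIdempotent [CompleteSpace E] {r : E → E} {a : E}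
    (hr : ContDiffAt ℝ ∞ r a) (ha : r a = a) (hidem : ∀ᶠ y in 𝓝 a, r (r y) = r y)
    (hfreq : ∃ᶠ y in 𝓝 a, ∀ᶠ z in 𝓝 y, r z = z) : ∀ᶠ y in 𝓝 a, r y = y := by
  have hc : ContinuousAt (fderiv ℝ r) a := (hr.fderiv_right (m := 0) (by simp)).continuousAt
  have hder : fderiv ℝ r a = ContinuousLinearMap.id ℝ E := by
    have h1 : ∃ᶠ y in 𝓝 a, fderiv ℝ r y = ContinuousLinearMap.id ℝ E := by
      refine hfreq.mono fun y hy => ?_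
      have h2 : r =ᶠ[𝓝 y] id := hy
      rw [h2.fderiv_eq, fderiv_id]
    by_contra hne
    exact h1 (hc.eventually_ne hne)
  have hs : HasStrictFDerivAt r ((ContinuousLinearEquiv.refl ℝ E : E ≃L[ℝ] E) : E →L[ℝ] E) a := by
    have := hr.hasStrictFDerivAt (by simp)
    rw [hder] at this
    exact this
  have hca : Tendsto r (𝓝 a) (𝓝 a) := by
    have := hr.continuousAt
    rwa [ContinuousAt, ha] at this
  filter_upwards [hs.eventually_left_inverse, hca.eventually hs.eventually_left_inverse, hidem]
    with y h1 h2 h3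
  rw [← h2, h3, h1]

namespace SmoothAction

variable {h : SmoothAction E M}

section Identity

variable [FiniteDimensional ℝ E] [T2Space M] [IsManifold 𝓘(ℝ, E) ∞ M]

/-- On a connected manifold `h 1 = id`: the map `h 1` is a smooth retraction which is the identity
near the base, and the interior of its fixed point set is closed. -/
theorem IsHomogeneityStructure.apply_one [ConnectedSpace M] {n : ℕ}
    (hh : h.IsHomogeneityStructure n) (p : M) : h.toFun 1 p = p := by
  have hcomplete : CompleteSpace E := FiniteDimensional.complete ℝ E
  have hclosed : IsClosed {q | h.toFun 1 q = q} := isClosed_eq (h.continuous 1) continuous_id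
  have hne : (interior {q | h.toFun 1 q = q}).Nonempty := by
    obtain ⟨q⟩ : Nonempty M := inferInstance
    have hx : h.toFun 0 q ∈ h.base := mem_range_self q
    obtain ⟨m, d, F, χ, U, hxχ, -, hχF, -, -, hF⟩ := hh.exists_linearization hx
    refine ⟨h.toFun 0 q, mem_interior_iff_mem_nhds.2 ?_⟩
    have h1 : ∀ᶠ y in 𝓝 (h.toFun 0 q), h.toFun 1 y ∈ χ.source := by
      refine (h.continuous 1).continuousAt.eventually (χ.open_source.mem_nhds ?_)
      rwa [h.apply_apply_zero]
    filter_upwards [h1, χ.open_source.mem_nhds hxχ] with y h2 h3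
    refine χ.injOn h2 h3 ?_
    rw [hχF h2, hχF h3]
    funext i
    simp [hF]
  have hcl : IsClosed (interior {q | h.toFun 1 q = q}) := by
    refine isClosed_of_closure_subset fun q hq => ?_
    have hq1 : h.toFun 1 q = q := hclosed.closure_subset_iff.2 interior_subset hq
    set κ := chartAt E q with hκ
    have hqs : q ∈ κ.source := mem_chart_source E q
    have hsymm : Tendsto κ.symm (𝓝 (κ q)) (𝓝 q) := by
      have h2 := κ.continuousAt_symm (κ.map_source hqs)
      rwa [ContinuousAt, κ.left_inv hqs] at h2
    have hmem : ∀ᶠ y in 𝓝 (κ q), y ∈ κ.target ∧ h.toFun 1 (κ.symm y) ∈ κ.source :=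
      Filter.Eventually.and (κ.open_target.mem_nhds (κ.map_source hqs))
        ((((h.continuous 1).tendsto q).comp hsymm).eventually
          (κ.open_source.mem_nhds (by rwa [hq1])))
    have hsm : ContDiffAt ℝ ∞ (fun y => κ (h.toFun 1 (κ.symm y))) (κ q) := by
      have h1 : ContMDiffAt 𝓘(ℝ, E) 𝓘(ℝ, E) ∞ κ.symm (κ q) :=
        (contMDiffOn_chart_symm (I := 𝓘(ℝ, E)) (n := ∞) (H := E) (x := q)).contMDiffAt
          (κ.open_target.mem_nhds (κ.map_source hqs))
      have h2 : ContMDiffAt 𝓘(ℝ, E) 𝓘(ℝ, E) ∞ κ (h.toFun 1 (κ.symm (κ q))) :=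
        (contMDiffOn_chart (I := 𝓘(ℝ, E)) (n := ∞) (H := E) (x := q)).contMDiffAt
          (κ.open_source.mem_nhds (by rwa [κ.left_inv hqs, hq1]))
      exact (h2.comp (κ q) ((h.contMDiff 1).contMDiffAt.comp (κ q) h1)).contDiffAt
    have hfreq : ∃ᶠ y in 𝓝 (κ q), ∀ᶠ z in 𝓝 y, κ (h.toFun 1 (κ.symm z)) = z := by
      have h1 : ∃ᶠ q' in 𝓝 q, q' ∈ interior {q | h.toFun 1 q = q} ∧ q' ∈ κ.source :=
        (mem_closure_iff_frequently.1 hq).and_eventually (κ.open_source.mem_nhds hqs)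
      refine (κ.continuousAt hqs).frequently (h1.mono ?_)
      rintro q' ⟨h2, h3⟩
      have h4 : Tendsto κ.symm (𝓝 (κ q')) (𝓝 q') := by
        have h2 := κ.continuousAt_symm (κ.map_source h3)
        rwa [ContinuousAt, κ.left_inv h3] at h2
      filter_upwards [h4.eventually (mem_interior_iff_mem_nhds.1 h2),
        κ.open_target.mem_nhds (κ.map_source h3)] with z h5 h6
      rw [show h.toFun 1 (κ.symm z) = κ.symm z from h5, κ.right_inv h6]
    have key := eventually_eq_of_isIdempotent hsm
      (by rw [κ.left_inv hqs, hq1]) (by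
        filter_upwards [hmem] with y hy
        rw [κ.left_inv hy.2, h.apply_one_apply_one]) hfreq
    refine mem_interior_iff_mem_nhds.2 ?_
    filter_upwards [(κ.continuousAt hqs).eventually key, (κ.continuousAt hqs).eventually hmem,
      κ.open_source.mem_nhds hqs] with y h1 h2 h3
    rw [κ.left_inv h3] at h1 h2
    exact κ.injOn h2.2 h3 h1
  have huniv := IsClopen.eq_univ ⟨hcl, isOpen_interior⟩ hne
  have hp : p ∈ interior {q | h.toFun 1 q = q} := huniv.symm ▸ mem_univ p
  exact (interior_subset hp : p ∈ {q | h.toFun 1 q = q})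

end Identity

/-- Linearizing coordinates near a point of the base extend to homogeneous coordinates on the preimage
of a neighbourhood under `h 0`: an arbitrary point of the preimage is moved into the domain of the
given coordinates by `h s` with small `s > 0`, which is invertible with inverse `h s⁻¹`. -/
theorem exists_isHomogeneousChart (hone : ∀ p, h.toFun 1 p = p) {n : ℕ} {ι : Type} [Fintype ι]
    {w : ι → ℕ} (hw : ∀ i, w i ≤ n) {F : M → ι → ℝ} {χ : OpenPartialHomeomorph M (ι → ℝ)}
    {U : Set M} {x : M} (hx : x ∈ h.base) (hxχ : x ∈ χ.source) (hχU : χ.source ⊆ U)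
    (hχF : EqOn χ F χ.source)
    (hsymm : ContMDiffOn 𝓘(ℝ, ι → ℝ) 𝓘(ℝ, E) ∞ χ.symm χ.target)
    (hF : ∀ p, h.toFun 0 p ∈ U → ContMDiffAt 𝓘(ℝ, E) 𝓘(ℝ, ι → ℝ) ∞ F p)
    (hhom : ∀ t p i, F (h.toFun t p) i = (t : ℝ) ^ w i * F p i) :
    ∃ χ' : OpenPartialHomeomorph M (ι → ℝ), x ∈ χ'.source ∧
      IsHomogeneousChart (EF := E) n h.toFun w χ' := by
  classical
  let dil : ℝ≥0 → (ι → ℝ) → ι → ℝ := fun s v i => (s : ℝ) ^ w i * v i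
  have hdil : ∀ t p, F (h.toFun t p) = dil t (F p) := fun t p => funext fun i => hhom t p i
  have hdil_inv : ∀ s : ℝ≥0, s ≠ 0 → ∀ v, dil s⁻¹ (dil s v) = v := by
    intro s hs v
    funext i
    have : (s : ℝ) ≠ 0 := by exact_mod_cast hs
    simp only [dil, NNReal.coe_inv]
    rw [← mul_assoc, ← mul_pow, inv_mul_cancel₀ this, one_pow, one_mul]
  have hdil_smooth : ∀ s, ContDiff ℝ ∞ (dil s) := fun s => by
    rw [contDiff_pi]; intro i; exact contDiff_const.mul (contDiff_apply ℝ ℝ i)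
  have hdil_cont : ∀ v, Continuous fun s => dil s v := fun v => by
    refine continuous_pi fun i => ?_
    exact (NNReal.continuous_coe.pow _).mul continuous_const
  -- the points of the domain whose base point lies in the domain
  let V : Set M := χ.source ∩ h.toFun 0 ⁻¹' χ.source
  have hVo : IsOpen V := χ.open_source.inter (χ.open_source.preimage (h.continuous 0))
  have hV0 : ∀ p ∈ V, h.toFun 0 p ∈ V := fun p hp => by
    refine ⟨hp.2, ?_⟩
    change h.toFun 0 (h.toFun 0 p) ∈ χ.source
    rw [h.apply_zero_apply]; exact hp.2
  let W : Set (ι → ℝ) := χ.target ∩ χ.symm ⁻¹' V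
  have hWo : IsOpen W := χ.isOpen_inter_preimage_symm hVo
  have hVW : ∀ p ∈ V, F p ∈ W := fun p hp => by
    rw [← hχF hp.1]
    exact ⟨χ.map_source hp.1, by rw [mem_preimage, χ.left_inv hp.1]; exact hp⟩
  have hFW : ∀ v ∈ W, F (χ.symm v) = v := fun v hv => by
    rw [← hχF (χ.map_target hv.1), χ.right_inv hv.1]
  have hinjV : InjOn F V := fun p hp q hq hpq =>
    χ.injOn hp.1 hq.1 (by rw [hχF hp.1, hχF hq.1, hpq])
  let D : Set M := h.toFun 0 ⁻¹' V
  have hDo : IsOpen D := hVo.preimage (h.continuous 0)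
  let T : Set (ι → ℝ) := dil 0 ⁻¹' W
  have hTo : IsOpen T := hWo.preimage (hdil_smooth 0).continuous
  have hDT : ∀ p ∈ D, F p ∈ T := fun p hp => by
    change dil 0 (F p) ∈ W
    rw [← hdil]; exact hVW _ hp
  have hsmall : ∀ p ∈ D, ∀ᶠ s in 𝓝[>] (0 : ℝ≥0), h.toFun s p ∈ V := fun p hp =>
    nhdsWithin_le_nhds ((h.continuous_time p).continuousAt.eventually (hVo.mem_nhds hp))
  have hinjD : InjOn F D := by
    intro p hp q hq hpq
    obtain ⟨s, ⟨h1, h2⟩, hs⟩ := (((hsmall p hp).and (hsmall q hq)).and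
      (self_mem_nhdsWithin : Ioi (0 : ℝ≥0) ∈ _)).exists
    have h3 : h.toFun s p = h.toFun s q := hinjV h1 h2 (by rw [hdil, hdil, hpq])
    have hs' : s⁻¹ * s = 1 := inv_mul_cancel₀ (ne_of_gt hs)
    have h4 := congrArg (h.toFun s⁻¹) h3
    rwa [← h.map_mul, ← h.map_mul, hs', hone, hone] at h4
  let G : ℝ≥0 → (ι → ℝ) → M := fun s v => h.toFun s⁻¹ (χ.symm (dil s v))
  have hG : ∀ s v, 0 < s → dil s v ∈ W → G s v ∈ D ∧ F (G s v) = v := by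
    intro s v hs hv
    constructor
    · change h.toFun 0 _ ∈ V
      rw [h.apply_zero_apply]
      exact hV0 _ hv.2
    · rw [hdil, hFW _ hv, hdil_inv s (ne_of_gt hs)]
  have hgood : ∀ v ∈ T, ∃ s : ℝ≥0, 0 < s ∧ dil s v ∈ W := by
    intro v hv
    have h0 : ∀ᶠ s in 𝓝[>] (0 : ℝ≥0), dil s v ∈ W :=
      nhdsWithin_le_nhds ((hdil_cont v).continuousAt.eventually (hWo.mem_nhds hv))
    obtain ⟨s, h1, hs⟩ := (h0.and (self_mem_nhdsWithin : Ioi (0 : ℝ≥0) ∈ _)).exists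
    exact ⟨s, hs, h1⟩
  choose! σ hσ using hgood
  let inv : (ι → ℝ) → M := fun v => G (σ v) v
  have hinvD : ∀ v ∈ T, inv v ∈ D := fun v hv => (hG _ v (hσ v hv).1 (hσ v hv).2).1
  have hinvF : ∀ v ∈ T, F (inv v) = v := fun v hv => (hG _ v (hσ v hv).1 (hσ v hv).2).2
  have hsmooth : ContMDiffOn 𝓘(ℝ, E) 𝓘(ℝ, ι → ℝ) ∞ F D := fun p hp =>
    (hF p (hχU hp.1)).contMDiffWithinAt
  have hsmooth_inv : ContMDiffOn 𝓘(ℝ, ι → ℝ) 𝓘(ℝ, E) ∞ inv T := by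
    intro v hv
    refine ContMDiffAt.contMDiffWithinAt ?_
    obtain ⟨hs, hsW⟩ := hσ v hv
    have h1 : ContMDiffAt 𝓘(ℝ, ι → ℝ) 𝓘(ℝ, E) ∞ χ.symm (dil (σ v) v) :=
      hsymm.contMDiffAt (χ.open_target.mem_nhds hsW.1)
    have h2 : ContMDiffAt 𝓘(ℝ, ι → ℝ) 𝓘(ℝ, E) ∞ (G (σ v)) v :=
      (h.contMDiff (σ v)⁻¹).contMDiffAt.comp v
        (h1.comp v (hdil_smooth (σ v)).contDiffAt.contMDiffAt)
    refine h2.congr_of_eventuallyEq ?_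
    filter_upwards [hTo.mem_nhds hv, (hWo.preimage (hdil_smooth (σ v)).continuous).mem_nhds hsW]
      with u hu huW
    obtain ⟨h3, h4⟩ := hG _ u hs huW
    exact hinjD (hinvD u hu) h3 (by rw [hinvF u hu, h4])
  let χ' : OpenPartialHomeomorph M (ι → ℝ) :=
    { toFun := F
      invFun := inv
      source := D
      target := T
      map_source' := hDT
      map_target' := hinvD
      left_inv' := fun p hp => hinjD (hinvD _ (hDT p hp)) hp (hinvF _ (hDT p hp))
      right_inv' := hinvF
      open_source := hDo
      open_target := hTo
      continuousOn_toFun := hsmooth.continuousOn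
      continuousOn_invFun := hsmooth_inv.continuousOn }
  refine ⟨χ', ?_, hsmooth, hsmooth_inv, hw, fun p => ?_, fun t p hp => ?_,
    fun t p _ i => hhom t p i, ?_⟩
  · change h.toFun 0 x ∈ V
    have h1 := h.mem_base_iff.1 hx
    rw [h1]
    refine ⟨hxχ, ?_⟩
    rw [mem_preimage, h1]
    exact hxχ
  · change h.toFun 0 (h.toFun 0 p) ∈ V ↔ h.toFun 0 p ∈ V
    rw [h.apply_zero_apply]
  · change h.toFun 0 (h.toFun t p) ∈ V
    rw [h.apply_zero_apply]
    exact hp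
  · intro y hy z hz
    have h1 : dil 0 z = dil 0 y := by
      funext i
      by_cases hi : w i = 0
      · simp only [dil, hz i hi]
      · simp [dil, hi]
    change dil 0 z ∈ W
    rw [h1]; exact hy

end SmoothAction

end HomogeneousCharts

/-! ### Uniqueness and constancy of the rank -/

section Rank

theorem exists_hasFDerivAt_equiv {V W : Type*} [NormedAddCommGroup V] [NormedSpace ℝ V]
    [NormedAddCommGroup W] [NormedSpace ℝ W] {φ : V → W} {ψ : W → V} {a : V}
    (hφ : DifferentiableAt ℝ φ a) (hψ : DifferentiableAt ℝ ψ (φ a))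
    (h1 : ∀ᶠ v in 𝓝 a, ψ (φ v) = v) (h2 : ∀ᶠ w in 𝓝 (φ a), φ (ψ w) = w) :
    ∃ A : V ≃L[ℝ] W, HasFDerivAt φ (A : V →L[ℝ] W) a := by
  have ha : ψ (φ a) = a := h1.self_of_nhds
  have hφ' : HasFDerivAt φ (fderiv ℝ φ a) (ψ (φ a)) := by rw [ha]; exact hφ.hasFDerivAt
  have e1 : (fderiv ℝ ψ (φ a)).comp (fderiv ℝ φ a) = ContinuousLinearMap.id ℝ V := by
    have h3 := (hψ.hasFDerivAt.comp a hφ.hasFDerivAt).fderiv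
    have h4 : ψ ∘ φ =ᶠ[𝓝 a] id := h1
    rw [h4.fderiv_eq, fderiv_id] at h3
    exact h3.symm
  have e2 : (fderiv ℝ φ a).comp (fderiv ℝ ψ (φ a)) = ContinuousLinearMap.id ℝ W := by
    have h3 := (hφ'.comp (φ a) hψ.hasFDerivAt).fderiv
    have h4 : φ ∘ ψ =ᶠ[𝓝 (φ a)] id := h2
    rw [h4.fderiv_eq, fderiv_id] at h3
    exact h3.symm
  exact ⟨ContinuousLinearEquiv.equivOfInverse (fderiv ℝ φ a) (fderiv ℝ ψ (φ a))
    (fun v => DFunLike.congr_fun e1 v) fun w => DFunLike.congr_fun e2 w, hφ.hasFDerivAt⟩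

/-- The linear map `y ↦ (t ^ (w i) * y i)`. -/
noncomputable def weightDilation {ι : Type} (w : ι → ℕ) (t : ℝ) : (ι → ℝ) →L[ℝ] (ι → ℝ) :=
  ContinuousLinearMap.pi fun i => t ^ w i • ContinuousLinearMap.proj i

theorem weightDilation_apply {ι : Type} (w : ι → ℕ) (t : ℝ) (y : ι → ℝ) (i : ι) :
    weightDilation w t y i = t ^ w i * y i := rfl

theorem trace_weightDilation {ι : Type} [Fintype ι] (w : ι → ℕ) (t : ℝ) :
    LinearMap.trace ℝ (ι → ℝ) (weightDilation w t : (ι → ℝ) →ₗ[ℝ] (ι → ℝ)) = ∑ i, t ^ w i := by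
  classical
  rw [LinearMap.trace_eq_matrix_trace ℝ (Pi.basisFun ℝ ι), Matrix.trace]
  refine Finset.sum_congr rfl fun i _ => ?_
  simp [weightDilation_apply]

theorem card_filter_eq_of_sum_pow_eq {ι ι' : Type} [Fintype ι] [Fintype ι'] {w : ι → ℕ}
    {w' : ι' → ℕ} (h : ∀ t : ℝ≥0, ∑ i, (t : ℝ) ^ w i = ∑ i, (t : ℝ) ^ w' i) (k : ℕ) :
    (Finset.univ.filter fun i => w i = k).card = (Finset.univ.filter fun i => w' i = k).card := by
  have hp : (∑ i, (Polynomial.X : Polynomial ℝ) ^ w i) = ∑ i, Polynomial.X ^ w' i := by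
    refine Polynomial.eq_of_infinite_eval_eq _ _ ((Set.Ici_infinite (0 : ℝ)).mono fun t ht => ?_)
    have h2 : ∑ i, t ^ w i = ∑ i, t ^ w' i := h ⟨t, ht⟩
    simpa [Polynomial.eval_finsetSum] using h2
  have hc := congrArg (fun p => Polynomial.coeff p k) hp
  simp only [Polynomial.finsetSum_coeff, Polynomial.coeff_X_pow, Finset.sum_boole] at hc
  simpa [eq_comm] using hc

theorem weightVector_inl {m n : ℕ} (d : Fin n → ℕ) (a : Fin m) :
    weightVector m d (Sum.inl a) = 0 := rfl

theorem weightVector_inr (m : ℕ) {n : ℕ} (d : Fin n → ℕ) (i : (j : Fin n) × Fin (d j)) :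
    weightVector m d (Sum.inr i) = i.1 + 1 := rfl

theorem card_weightVector_eq_zero (m : ℕ) {n : ℕ} (d : Fin n → ℕ) :
    (Finset.univ.filter fun i => weightVector m d i = 0).card = m := by
  have : (Finset.univ.filter fun i => weightVector m d i = 0) =
      (Finset.univ : Finset (Fin m)).map Function.Embedding.inl := by
    ext i
    rcases i with i | i <;> simp [weightVector_inl, weightVector_inr]
  rw [this, Finset.card_map, Finset.card_univ, Fintype.card_fin]

theorem card_weightVector_eq_succ (m : ℕ) {n : ℕ} (d : Fin n → ℕ) (j : Fin n) :
    (Finset.univ.filter fun i => weightVector m d i = j + 1).card = d j := by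
  have : (Finset.univ.filter fun i => weightVector m d i = (j : ℕ) + 1) =
      (Finset.univ : Finset (Fin (d j))).map
        ((Function.Embedding.sigmaMk j).trans Function.Embedding.inr) := by
    ext i
    rcases i with i | ⟨j', a⟩
    · simp [weightVector_inl]
    · simp only [weightVector_inr, Finset.mem_filter, Finset.mem_univ, true_and, Finset.mem_map,
        Function.Embedding.trans_apply, Function.Embedding.sigmaMk_apply,
        Function.Embedding.inr_apply, Sum.inr.injEq, Nat.add_right_cancel_iff]
      constructor
      · intro h
        obtain rfl : j' = j := Fin.ext h
        exact ⟨a, rfl⟩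
      · rintro ⟨b, hb⟩
        exact congrArg Fin.val (congrArg Sigma.fst hb).symm
  rw [this, Finset.card_map, Finset.card_univ, Fintype.card_fin]

variable {E : Type v} [NormedAddCommGroup E] [NormedSpace ℝ E]
variable {M : Type u} [TopologicalSpace M] [ChartedSpace E M]

theorem contDiffAt_transition {ι ι' : Type} [Fintype ι] [Fintype ι']
    {χ : OpenPartialHomeomorph M (ι → ℝ)} {χ' : OpenPartialHomeomorph M (ι' → ℝ)}
    (hχ : ContMDiffOn 𝓘(ℝ, ι → ℝ) 𝓘(ℝ, E) ∞ χ.symm χ.target)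
    (hχ' : ContMDiffOn 𝓘(ℝ, E) 𝓘(ℝ, ι' → ℝ) ∞ χ' χ'.source) {x : M} (hx : x ∈ χ.source)
    (hx' : x ∈ χ'.source) : ContDiffAt ℝ ∞ (fun v => χ' (χ.symm v)) (χ x) := by
  have h1 : ContMDiffAt 𝓘(ℝ, ι → ℝ) 𝓘(ℝ, E) ∞ χ.symm (χ x) :=
    hχ.contMDiffAt (χ.open_target.mem_nhds (χ.map_source hx))
  have h2 : ContMDiffAt 𝓘(ℝ, E) 𝓘(ℝ, ι' → ℝ) ∞ χ' (χ.symm (χ x)) := by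
    rw [χ.left_inv hx]
    exact hχ'.contMDiffAt (χ'.open_source.mem_nhds hx')
  exact (h2.comp (χ x) h1).contDiffAt

theorem eventually_transition {X Y Z : Type*} [TopologicalSpace X] [TopologicalSpace Y]
    [TopologicalSpace Z] {χ : OpenPartialHomeomorph X Y} {χ' : OpenPartialHomeomorph X Z} {x : X}
    (hx : x ∈ χ.source) (hx' : x ∈ χ'.source) :
    ∀ᶠ v in 𝓝 (χ x), v ∈ χ.target ∧ χ.symm v ∈ χ'.source := by
  refine Filter.Eventually.and (χ.open_target.mem_nhds (χ.map_source hx)) ?_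
  refine (χ.continuousAt_symm (χ.map_source hx)).eventually (χ'.open_source.mem_nhds ?_)
  rwa [χ.left_inv hx]

namespace SmoothAction

variable {h : SmoothAction E M}

/-- At a point of the base, the trace of the differential of `h t` can be computed in any homogeneous
coordinates. -/
theorem sum_pow_weight_eq {n : ℕ} {ι ι' : Type} [Fintype ι] [Fintype ι'] {w : ι → ℕ} {w' : ι' → ℕ}
    {χ : OpenPartialHomeomorph M (ι → ℝ)} {χ' : OpenPartialHomeomorph M (ι' → ℝ)}
    (hχ : IsHomogeneousChart (EF := E) n h.toFun w χ)
    (hχ' : IsHomogeneousChart (EF := E) n h.toFun w' χ') {x : M} (hx : x ∈ h.base)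
    (hxχ : x ∈ χ.source) (hxχ' : x ∈ χ'.source) (t : ℝ≥0) :
    ∑ i, (t : ℝ) ^ w i = ∑ i, (t : ℝ) ^ w' i := by
  have d1 := contDiffAt_transition hχ.smooth_symm hχ'.smooth hxχ hxχ'
  have d2 := contDiffAt_transition hχ'.smooth_symm hχ.smooth hxχ' hxχ
  have e0 : χ' (χ.symm (χ x)) = χ' x := by rw [χ.left_inv hxχ]
  obtain ⟨A, hA⟩ := exists_hasFDerivAt_equiv (ψ := fun v => χ (χ'.symm v))
    (d1.differentiableAt (by simp)) (by rw [e0]; exact d2.differentiableAt (by simp))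
    (by
      filter_upwards [eventually_transition hxχ hxχ'] with v hv
      rw [χ'.left_inv hv.2, χ.right_inv hv.1])
    (by
      rw [e0]
      filter_upwards [eventually_transition hxχ' hxχ] with v hv
      rw [χ.left_inv hv.2, χ'.right_inv hv.1])
  have hfix : weightDilation w t (χ x) = χ x := by
    funext i
    rw [weightDilation_apply, ← hχ.homogeneous t x hxχ i, h.apply_of_mem_base hx]
  have hA' : HasFDerivAt (fun v => χ' (χ.symm v)) (A : (ι → ℝ) →L[ℝ] ι' → ℝ)
      (weightDilation w t (χ x)) := by rwa [hfix]
  have hcomm : (A : (ι → ℝ) →L[ℝ] ι' → ℝ).comp (weightDilation w t) =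
      (weightDilation w' t).comp (A : (ι → ℝ) →L[ℝ] ι' → ℝ) := by
    refine (hA'.comp (χ x) (weightDilation w t).hasFDerivAt).unique ?_
    refine ((weightDilation w' t).hasFDerivAt.comp (χ x) hA).congr_of_eventuallyEq ?_
    filter_upwards [eventually_transition hxχ hxχ'] with v hv
    have h1 : weightDilation w t v = χ (h.toFun t (χ.symm v)) := by
      funext i
      rw [hχ.homogeneous t _ (χ.map_target hv.1), χ.right_inv hv.1]
      rfl
    simp only [Function.comp_apply]
    rw [h1, χ.left_inv (hχ.mapsTo t _ (χ.map_target hv.1))]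
    funext i
    rw [hχ'.homogeneous t _ hv.2]
    rfl
  rw [← trace_weightDilation w, ← trace_weightDilation w',
    ← LinearMap.trace_conj' (weightDilation w t : (ι → ℝ) →ₗ[ℝ] (ι → ℝ)) A.toLinearEquiv]
  congr 1
  ext1 v
  have h1 := DFunLike.congr_fun hcomm (A.symm v)
  simpa [LinearEquiv.conj_apply] using h1

theorem rank_eq {n m m' : ℕ} {d d' : Fin n → ℕ}
    {χ : OpenPartialHomeomorph M (Fin m ⊕ ((j : Fin n) × Fin (d j)) → ℝ)}
    {χ' : OpenPartialHomeomorph M (Fin m' ⊕ ((j : Fin n) × Fin (d' j)) → ℝ)}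
    (hχ : IsHomogeneousChart (EF := E) n h.toFun (weightVector m d) χ)
    (hχ' : IsHomogeneousChart (EF := E) n h.toFun (weightVector m' d') χ') {x : M}
    (hx : x ∈ h.base) (hxχ : x ∈ χ.source) (hxχ' : x ∈ χ'.source) : m = m' ∧ d = d' := by
  have h1 := card_filter_eq_of_sum_pow_eq (sum_pow_weight_eq hχ hχ' hx hxχ hxχ')
  refine ⟨?_, funext fun j => ?_⟩
  · rw [← card_weightVector_eq_zero m d, h1, card_weightVector_eq_zero]
  · rw [← card_weightVector_eq_succ m d j, h1, card_weightVector_eq_succ]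

theorem nonempty_continuousLinearEquiv [IsManifold 𝓘(ℝ, E) ∞ M] {n : ℕ} {ι : Type} [Fintype ι] {w : ι → ℕ}
    {χ : OpenPartialHomeomorph M (ι → ℝ)} (hχ : IsHomogeneousChart (EF := E) n h.toFun w χ) {x : M}
    (hx : x ∈ χ.source) : Nonempty (E ≃L[ℝ] (ι → ℝ)) := by
  have hxs := mem_chart_source E x
  have h1 : ContMDiffAt 𝓘(ℝ, ι → ℝ) 𝓘(ℝ, E) ∞ χ.symm (χ x) :=
    hχ.smooth_symm.contMDiffAt (χ.open_target.mem_nhds (χ.map_source hx))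
  have h2 : ContMDiffAt 𝓘(ℝ, E) 𝓘(ℝ, E) ∞ (chartAt E x) (χ.symm (χ x)) := by
    rw [χ.left_inv hx]
    exact contMDiffOn_chart.contMDiffAt (chart_source_mem_nhds E x)
  have h3 : ContMDiffAt 𝓘(ℝ, E) 𝓘(ℝ, E) ∞ (chartAt E x).symm (chartAt E x x) :=
    contMDiffOn_chart_symm.contMDiffAt (chart_target_mem_nhds E x)
  have h4 : ContMDiffAt 𝓘(ℝ, E) 𝓘(ℝ, ι → ℝ) ∞ χ ((chartAt E x).symm (chartAt E x x)) := by
    rw [(chartAt E x).left_inv hxs]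
    exact hχ.smooth.contMDiffAt (χ.open_source.mem_nhds hx)
  have d1 : ContDiffAt ℝ ∞ (fun v => χ ((chartAt E x).symm v)) (chartAt E x x) :=
    (h4.comp _ h3).contDiffAt
  have d2 : ContDiffAt ℝ ∞ (fun v => chartAt E x (χ.symm v)) (χ x) := (h2.comp _ h1).contDiffAt
  have e0 : χ ((chartAt E x).symm (chartAt E x x)) = χ x := by rw [(chartAt E x).left_inv hxs]
  obtain ⟨A, -⟩ := exists_hasFDerivAt_equiv (ψ := fun v => chartAt E x (χ.symm v))
    (d1.differentiableAt (by simp)) (by rw [e0]; exact d2.differentiableAt (by simp))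
    (by
      filter_upwards [eventually_transition hxs hx] with v hv
      rw [χ.left_inv hv.2, (chartAt E x).right_inv hv.1])
    (by
      rw [e0]
      filter_upwards [eventually_transition hx hxs] with v hv
      rw [(chartAt E x).left_inv hv.2, χ.right_inv hv.1])
  exact ⟨A⟩

variable [FiniteDimensional ℝ E] [T2Space M] [IsManifold 𝓘(ℝ, E) ∞ M]

/-- All points of the base have homogeneous coordinates with the same weights, because the rank is
locally constant and the base is connected. -/
theorem IsHomogeneityStructure.exists_charts [ConnectedSpace M] {n : ℕ}
    (hh : h.IsHomogeneityStructure n) :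
    ∃ (m : ℕ) (d : Fin n → ℕ), ∀ x ∈ h.base,
      ∃ χ : OpenPartialHomeomorph M (Fin m ⊕ ((j : Fin n) × Fin (d j)) → ℝ),
        x ∈ χ.source ∧ IsHomogeneousChart (EF := E) n h.toFun (weightVector m d) χ := by
  have hloc : ∀ x : h.base, ∃ (r : ℕ × (Fin n → ℕ))
      (χ : OpenPartialHomeomorph M (Fin r.1 ⊕ ((j : Fin n) × Fin (r.2 j)) → ℝ)),
      (x : M) ∈ χ.source ∧ IsHomogeneousChart (EF := E) n h.toFun (weightVector r.1 r.2) χ := by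
    rintro ⟨x, hx⟩
    obtain ⟨m, d, F, χ, U, h1, h2, h3, h4, h5, h6⟩ := hh.exists_linearization hx
    obtain ⟨χ', h7, h8⟩ := exists_isHomogeneousChart hh.apply_one (weightVector_le m d) hx h1 h2 h3
      h4 h5 h6
    exact ⟨(m, d), χ', h7, h8⟩
  choose r χ hxχ hχ using hloc
  have hconn : PreconnectedSpace h.base :=
    Subtype.preconnectedSpace (isPreconnected_range (h.continuous 0))
  have hlc : IsLocallyConstant r := by
    rw [IsLocallyConstant.iff_eventually_eq]
    intro x
    have : ∀ᶠ y : h.base in 𝓝 x, (y : M) ∈ (χ x).source :=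
      continuous_subtype_val.continuousAt.eventually ((χ x).open_source.mem_nhds (hxχ x))
    filter_upwards [this] with y hy
    obtain ⟨h1, h2⟩ := rank_eq (hχ y) (hχ x) y.2 (hxχ y) hy
    exact Prod.ext h1 h2
  obtain ⟨q⟩ : Nonempty M := inferInstance
  let x₀ : h.base := h.proj q
  refine ⟨(r x₀).1, (r x₀).2, fun x hx => ?_⟩
  have h1 : r ⟨x, hx⟩ = r x₀ := hlc.apply_eq_of_preconnectedSpace _ _
  rw [← h1]
  exact ⟨χ ⟨x, hx⟩, hxχ ⟨x, hx⟩, hχ ⟨x, hx⟩⟩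

end SmoothAction

end Rank

/-! ### Homogeneous local trivializations -/

section HomogeneousTrivializations

variable {M B : Type*} [TopologicalSpace M] [TopologicalSpace B] {π : M → B}
variable {n : ℕ} {d : Fin n → ℕ}

/-- A local trivialization in which the maps `h t` are the homotheties of the standard graded
space. -/
def IsHomogeneousTrivialization (h : ℝ≥0 → M → M) (e : Bundle.Trivialization (GradedSpace n d) π) :
    Prop :=
  ∀ p ∈ e.source, ∀ t, (e (h t p)).2 = GradedSpace.dilation t (e p).2

theorem IsHomogeneousTrivialization.symm_dilation {h : ℝ≥0 → M → M} (hπ : ∀ t p, π (h t p) = π p)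
    {e : Bundle.Trivialization (GradedSpace n d) π} (he : IsHomogeneousTrivialization h e) {b : B}
    (hb : b ∈ e.baseSet) (t : ℝ≥0) (y : GradedSpace n d) :
    e.toOpenPartialHomeomorph.symm (b, GradedSpace.dilation t y) =
      h t (e.toOpenPartialHomeomorph.symm (b, y)) := by
  set q := e.toOpenPartialHomeomorph.symm (b, y) with hq
  have hπq : π q = b := e.proj_symm_apply' hb
  have hqs : q ∈ e.source := e.mem_source.2 (by rwa [hπq])
  have hts : h t q ∈ e.source := e.mem_source.2 (by rwa [hπ, hπq])
  have h1 : e (h t q) = (b, GradedSpace.dilation t y) := by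
    refine Prod.ext ?_ ?_
    · rw [e.coe_fst hts, hπ, hπq]
    · rw [he q hqs, hq, e.apply_symm_apply' hb]
  rw [← h1]
  exact e.toOpenPartialHomeomorph.left_inv hts

theorem IsHomogeneousTrivialization.isGradedTransition {h : ℝ≥0 → M → M}
    (hπ : ∀ t p, π (h t p) = π p) {e e' : Bundle.Trivialization (GradedSpace n d) π}
    (he : IsHomogeneousTrivialization h e) (he' : IsHomogeneousTrivialization h e') :
    IsGradedTransition e e' := by
  rintro b ⟨hb, hb'⟩ t y
  rw [he.symm_dilation hπ hb]
  refine he' _ (e'.mem_source.2 ?_) t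
  rwa [e.proj_symm_apply' hb]

theorem IsHomogeneousTrivialization.of_isGradedTransition {h : ℝ≥0 → M → M}
    (hπ : ∀ t p, π (h t p) = π p) {e : Bundle.Trivialization (GradedSpace n d) π}
    (H : ∀ b ∈ e.baseSet, ∃ e' : Bundle.Trivialization (GradedSpace n d) π, b ∈ e'.baseSet ∧
      IsHomogeneousTrivialization h e' ∧ IsGradedTransition e e') :
    IsHomogeneousTrivialization h e := by
  intro p hp t
  have hpb := e.mem_source.1 hp
  obtain ⟨e', hb', he', hee'⟩ := H (π p) hpb
  have hp' : p ∈ e'.source := e'.mem_source.2 hb'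
  have h1 := hee' (π p) ⟨hpb, hb'⟩ t (e p).2
  rw [e.symm_apply_mk_proj hp, ← he' p hp' t] at h1
  have h2 : e.toOpenPartialHomeomorph.symm (π p, GradedSpace.dilation t (e p).2) = h t p := by
    set q := e.toOpenPartialHomeomorph.symm (π p, GradedSpace.dilation t (e p).2)
    have hq : π q = π p := e.proj_symm_apply' hpb
    have hqs' : q ∈ e'.source := e'.mem_source.2 (by rwa [hq])
    have hts' : h t p ∈ e'.source := e'.mem_source.2 (by rwa [hπ])
    refine e'.toOpenPartialHomeomorph.injOn hqs' hts' (Prod.ext ?_ h1)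
    exact (e'.coe_fst hqs').trans (hq.trans ((hπ t p).symm.trans (e'.coe_fst hts').symm))
  rw [← h2, e.apply_symm_apply' hpb]

namespace GradedBundle

variable {E EB : Type*} [NormedAddCommGroup E] [NormedSpace ℝ E] [NormedAddCommGroup EB]
  [NormedSpace ℝ EB] [ChartedSpace E M] [ChartedSpace EB B]

theorem proj_homothety (G : GradedBundle n d E EB π) (t : ℝ≥0) (p : M) :
    π (G.homothety t p) = π p :=
  (G.cover (π p)).choose.proj_symm_apply' (G.cover (π p)).choose_spec.2

theorem isHomogeneousTrivialization (G : GradedBundle n d E EB π)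
    {e : Bundle.Trivialization (GradedSpace n d) π} (he : e ∈ G.atlas) :
    IsHomogeneousTrivialization G.homothety e := fun p hp t => by
  rw [G.apply_homothety he (e.mem_source.1 hp)]

/-- A graded bundle structure is determined by its homotheties. -/
theorem mem_atlas_iff (G : GradedBundle n d E EB π)
    {e : Bundle.Trivialization (GradedSpace n d) π} :
    e ∈ G.atlas ↔ IsSmoothTrivialization E EB e ∧ IsHomogeneousTrivialization G.homothety e :=
  ⟨fun he => ⟨G.smooth e he, G.isHomogeneousTrivialization he⟩, fun he =>
    G.maximal e he.1 fun _ he' =>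
      he.2.isGradedTransition G.proj_homothety (G.isHomogeneousTrivialization he')⟩

variable (E EB) in
/-- The graded bundle structure of all smooth homogeneous local trivializations. -/
def ofHomogeneous (h : ℝ≥0 → M → M) (hπ : ∀ t p, π (h t p) = π p)
    (H : ∀ b : B, ∃ e : Bundle.Trivialization (GradedSpace n d) π, b ∈ e.baseSet ∧
      IsSmoothTrivialization E EB e ∧ IsHomogeneousTrivialization h e) :
    GradedBundle n d E EB π where
  atlas := {e | IsSmoothTrivialization E EB e ∧ IsHomogeneousTrivialization h e}
  smooth _ he := he.1
  cover b := let ⟨e, hb, he⟩ := H b; ⟨e, he, hb⟩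
  compatible _ he _ he' := he.2.isGradedTransition hπ he'.2
  maximal _ he he' := ⟨he, .of_isGradedTransition hπ fun b _ =>
    let ⟨e', hb', h1⟩ := H b; ⟨e', hb', h1.2, he' e' h1⟩⟩

theorem homothety_ofHomogeneous (h : ℝ≥0 → M → M) (hπ : ∀ t p, π (h t p) = π p)
    (H : ∀ b : B, ∃ e : Bundle.Trivialization (GradedSpace n d) π, b ∈ e.baseSet ∧
      IsSmoothTrivialization E EB e ∧ IsHomogeneousTrivialization h e) :
    (ofHomogeneous E EB h hπ H).homothety = h := by
  funext t p
  obtain ⟨⟨h1, h2⟩, h3⟩ := ((ofHomogeneous E EB h hπ H).cover (π p)).choose_spec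
  exact (h2.symm_dilation hπ h3 t _).trans
    (congrArg (h t) (Bundle.Trivialization.symm_apply_mk_proj _
      ((Bundle.Trivialization.mem_source _).2 h3)))

end GradedBundle

end HomogeneousTrivializations

/-! ### The base as a submanifold and the bundle over it -/

section Base

variable {E : Type v} [NormedAddCommGroup E] [NormedSpace ℝ E]
variable {M : Type u} [TopologicalSpace M] [ChartedSpace E M]
variable {h : SmoothAction E M} {n m : ℕ} {d : Fin n → ℕ}

theorem SmoothAction.continuous_proj (h : SmoothAction E M) : Continuous h.proj :=
  (h.continuous 0).subtype_mk _

theorem SmoothAction.proj_apply (h : SmoothAction E M) (t : ℝ≥0) (p : M) :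
    h.proj (h.toFun t p) = h.proj p :=
  Subtype.ext (h.apply_zero_apply t p)

theorem SmoothAction.proj_coe (h : SmoothAction E M) (b : h.base) : h.proj b = b :=
  Subtype.ext (h.mem_base_iff.1 b.2)

section Chart

variable {χ : OpenPartialHomeomorph M (Fin m ⊕ ((j : Fin n) × Fin (d j)) → ℝ)}

theorem IsHomogeneousChart.apply_zero
    (hχ : IsHomogeneousChart (EF := E) n h.toFun (weightVector m d) χ) {p : M} (hp : p ∈ χ.source) :
    χ (h.toFun 0 p) = Sum.elim (fun a => χ p (Sum.inl a)) 0 := by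
  funext i
  rw [hχ.homogeneous 0 p hp i]
  rcases i with a | i
  · simp [weightVector_inl]
  · simp [weightVector_inr]

theorem IsHomogeneousChart.apply_base
    (hχ : IsHomogeneousChart (EF := E) n h.toFun (weightVector m d) χ) {p : M} (hp : p ∈ χ.source)
    (hb : p ∈ h.base) : Sum.elim (fun a => χ p (Sum.inl a)) 0 = χ p := by
  rw [← hχ.apply_zero hp, h.mem_base_iff.1 hb]

theorem IsHomogeneousChart.symm_mem_base
    (hχ : IsHomogeneousChart (EF := E) n h.toFun (weightVector m d) χ) {v : Fin m → ℝ}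
    (hv : Sum.elim v 0 ∈ χ.target) : h.toFun 0 (χ.symm (Sum.elim v 0)) = χ.symm (Sum.elim v 0) := by
  have hs := χ.map_target hv
  refine χ.injOn (hχ.mapsTo 0 _ hs) hs ?_
  rw [hχ.apply_zero hs, χ.right_inv hv]
  rfl

/-- The chart of the base given by the coordinates of degree `0` in homogeneous coordinates. -/
noncomputable def baseChart
    (hχ : IsHomogeneousChart (EF := E) n h.toFun (weightVector m d) χ) :
    OpenPartialHomeomorph h.base (EuclideanSpace ℝ (Fin m)) where
  toFun b := WithLp.toLp 2 fun a => χ b (Sum.inl a)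
  invFun v := h.proj (χ.symm (Sum.elim v.ofLp 0))
  source := Subtype.val ⁻¹' χ.source
  target := {v | Sum.elim v.ofLp 0 ∈ χ.target}
  map_source' b hb := by
    have := χ.map_source hb
    rwa [← hχ.apply_base hb b.2] at this
  map_target' v hv := hχ.mapsTo 0 _ (χ.map_target hv)
  left_inv' b hb := by
    apply Subtype.ext
    simp only
    rw [hχ.apply_base hb b.2, χ.left_inv hb]
    exact h.mem_base_iff.1 b.2
  right_inv' v hv := by
    simp only [SmoothAction.proj]
    rw [hχ.symm_mem_base hv, χ.right_inv hv]
    rfl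
  open_source := χ.open_source.preimage continuous_subtype_val
  open_target := by
    refine χ.open_target.preimage ?_
    refine continuous_pi fun i => ?_
    rcases i with a | i
    · exact (continuous_apply a).comp (PiLp.continuous_ofLp 2 _)
    · exact continuous_const
  continuousOn_toFun := by
    refine (PiLp.continuous_toLp 2 _).comp_continuousOn (continuousOn_pi.2 fun a => ?_)
    exact (continuous_apply _).comp_continuousOn
      (χ.continuousOn.comp continuous_subtype_val.continuousOn fun b hb => hb)
  continuousOn_invFun := by
    refine h.continuous_proj.comp_continuousOn (χ.continuousOn_symm.comp ?_ fun v hv => hv)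
    refine (continuous_pi fun i => ?_).continuousOn
    rcases i with a | i
    · exact (continuous_apply a).comp (PiLp.continuous_ofLp 2 _)
    · exact continuous_const

/-- The local trivialization of `h 0` given by homogeneous coordinates. -/
noncomputable def homogeneousTrivialization
    (hχ : IsHomogeneousChart (EF := E) n h.toFun (weightVector m d) χ) :
    Bundle.Trivialization (GradedSpace n d) h.proj where
  toFun p := (h.proj p, fun i => χ p (Sum.inr i))
  invFun q := χ.symm (Sum.elim (fun a => χ q.1 (Sum.inl a)) q.2)
  source := χ.source
  target := (Subtype.val ⁻¹' χ.source) ×ˢ univ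
  map_source' p hp := ⟨hχ.mapsTo 0 p hp, mem_univ _⟩
  map_target' q hq := χ.map_target (hχ.cylinder _ (χ.map_source hq.1) _ (by
    rintro (a | i) hi
    · rfl
    · simp [weightVector_inr] at hi))
  left_inv' p hp := by
    have h1 : Sum.elim (fun a => χ (h.proj p) (Sum.inl a)) (fun i => χ p (Sum.inr i)) = χ p := by
      funext i
      rcases i with a | i
      · exact congrFun (hχ.apply_zero hp) (Sum.inl a)
      · rfl
    simp only
    rw [h1, χ.left_inv hp]
  right_inv' q hq := by
    have ht : Sum.elim (fun a => χ q.1 (Sum.inl a)) q.2 ∈ χ.target :=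
      hχ.cylinder _ (χ.map_source hq.1) _ (by
        rintro (a | i) hi
        · rfl
        · simp [weightVector_inr] at hi)
    have hs := χ.map_target ht
    refine Prod.ext (Subtype.ext ?_) ?_
    · refine χ.injOn (hχ.mapsTo 0 _ hs) hq.1 ?_
      rw [hχ.apply_zero hs, χ.right_inv ht]
      exact hχ.apply_base hq.1 q.1.2
    · simp only
      rw [χ.right_inv ht]
      rfl
  open_source := χ.open_source
  open_target := (χ.open_source.preimage continuous_subtype_val).prod isOpen_univ
  continuousOn_toFun := by
    refine ContinuousOn.prodMk ?_ (continuousOn_pi.2 fun i =>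
      (continuous_apply _).comp_continuousOn χ.continuousOn)
    exact h.continuous_proj.continuousOn
  continuousOn_invFun := by
    refine χ.continuousOn_symm.comp (continuousOn_pi.2 fun i => ?_) fun q hq =>
      hχ.cylinder _ (χ.map_source hq.1) _ (by
        rintro (a | i) hi
        · rfl
        · simp [weightVector_inr] at hi)
    rcases i with a | i
    · exact (continuous_apply _).comp_continuousOn
        (χ.continuousOn.comp (continuous_subtype_val.comp continuous_fst).continuousOn
          fun q hq => hq.1)
    · exact ((continuous_apply i).comp continuous_snd).continuousOn
  baseSet := Subtype.val ⁻¹' χ.source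
  open_baseSet := χ.open_source.preimage continuous_subtype_val
  source_eq := by
    ext p
    exact (hχ.saturated p).symm
  target_eq := rfl
  proj_toFun _ _ := rfl

theorem isHomogeneousTrivialization_homogeneousTrivialization
    (hχ : IsHomogeneousChart (EF := E) n h.toFun (weightVector m d) χ) :
    IsHomogeneousTrivialization h.toFun (homogeneousTrivialization hχ) := fun p hp t =>
  funext fun i => hχ.homogeneous t p hp (Sum.inr i)

end Chart

end Base

/-! ### The smooth structure of the base -/

theorem trans_mem_maximalAtlas {EX X V : Type*} [NormedAddCommGroup EX] [NormedSpace ℝ EX]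
    [TopologicalSpace X] [ChartedSpace EX X] [IsManifold 𝓘(ℝ, EX) ∞ X] [NormedAddCommGroup V]
    [NormedSpace ℝ V] {χ : OpenPartialHomeomorph X V}
    (h1 : ContMDiffOn 𝓘(ℝ, EX) 𝓘(ℝ, V) ∞ χ χ.source)
    (h2 : ContMDiffOn 𝓘(ℝ, V) 𝓘(ℝ, EX) ∞ χ.symm χ.target) (L : V ≃L[ℝ] EX) :
    χ.trans L.toHomeomorph.toOpenPartialHomeomorph ∈ IsManifold.maximalAtlas 𝓘(ℝ, EX) ∞ X := by
  refine OpenPartialHomeomorph.mem_maximalAtlas_of_contMDiffOn (I := 𝓘(ℝ, EX)) (n := ∞) _ ?_ ?_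
  · have h3 : ContMDiff 𝓘(ℝ, V) 𝓘(ℝ, EX) ∞ L := L.contDiff.contMDiff
    refine (h3.comp_contMDiffOn h1).mono fun x hx => ?_
    simpa using hx
  · have h3 : ContMDiff 𝓘(ℝ, EX) 𝓘(ℝ, V) ∞ L.symm := L.symm.contDiff.contMDiff
    refine h2.comp h3.contMDiffOn fun x hx => ?_
    simpa using hx

/-- Assembling base and fibre coordinates. -/
noncomputable def sumCoordEquiv (m : ℕ) {κ : Type} [Fintype κ] :
    (EuclideanSpace ℝ (Fin m) × (κ → ℝ)) ≃L[ℝ] (Fin m ⊕ κ → ℝ) :=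
  (((EuclideanSpace.equiv (Fin m) ℝ).toLinearEquiv.prodCongr (LinearEquiv.refl ℝ (κ → ℝ))).trans
    (LinearEquiv.sumArrowLequivProdArrow (Fin m) κ ℝ ℝ).symm).toContinuousLinearEquiv

theorem sumCoordEquiv_apply (m : ℕ) {κ : Type} [Fintype κ] (v : EuclideanSpace ℝ (Fin m))
    (y : κ → ℝ) : sumCoordEquiv m (v, y) = Sum.elim v.ofLp y := by
  funext i
  rcases i with a | i <;> rfl

section Base

variable {E : Type v} [NormedAddCommGroup E] [NormedSpace ℝ E]
variable {M : Type u} [TopologicalSpace M] [ChartedSpace E M]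
variable {h : SmoothAction E M} {n m : ℕ} {d : Fin n → ℕ}

section Chart

variable {χ : OpenPartialHomeomorph M (Fin m ⊕ ((j : Fin n) × Fin (d j)) → ℝ)}

theorem contMDiffOn_symm_sumElim
    (hχ : IsHomogeneousChart (EF := E) n h.toFun (weightVector m d) χ) :
    ContMDiffOn 𝓘(ℝ, EuclideanSpace ℝ (Fin m)) 𝓘(ℝ, E) ∞
      (fun v => χ.symm (Sum.elim v.ofLp 0)) (baseChart hχ).target := by
  have h1 : ContDiff ℝ ∞ fun v : EuclideanSpace ℝ (Fin m) =>
      (Sum.elim v.ofLp 0 : Fin m ⊕ ((j : Fin n) × Fin (d j)) → ℝ) := by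
    have h2 := (sumCoordEquiv m (κ := (j : Fin n) × Fin (d j))).contDiff (n := ∞) |>.comp
      (contDiff_id.prodMk (contDiff_const (c := (0 : (j : Fin n) × Fin (d j) → ℝ))))
    simpa only [Function.comp_def, sumCoordEquiv_apply, id] using h2
  exact hχ.smooth_symm.comp h1.contMDiff.contMDiffOn fun v hv => hv

theorem contMDiffOn_baseCoord
    (hχ : IsHomogeneousChart (EF := E) n h.toFun (weightVector m d) χ) :
    ContMDiffOn 𝓘(ℝ, E) 𝓘(ℝ, EuclideanSpace ℝ (Fin m)) ∞
      (fun p => WithLp.toLp 2 fun a => χ p (Sum.inl a)) χ.source := by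
  have h1 : ContDiff ℝ ∞ fun y : Fin m ⊕ ((j : Fin n) × Fin (d j)) → ℝ =>
      (WithLp.toLp 2 fun a => y (Sum.inl a) : EuclideanSpace ℝ (Fin m)) := by
    refine (EuclideanSpace.equiv (Fin m) ℝ).symm.contDiff.comp (contDiff_pi.2 fun a => ?_)
    exact contDiff_apply ℝ ℝ (Sum.inl a)
  exact h1.contMDiff.comp_contMDiffOn hχ.smooth

variable {χ' : OpenPartialHomeomorph M (Fin m ⊕ ((j : Fin n) × Fin (d j)) → ℝ)}

theorem contDiffOn_baseChart_transition
    (hχ : IsHomogeneousChart (EF := E) n h.toFun (weightVector m d) χ)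
    (hχ' : IsHomogeneousChart (EF := E) n h.toFun (weightVector m d) χ') :
    ContDiffOn ℝ ∞ ((baseChart hχ).symm.trans (baseChart hχ'))
      ((baseChart hχ).symm.trans (baseChart hχ')).source := by
  rw [← contMDiffOn_iff_contDiffOn]
  have h1 := (contMDiffOn_baseCoord hχ').comp ((h.contMDiff 0).comp_contMDiffOn
    ((contMDiffOn_symm_sumElim hχ).mono
      (inter_subset_left : (baseChart hχ).target ∩ (baseChart hχ).symm ⁻¹' (baseChart hχ').source ⊆
        (baseChart hχ).target))) fun v hv => hv.2
  simp only [mfld_simps]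
  exact h1

end Chart

variable {χ : h.base → OpenPartialHomeomorph M (Fin m ⊕ ((j : Fin n) × Fin (d j)) → ℝ)}

/-- The atlas of the base consisting of the coordinates of degree `0` of homogeneous charts. -/
@[reducible] noncomputable def baseChartedSpace
    (hχ : ∀ b, IsHomogeneousChart (EF := E) n h.toFun (weightVector m d) (χ b))
    (hmem : ∀ b, (b : M) ∈ (χ b).source) : ChartedSpace (EuclideanSpace ℝ (Fin m)) h.base where
  atlas := Set.range fun b => baseChart (hχ b)
  chartAt b := baseChart (hχ b)
  mem_chart_source := hmem
  chart_mem_atlas b := mem_range_self b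

theorem isManifold_baseChartedSpace
    (hχ : ∀ b, IsHomogeneousChart (EF := E) n h.toFun (weightVector m d) (χ b))
    (hmem : ∀ b, (b : M) ∈ (χ b).source) :
    letI := baseChartedSpace hχ hmem
    IsManifold 𝓘(ℝ, EuclideanSpace ℝ (Fin m)) ∞ h.base := by
  let _ := baseChartedSpace hχ hmem
  refine isManifold_of_contDiffOn _ _ _ ?_
  rintro _ _ ⟨b, rfl⟩ ⟨b', rfl⟩
  have := contDiffOn_baseChart_transition (hχ b) (hχ b')
  simp only [modelWithCornersSelf_coe, modelWithCornersSelf_coe_symm, Function.id_comp,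
    Function.comp_id, preimage_id, range_id, inter_univ]
  exact this

section Smooth

variable [ChartedSpace (EuclideanSpace ℝ (Fin m)) h.base]

variable (h m d) in
/-- The charts of the base are given by the coordinates of degree `0` of homogeneous charts. -/
def HasHomogeneousBaseCharts : Prop :=
  ∀ b : h.base, ∃ (χ : OpenPartialHomeomorph M (Fin m ⊕ ((j : Fin n) × Fin (d j)) → ℝ))
    (hχ : IsHomogeneousChart (EF := E) n h.toFun (weightVector m d) χ),
    (b : M) ∈ χ.source ∧ chartAt (EuclideanSpace ℝ (Fin m)) b = baseChart hχ

namespace HasHomogeneousBaseCharts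

theorem contMDiff_proj (hb : HasHomogeneousBaseCharts h m d) :
    ContMDiff 𝓘(ℝ, E) 𝓘(ℝ, EuclideanSpace ℝ (Fin m)) ∞ h.proj := by
  intro p
  obtain ⟨χ, hχ, hpχ, hchart⟩ := hb (h.proj p)
  rw [contMDiffAt_iff_target]
  refine ⟨h.continuous_proj.continuousAt, ?_⟩
  simp only [mfld_simps, extChartAt, hchart]
  exact ((contMDiffOn_baseCoord hχ).contMDiffAt (χ.open_source.mem_nhds hpχ)).comp p
    (h.contMDiff 0).contMDiffAt

variable [IsManifold 𝓘(ℝ, EuclideanSpace ℝ (Fin m)) ∞ h.base]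

theorem contMDiff_val (hb : HasHomogeneousBaseCharts h m d) :
    ContMDiff 𝓘(ℝ, EuclideanSpace ℝ (Fin m)) 𝓘(ℝ, E) ∞ (Subtype.val : h.base → M) := by
  intro b
  obtain ⟨χ, hχ, hbχ, hchart⟩ := hb b
  have h1 : ContMDiffAt 𝓘(ℝ, EuclideanSpace ℝ (Fin m)) 𝓘(ℝ, EuclideanSpace ℝ (Fin m)) ∞
      (baseChart hχ) b := by
    rw [← hchart]
    exact contMDiffOn_chart.contMDiffAt (chart_source_mem_nhds _ b)
  have hbs : b ∈ (baseChart hχ).source := hbχ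
  have h2 := (contMDiffOn_symm_sumElim hχ).contMDiffAt
    ((baseChart hχ).open_target.mem_nhds ((baseChart hχ).map_source hbs))
  refine (h2.comp b h1).congr_of_eventuallyEq ?_
  filter_upwards [(baseChart hχ).open_source.mem_nhds hbs] with b' hb'
  have h3 : Sum.elim (fun a => χ b' (Sum.inl a)) 0 = χ b' := hχ.apply_base hb' b'.2
  change (b' : M) = χ.symm (Sum.elim (fun a => χ b' (Sum.inl a)) 0)
  rw [h3, χ.left_inv hb']

theorem isSmoothTrivialization (hb : HasHomogeneousBaseCharts h m d)
    {χ : OpenPartialHomeomorph M (Fin m ⊕ ((j : Fin n) × Fin (d j)) → ℝ)}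
    (hχ : IsHomogeneousChart (EF := E) n h.toFun (weightVector m d) χ) :
    IsSmoothTrivialization E (EuclideanSpace ℝ (Fin m)) (homogeneousTrivialization hχ) := by
  constructor
  · refine hb.contMDiff_proj.contMDiffOn.prodMk ?_
    have h1 : ContDiff ℝ ∞ fun (y : Fin m ⊕ ((j : Fin n) × Fin (d j)) → ℝ)
        (i : (j : Fin n) × Fin (d j)) => y (Sum.inr i) :=
      contDiff_pi.2 fun i => contDiff_apply ℝ ℝ (Sum.inr i)
    exact h1.contMDiff.comp_contMDiffOn hχ.smooth
  · have h1 : ContMDiffOn (𝓘(ℝ, EuclideanSpace ℝ (Fin m)).prod 𝓘(ℝ, GradedSpace n d))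
        𝓘(ℝ, Fin m ⊕ ((j : Fin n) × Fin (d j)) → ℝ) ∞
        (fun q : h.base × GradedSpace n d => Sum.elim (fun a => χ q.1 (Sum.inl a)) q.2)
        (homogeneousTrivialization hχ).target := by
      rw [contMDiffOn_pi_space]
      rintro (a | i)
      · have h2 : ContMDiffOn (𝓘(ℝ, EuclideanSpace ℝ (Fin m)).prod 𝓘(ℝ, GradedSpace n d))
            𝓘(ℝ, E) ∞ (fun q : h.base × GradedSpace n d => (q.1 : M))
            (homogeneousTrivialization hχ).target :=
          (hb.contMDiff_val.comp contMDiff_fst).contMDiffOn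
        have h3 := hχ.smooth.comp h2 fun q hq => hq.1
        rw [contMDiffOn_pi_space] at h3
        exact h3 (Sum.inl a)
      · have h2 : ContMDiffOn (𝓘(ℝ, EuclideanSpace ℝ (Fin m)).prod 𝓘(ℝ, GradedSpace n d))
            𝓘(ℝ, GradedSpace n d) ∞ (fun q : h.base × GradedSpace n d => q.2)
            (homogeneousTrivialization hχ).target := contMDiff_snd.contMDiffOn
        rw [contMDiffOn_pi_space] at h2
        exact h2 i
    exact hχ.smooth_symm.comp h1 fun q hq =>
      hχ.cylinder _ (χ.map_source hq.1) _ (by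
        rintro (a | i) hi
        · rfl
        · simp [weightVector_inr] at hi)

theorem isSmoothEmbedding_val [IsManifold 𝓘(ℝ, E) ∞ M] (hb : HasHomogeneousBaseCharts h m d)
    (L : E ≃L[ℝ] (Fin m ⊕ ((j : Fin n) × Fin (d j)) → ℝ)) :
    IsSmoothEmbedding 𝓘(ℝ, EuclideanSpace ℝ (Fin m)) 𝓘(ℝ, E) ∞ (Subtype.val : h.base → M) := by
  refine ⟨IsImmersionOfComplement.isImmersion (F := (j : Fin n) × Fin (d j) → ℝ) fun b => ?_,
    Topology.IsEmbedding.subtypeVal⟩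
  obtain ⟨χ, hχ, hbχ, hchart⟩ := hb b
  refine IsImmersionAtOfComplement.mk_of_continuousAt continuous_subtype_val.continuousAt
    ((sumCoordEquiv m).trans L.symm) (baseChart hχ)
    (χ.trans L.symm.toHomeomorph.toOpenPartialHomeomorph) hbχ (by simpa using hbχ) ?_
    (trans_mem_maximalAtlas hχ.smooth hχ.smooth_symm L.symm) ?_
  · rw [← hchart]
    exact IsManifold.chart_mem_maximalAtlas b
  · intro v hv
    have hv' : Sum.elim v.ofLp 0 ∈ χ.target := by
      simp only [mfld_simps] at hv
      exact hv
    simp only [mfld_simps]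
    change L.symm (χ (h.toFun 0 (χ.symm (Sum.elim v.ofLp 0)))) = L.symm (sumCoordEquiv m (v, 0))
    rw [hχ.symm_mem_base hv', χ.right_inv hv', sumCoordEquiv_apply]

/-- The graded bundle structure on `h 0` whose homotheties are the maps `h t`. -/
noncomputable def gradedBundle (hb : HasHomogeneousBaseCharts h m d) :
    GradedBundle n d E (EuclideanSpace ℝ (Fin m)) h.proj :=
  GradedBundle.ofHomogeneous E (EuclideanSpace ℝ (Fin m)) h.toFun h.proj_apply fun b =>
    let ⟨_, hχ, hbχ, _⟩ := hb b
    ⟨homogeneousTrivialization hχ, hbχ, hb.isSmoothTrivialization hχ,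
      isHomogeneousTrivialization_homogeneousTrivialization hχ⟩

theorem homothety_gradedBundle (hb : HasHomogeneousBaseCharts h m d) :
    hb.gradedBundle.homothety = h.toFun :=
  GradedBundle.homothety_ofHomogeneous _ _ _

end HasHomogeneousBaseCharts

end Smooth

end Base

/-! ### Uniqueness of the graded bundle structure -/

section Uniqueness

variable {E : Type*} [NormedAddCommGroup E] [NormedSpace ℝ E]
variable {M : Type*} [TopologicalSpace M] [ChartedSpace E M]
variable {n m : ℕ} {d : Fin n → ℕ}

section ChartOfTrivialization

variable {B : Type*} [TopologicalSpace B] {π : M → B}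

/-- The coordinates on the total space of a bundle given by a local trivialization and by
coordinates of the base. -/
noncomputable def trivializationChart (e : Bundle.Trivialization (GradedSpace n d) π)
    (c : OpenPartialHomeomorph B (EuclideanSpace ℝ (Fin m))) :
    OpenPartialHomeomorph M (Fin m ⊕ ((j : Fin n) × Fin (d j)) → ℝ) :=
  e.toOpenPartialHomeomorph.trans ((c.prod (OpenPartialHomeomorph.refl (GradedSpace n d))).trans
    (sumCoordEquiv m).toHomeomorph.toOpenPartialHomeomorph)

variable {e : Bundle.Trivialization (GradedSpace n d) π}
  {c : OpenPartialHomeomorph B (EuclideanSpace ℝ (Fin m))}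

theorem mem_source_trivializationChart {p : M} :
    p ∈ (trivializationChart e c).source ↔ π p ∈ e.baseSet ∧ π p ∈ c.source := by
  simp only [trivializationChart, mfld_simps, e.mem_source, mem_preimage]
  refine and_congr_right fun hp => ?_
  rw [e.coe_fst' hp]

theorem trivializationChart_apply {p : M} (hp : π p ∈ e.baseSet) :
    trivializationChart e c p = Sum.elim (c (π p)).ofLp (e p).2 := by
  change sumCoordEquiv m (c (e p).1, (e p).2) = _
  rw [sumCoordEquiv_apply, e.coe_fst' hp]

theorem mem_target_trivializationChart {z : Fin m ⊕ ((j : Fin n) × Fin (d j)) → ℝ} :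
    z ∈ (trivializationChart e c).target ↔ WithLp.toLp 2 (z ∘ Sum.inl) ∈ c.target ∧
      c.symm (WithLp.toLp 2 (z ∘ Sum.inl)) ∈ e.baseSet := by
  simp only [trivializationChart, mfld_simps, e.target_eq, mem_preimage, mem_prod, mem_univ,
    and_true]
  rfl

variable [ChartedSpace (EuclideanSpace ℝ (Fin m)) B]

theorem isHomogeneousChart_trivializationChart {h : ℝ≥0 → M → M} (hπ : ∀ t p, π (h t p) = π p)
    (hs : IsSmoothTrivialization E (EuclideanSpace ℝ (Fin m)) e)
    (he : IsHomogeneousTrivialization h e)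
    (hc : ContMDiffOn 𝓘(ℝ, EuclideanSpace ℝ (Fin m)) 𝓘(ℝ, EuclideanSpace ℝ (Fin m)) ∞ c c.source)
    (hc' : ContMDiffOn 𝓘(ℝ, EuclideanSpace ℝ (Fin m)) 𝓘(ℝ, EuclideanSpace ℝ (Fin m)) ∞
      c.symm c.target) :
    IsHomogeneousChart (EF := E) n h (weightVector m d) (trivializationChart e c) where
  smooth := by
    have h1 : ContMDiffOn 𝓘(ℝ, E) 𝓘(ℝ, EuclideanSpace ℝ (Fin m)) ∞ (fun p => (e p).1)
        (trivializationChart e c).source := fun p hp =>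
      (contMDiffAt_fst.comp_contMDiffWithinAt p (hs.1 p hp.1)).mono inter_subset_left
    have h2 : ContMDiffOn 𝓘(ℝ, E) 𝓘(ℝ, GradedSpace n d) ∞ (fun p => (e p).2)
        (trivializationChart e c).source := fun p hp =>
      (contMDiffAt_snd.comp_contMDiffWithinAt p (hs.1 p hp.1)).mono inter_subset_left
    have h3 := hc.comp h1 fun p hp => by
      have := mem_source_trivializationChart.1 hp
      simpa only [mem_preimage, e.coe_fst' this.1] using this.2
    have h4 := (sumCoordEquiv m (κ := (j : Fin n) × Fin (d j))).contDiff (n := ∞) |>.contMDiff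
    exact h4.comp_contMDiffOn (h3.prodMk_space h2)
  smooth_symm := by
    have h4 := (sumCoordEquiv m (κ := (j : Fin n) × Fin (d j))).symm.contDiff (n := ∞)
    have h5 := contDiff_fst.comp h4
    have h6 := contDiff_snd.comp h4
    refine hs.2.comp ((hc'.comp h5.contMDiff.contMDiffOn fun z hz => ?_).prodMk
      h6.contMDiff.contMDiffOn) fun z hz => ?_
    · exact (mem_target_trivializationChart.1 hz).1
    · exact e.mem_target.2 (mem_target_trivializationChart.1 hz).2
  weight_le := weightVector_le m d
  saturated p := by rw [mem_source_trivializationChart, mem_source_trivializationChart, hπ]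
  mapsTo t p hp := by rwa [mem_source_trivializationChart, hπ, ← mem_source_trivializationChart]
  homogeneous t p hp i := by
    have hb := (mem_source_trivializationChart.1 hp).1
    rw [trivializationChart_apply hb, trivializationChart_apply (by rwa [hπ]), hπ,
      he p (e.mem_source.2 hb)]
    rcases i with a | i
    · simp [weightVector_inl]
    · simp [weightVector_inr, GradedSpace.dilation]
  cylinder y hy z hz := by
    have h1 : z ∘ Sum.inl = y ∘ Sum.inl := funext fun a => hz (Sum.inl a) rfl
    rw [mem_target_trivializationChart] at hy ⊢
    rwa [h1]

end ChartOfTrivialization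

section Diffeomorph

variable {EB EB' : Type*} [NormedAddCommGroup EB] [NormedSpace ℝ EB] [NormedAddCommGroup EB']
  [NormedSpace ℝ EB'] {B B' : Type*} [TopologicalSpace B] [ChartedSpace EB B]
  [TopologicalSpace B'] [ChartedSpace EB' B'] {π : M → B} {π' : M → B'}

theorem IsSmoothTrivialization.of_diffeomorph {e : Bundle.Trivialization (GradedSpace n d) π}
    {e' : Bundle.Trivialization (GradedSpace n d) π'} (he : IsSmoothTrivialization E EB e)
    (Φ : Diffeomorph 𝓘(ℝ, EB) 𝓘(ℝ, EB') B B' ∞) (hs : e'.source = e.source)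
    (H : ∀ p ∈ e.source, e' p = (Φ (e p).1, (e p).2)) : IsSmoothTrivialization E EB' e' := by
  constructor
  · rw [hs]
    have h1 : ContMDiffOn 𝓘(ℝ, E) 𝓘(ℝ, EB) ∞ (fun p => (e p).1) e.source := fun p hp =>
      contMDiffAt_fst.comp_contMDiffWithinAt p (he.1 p hp)
    have h2 : ContMDiffOn 𝓘(ℝ, E) 𝓘(ℝ, GradedSpace n d) ∞ (fun p => (e p).2) e.source := fun p hp =>
      contMDiffAt_snd.comp_contMDiffWithinAt p (he.1 p hp)
    exact ((Φ.contMDiff.comp_contMDiffOn h1).prodMk h2).congr H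
  · have key : ∀ q ∈ e'.target, (Φ.symm q.1, q.2) ∈ e.target ∧
        e.toOpenPartialHomeomorph.symm (Φ.symm q.1, q.2) = e'.toOpenPartialHomeomorph.symm q := by
      intro q hq
      have hp : e'.toOpenPartialHomeomorph.symm q ∈ e.source := by
        rw [← hs]; exact e'.toOpenPartialHomeomorph.map_target hq
      have h1 : e' (e'.toOpenPartialHomeomorph.symm q) = q :=
        e'.toOpenPartialHomeomorph.right_inv hq
      rw [H _ hp] at h1
      have h2 : (Φ.symm q.1, q.2) = e (e'.toOpenPartialHomeomorph.symm q) := by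
        conv_lhs => rw [← h1]
        simp
      rw [h2]
      exact ⟨e.toOpenPartialHomeomorph.map_source hp, e.toOpenPartialHomeomorph.left_inv hp⟩
    have h3 : ContMDiff (𝓘(ℝ, EB').prod 𝓘(ℝ, GradedSpace n d)) (𝓘(ℝ, EB).prod 𝓘(ℝ, GradedSpace n d))
        ∞ (fun q : B' × GradedSpace n d => (Φ.symm q.1, q.2)) :=
      (Φ.symm.contMDiff.comp contMDiff_fst).prodMk contMDiff_snd
    exact (he.2.comp h3.contMDiffOn fun q hq => (key q hq).1).congr fun q hq => (key q hq).2.symm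

/-- Graded bundle structures with the same homotheties are identified by every diffeomorphism of
their bases over which the identity of the total space lies. -/
theorem GradedBundle.sameStructure {G : GradedBundle n d E EB π} {G' : GradedBundle n d E EB' π'}
    (hG : G.homothety = G'.homothety) (Φ : Diffeomorph 𝓘(ℝ, EB) 𝓘(ℝ, EB') B B' ∞)
    (hΦ : ∀ p, Φ (π p) = π' p) : G.SameStructure Φ G' := by
  intro e e' hbase H
  have hs : e'.source = e.source := by
    ext p
    rw [e.mem_source, e'.mem_source, hbase, ← hΦ]
    exact Φ.injective.mem_set_image
  have H' : ∀ p ∈ e'.source, e p = (Φ.symm (e' p).1, (e' p).2) := fun p hp => by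
    rw [H p (hs ▸ hp)]
    simp
  have hts : ∀ t, ∀ p ∈ e.source, G.homothety t p ∈ e.source := fun t p hp => by
    rw [e.mem_source] at hp ⊢
    rwa [G.proj_homothety]
  rw [GradedBundle.mem_atlas_iff, GradedBundle.mem_atlas_iff, ← hG]
  refine and_congr ⟨fun he => he.of_diffeomorph Φ hs H,
    fun he => he.of_diffeomorph Φ.symm hs.symm H'⟩ ?_
  unfold IsHomogeneousTrivialization
  rw [hs]
  refine forall₂_congr fun p hp => forall_congr' fun t => ?_
  rw [H p hp, H _ (hts t p hp)]

theorem GradedBundle.contMDiff_proj (G : GradedBundle n d E EB π) :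
    ContMDiff 𝓘(ℝ, E) 𝓘(ℝ, EB) ∞ π := by
  intro p
  obtain ⟨e, he, hp⟩ := G.cover (π p)
  have hps := e.mem_source.2 hp
  have h1 := contMDiffAt_fst.comp p
    ((G.smooth e he).1.contMDiffAt (e.open_source.mem_nhds hps))
  refine h1.congr_of_eventuallyEq ?_
  filter_upwards [e.open_source.mem_nhds hps] with q hq
  exact (e.coe_fst hq).symm

end Diffeomorph

variable {h : SmoothAction E M} [ChartedSpace (EuclideanSpace ℝ (Fin m)) h.base]
  {B : Type*} [TopologicalSpace B] {EB : Type*} [NormedAddCommGroup EB] [NormedSpace ℝ EB]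
  [ChartedSpace EB B] {π : M → B}

/-- The base of a graded bundle with homotheties `h` is canonically diffeomorphic to `h 0 (M)`. -/
theorem HasHomogeneousBaseCharts.exists_diffeomorph
    [IsManifold 𝓘(ℝ, EuclideanSpace ℝ (Fin m)) ∞ h.base] (hb : HasHomogeneousBaseCharts h m d)
    {d' : Fin n → ℕ} (G : GradedBundle n d' E EB π) (hG : G.homothety = h.toFun) :
    ∃ Φ : Diffeomorph 𝓘(ℝ, EuclideanSpace ℝ (Fin m)) 𝓘(ℝ, EB) h.base B ∞,
      ∀ p, Φ (h.proj p) = π p := by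
  have hπ : ∀ t p, π (h.toFun t p) = π p := fun t p => hG ▸ G.proj_homothety t p
  have hinj : Function.Injective fun b : h.base => π b := by
    intro b b' hbb'
    simp only at hbb'
    obtain ⟨e, he, hbe⟩ := G.cover (π b)
    have hval : ∀ b : h.base, π b ∈ e.baseSet → e b = (π b, 0) := fun b hbe => by
      have h1 := G.apply_homothety he hbe 0
      rw [hG, h.mem_base_iff.1 b.2] at h1
      rw [h1]
      refine Prod.ext rfl (funext fun i => ?_)
      simp [GradedSpace.dilation]
    refine Subtype.ext (e.toOpenPartialHomeomorph.injOn (e.mem_source.2 hbe)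
      (e.mem_source.2 (hbb' ▸ hbe)) ?_)
    exact (hval b hbe).trans (((hval b' (hbb' ▸ hbe)).trans (by rw [hbb'])).symm)
  have hproj : ∀ p, π (h.proj p) = π p := fun p => hπ 0 p
  have hlift : ∀ {e : Bundle.Trivialization (GradedSpace n d') π} {y : B}, y ∈ e.baseSet →
      π (h.proj (e.toOpenPartialHomeomorph.symm (y, 0))) = y := fun hy =>
    (hproj _).trans (Bundle.Trivialization.proj_symm_apply' _ hy)
  have hsurj : Function.Surjective fun b : h.base => π b := fun y => by
    obtain ⟨e, -, hy⟩ := G.cover y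
    exact ⟨_, hlift hy⟩
  refine ⟨⟨Equiv.ofBijective _ ⟨hinj, hsurj⟩, G.contMDiff_proj.comp hb.contMDiff_val, ?_⟩, hproj⟩
  intro y
  obtain ⟨e, he, hy⟩ := G.cover y
  have h1 : ContMDiffAt 𝓘(ℝ, EB) (𝓘(ℝ, EB).prod 𝓘(ℝ, GradedSpace n d')) ∞
      (fun y : B => (y, (0 : GradedSpace n d'))) y := contMDiffAt_id.prodMk contMDiffAt_const
  have h2 := (G.smooth e he).2.contMDiffAt (e.open_target.mem_nhds (e.mem_target.2 hy :
    ((y, (0 : GradedSpace n d')) : B × GradedSpace n d') ∈ e.target))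
  refine (hb.contMDiff_proj.contMDiffAt.comp y (h2.comp y h1)).congr_of_eventuallyEq ?_
  filter_upwards [e.open_baseSet.mem_nhds hy] with z hz
  exact (Equiv.symm_apply_eq _).2 (hlift hz).symm

/-- The rank of a graded bundle is determined by its homotheties. -/
theorem HasHomogeneousBaseCharts.rank_eq [Nonempty M] (hb : HasHomogeneousBaseCharts h m d)
    {m' : ℕ} {d' : Fin n → ℕ} [ChartedSpace (EuclideanSpace ℝ (Fin m')) B]
    [IsManifold 𝓘(ℝ, EuclideanSpace ℝ (Fin m')) ∞ B]
    (G : GradedBundle n d' E (EuclideanSpace ℝ (Fin m')) π) (hG : G.homothety = h.toFun) :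
    d' = d := by
  obtain ⟨p⟩ := ‹Nonempty M›
  obtain ⟨χ, hχ, hpχ, -⟩ := hb (h.proj p)
  obtain ⟨e, he, hpe⟩ := G.cover (π (h.proj p))
  have hχ' := isHomogeneousChart_trivializationChart (h := h.toFun)
    (c := chartAt (EuclideanSpace ℝ (Fin m')) (π (h.proj p)))
    (fun t p => hG ▸ G.proj_homothety t p) (G.smooth e he)
    (hG ▸ G.isHomogeneousTrivialization he) contMDiffOn_chart contMDiffOn_chart_symm
  exact (SmoothAction.rank_eq hχ hχ' (h.proj p).2 hpχ
    (mem_source_trivializationChart.2 ⟨hpe, mem_chart_source _ _⟩)).2.symm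

end Uniqueness

/-! ### Adapted coordinates of the higher tangent bundle -/

section AdaptedCoordinates

variable {E : Type v} [NormedAddCommGroup E] [NormedSpace ℝ E]
variable {M : Type u} [TopologicalSpace M] [ChartedSpace E M]
variable {V F : Type*} [NormedAddCommGroup V] [NormedSpace ℝ V]
variable [NormedAddCommGroup F] [NormedSpace ℝ F]

theorem contDiffAt_iteratedDeriv_comp_taylorCurve {n : ℕ} {G : V → F} {v : Fin (n + 1) → V}
    (hG : ContDiffAt ℝ ∞ G (v 0)) (k : ℕ) :
    ContDiffAt ℝ ∞ (fun w : Fin (n + 1) → V =>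
      iteratedDeriv k (fun s => G (taylorCurve w s)) 0) v := by
  have hf : ContDiffAt ℝ ∞ (fun p : (Fin (n + 1) → V) × ℝ => G (taylorCurve p.1 p.2)) (v, 0) :=
    ContDiffAt.comp (g := G) (v, (0 : ℝ)) (by rwa [taylorCurve_zero])
      contDiff_taylorCurve.contDiffAt
  have h3 := contDiffAt_iteratedDeriv_param 0 hf k
  exact ContDiffAt.comp (g := fun p : (Fin (n + 1) → V) × ℝ => iteratedDeriv k (fun s =>
      G (taylorCurve p.1 s)) p.2) v h3 (contDiffAt_id.prodMk contDiffAt_const)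

/-- A diffeomorphism from an open subset of a manifold onto an open subset of a normed space. -/
structure IsSmoothChart (χ : OpenPartialHomeomorph M V) : Prop where
  smooth : ContMDiffOn 𝓘(ℝ, E) 𝓘(ℝ, V) ∞ χ χ.source
  smooth_symm : ContMDiffOn 𝓘(ℝ, V) 𝓘(ℝ, E) ∞ χ.symm χ.target

variable {χ : OpenPartialHomeomorph M V}

namespace IsSmoothChart

theorem contDiffAt_comp (hχ : IsSmoothChart (E := E) χ) {α : CurveAtZero E M}
    (hα : α.toFun 0 ∈ χ.source) : ContDiffAt ℝ ∞ (fun s => χ (α.toFun s)) 0 :=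
  ((hχ.smooth.contMDiffAt (χ.open_source.mem_nhds hα)).comp (0 : ℝ) α.smoothAt :
    ContMDiffAt _ _ _ _ _).contDiffAt

theorem jet_eq (hχ : IsSmoothChart (E := E) χ) {n : ℕ} {α β : CurveAtZero E M}
    (hα : α.toFun 0 ∈ χ.source) (hβ : β.toFun 0 ∈ χ.source)
    (h : ∀ k ≤ n, iteratedDeriv k (fun s => χ (α.toFun s)) 0 =
      iteratedDeriv k (fun s => χ (β.toFun s)) 0) : α.jet n = β.jet n := by
  rw [CurveAtZero.jet_eq_iff]
  intro f hf k hk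
  have hcongr : ∀ γ : CurveAtZero E M, γ.toFun 0 ∈ χ.source →
      (f ∘ γ.toFun) =ᶠ[𝓝 0] ((f ∘ χ.symm) ∘ fun s => χ (γ.toFun s)) := by
    intro γ hγ
    filter_upwards [γ.smoothAt.continuousAt.eventually (χ.open_source.mem_nhds hγ)] with s hs
    simp only [Function.comp_apply]
    rw [χ.left_inv hs]
  rw [(hcongr α hα).iteratedDeriv_eq, (hcongr β hβ).iteratedDeriv_eq]
  refine iteratedDeriv_comp_eq_of_eq ?_ (hχ.contDiffAt_comp hα) (hχ.contDiffAt_comp hβ) h hk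
  exact (hf.contMDiffAt.comp (χ (α.toFun 0)) (hχ.smooth_symm.contMDiffAt
    (χ.open_target.mem_nhds (χ.map_source hα))) : ContMDiffAt _ _ _ _ _).contDiffAt

/-- The curve in `M` that is in the given chart the polynomial curve with the derivatives `v k`. -/
noncomputable def curve (hχ : IsSmoothChart (E := E) χ) {n : ℕ} {v : Fin (n + 1) → V}
    (hv : v 0 ∈ χ.target) : CurveAtZero E M where
  toFun s := χ.symm (taylorCurve v s)
  smoothAt := by
    have h1 : ContMDiffAt 𝓘(ℝ, V) 𝓘(ℝ, E) ∞ χ.symm (taylorCurve v 0) :=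
      hχ.smooth_symm.contMDiffAt (χ.open_target.mem_nhds (by rwa [taylorCurve_zero]))
    have h2 : ContDiffAt ℝ ∞ (fun t => taylorCurve v t) (0 : ℝ) :=
      (contDiff_taylorCurve.comp (contDiff_const.prodMk contDiff_id)).contDiffAt
    exact h1.comp (0 : ℝ) h2.contMDiffAt

theorem curve_zero (hχ : IsSmoothChart (E := E) χ) {n : ℕ} {v : Fin (n + 1) → V}
    (hv : v 0 ∈ χ.target) : (hχ.curve hv).toFun 0 = χ.symm (v 0) :=
  congrArg χ.symm (taylorCurve_zero v)

end IsSmoothChart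

variable {n : ℕ}

variable (χ) in
/-- The derivatives at `0`, in the coordinates `χ`, of a curve representing a jet. -/
noncomputable def HigherTangent.chartCoord (j : HigherTangent E M n) (k : Fin (n + 1)) : V :=
  iteratedDeriv (k : ℕ) (fun s => χ (j.exists_jet.choose.toFun s)) 0

open Classical in
/-- The jet with prescribed derivatives in the coordinates `χ` (with a dummy value when they are out
of range). -/
noncomputable def IsSmoothChart.jetOfCoord (hχ : IsSmoothChart (E := E) χ) (v : Fin (n + 1) → V) :
    HigherTangent E M n :=
  if hv : v 0 ∈ χ.target then (hχ.curve hv).jet n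
  else CurveAtZero.jet n ⟨fun _ => χ.symm (v 0), contMDiffAt_const⟩

theorem IsSmoothChart.jetOfCoord_of_mem (hχ : IsSmoothChart (E := E) χ) {v : Fin (n + 1) → V}
    (hv : v 0 ∈ χ.target) : hχ.jetOfCoord v = (hχ.curve hv).jet n :=
  dif_pos hv

variable [FiniteDimensional ℝ E] [T2Space M] [IsManifold 𝓘(ℝ, E) ∞ M]

theorem HigherTangent.continuous_base :
    Continuous (HigherTangent.base (E := E) (M := M) (n := n)) := by
  rw [continuous_iff_continuousAt]
  intro j
  have hs := mem_chart_source (Fin (n + 1) → E) j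
  have h1 : ContinuousAt (fun j' : HigherTangent E M n =>
      (chartAt E j.base).symm (chartAt (Fin (n + 1) → E) j j' 0)) j := by
    refine ContinuousAt.comp (g := (chartAt E j.base).symm) ?_ ((continuous_apply 0).continuousAt.comp
      ((chartAt (Fin (n + 1) → E) j).continuousAt hs))
    refine (chartAt E j.base).continuousAt_symm ?_
    exact (chartAt (Fin (n + 1) → E) j).map_source hs
  refine h1.congr ?_
  filter_upwards [chart_source_mem_nhds (Fin (n + 1) → E) j] with j' hj'
  have h2 : j'.coord j.base 0 = chartAt E j.base j'.base := HigherTangent.coord_zero hj'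
  change (chartAt E j.base).symm (j'.coord j.base 0) = _
  rw [h2]
  exact (chartAt E j.base).left_inv hj'

namespace IsSmoothChart

theorem chartCoord_jet (hχ : IsSmoothChart (E := E) χ) {α : CurveAtZero E M}
    (hα : α.toFun 0 ∈ χ.source) (k : Fin (n + 1)) :
    (α.jet n).chartCoord χ k = iteratedDeriv (k : ℕ) (fun s => χ (α.toFun s)) 0 := by
  have h1 := (α.jet n).exists_jet.choose_spec
  have h0 := base_eq_of_jet_eq h1
  exact iteratedDeriv_comp_eq_of_jet_eq h1 h0 χ.open_source (h0 ▸ hα) hχ.smooth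
    (Nat.lt_succ_iff.1 k.2)

theorem chartCoord_zero (hχ : IsSmoothChart (E := E) χ) {j : HigherTangent E M n}
    (hj : j.base ∈ χ.source) : j.chartCoord χ 0 = χ j.base := by
  obtain ⟨α, rfl⟩ := j.exists_jet
  rw [hχ.chartCoord_jet hj]
  simp [CurveAtZero.base_jet]

theorem base_jetOfCoord (hχ : IsSmoothChart (E := E) χ) {v : Fin (n + 1) → V}
    (hv : v 0 ∈ χ.target) : (hχ.jetOfCoord v).base = χ.symm (v 0) := by
  rw [hχ.jetOfCoord_of_mem hv, CurveAtZero.base_jet, hχ.curve_zero]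

theorem chartCoord_jetOfCoord (hχ : IsSmoothChart (E := E) χ) {v : Fin (n + 1) → V}
    (hv : v 0 ∈ χ.target) : (hχ.jetOfCoord v).chartCoord χ = v := by
  funext k
  rw [hχ.jetOfCoord_of_mem hv,
    hχ.chartCoord_jet (by rw [hχ.curve_zero]; exact χ.map_target hv),
    ← iteratedDeriv_taylorCurve v k]
  refine Filter.EventuallyEq.iteratedDeriv_eq _ ?_
  have hc : ContinuousAt (taylorCurve v) 0 :=
    (contDiff_taylorCurve.comp (contDiff_const.prodMk contDiff_id)).continuous.continuousAt
  filter_upwards [hc.eventually (χ.open_target.mem_nhds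
    (show taylorCurve v 0 ∈ χ.target by rwa [taylorCurve_zero]))] with s hs
  exact χ.right_inv hs

theorem jetOfCoord_chartCoord (hχ : IsSmoothChart (E := E) χ) {j : HigherTangent E M n}
    (hj : j.base ∈ χ.source) : hχ.jetOfCoord (j.chartCoord χ) = j := by
  have hv : j.chartCoord χ 0 ∈ χ.target := by
    rw [hχ.chartCoord_zero hj]
    exact χ.map_source hj
  have h1 := hχ.chartCoord_jetOfCoord hv
  obtain ⟨α, rfl⟩ := j.exists_jet
  have hs : (hχ.curve hv).toFun 0 ∈ χ.source := by
    rw [hχ.curve_zero]; exact χ.map_target hv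
  rw [hχ.jetOfCoord_of_mem hv] at h1 ⊢
  refine hχ.jet_eq hs hj fun k hk => ?_
  have h2 := congrFun h1 ⟨k, Nat.lt_succ_iff.2 hk⟩
  rw [hχ.chartCoord_jet hs, hχ.chartCoord_jet hj] at h2
  exact h2

theorem contMDiffOn_chartCoord (hχ : IsSmoothChart (E := E) χ) :
    ContMDiffOn 𝓘(ℝ, Fin (n + 1) → E) 𝓘(ℝ, Fin (n + 1) → V) ∞
      (HigherTangent.chartCoord (E := E) (n := n) χ) {j | j.base ∈ χ.source} := by
  intro j hj
  refine ContMDiffAt.contMDiffWithinAt ?_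
  set κ := chartAt E j.base with hκ
  have hjs : j.base ∈ κ.source := mem_chart_source E j.base
  have hκj : κ j.base ∈ κ.target := κ.map_source hjs
  rw [contMDiffAt_pi_space]
  intro k
  have h0 : j.coord j.base 0 = κ j.base := HigherTangent.coord_zero hjs
  have hG : ContDiffAt ℝ ∞ (fun y => χ (κ.symm y)) (j.coord j.base 0) := by
    rw [h0]
    have h1 : ContMDiffAt 𝓘(ℝ, E) 𝓘(ℝ, E) ∞ κ.symm (κ j.base) :=
      (contMDiffOn_chart_symm (I := 𝓘(ℝ, E)) (n := ∞) (H := E) (x := j.base)).contMDiffAt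
        (κ.open_target.mem_nhds hκj)
    have h2 : ContMDiffAt 𝓘(ℝ, E) 𝓘(ℝ, V) ∞ χ (κ.symm (κ j.base)) := by
      rw [κ.left_inv hjs]
      exact hχ.smooth.contMDiffAt (χ.open_source.mem_nhds hj)
    exact (h2.comp (κ j.base) h1 : ContMDiffAt _ _ _ _ _).contDiffAt
  have h3 : ContMDiffAt 𝓘(ℝ, Fin (n + 1) → E) 𝓘(ℝ, Fin (n + 1) → E) ∞
      (HigherTangent.coord (n := n) j.base) j :=
    (contMDiffOn_chart (I := 𝓘(ℝ, Fin (n + 1) → E)) (n := ∞) (H := Fin (n + 1) → E)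
      (x := j)).contMDiffAt (chart_source_mem_nhds _ j)
  refine ((contDiffAt_iteratedDeriv_comp_taylorCurve hG (k : ℕ)).contMDiffAt.comp j
    h3).congr_of_eventuallyEq ?_
  filter_upwards [(κ.open_source.preimage HigherTangent.continuous_base).mem_nhds hjs,
    (χ.open_source.preimage HigherTangent.continuous_base).mem_nhds hj] with j' hj' hj''
  simp only [mem_preimage] at hj' hj''
  have h4 : HigherTangent.ofCoord j.base (j'.coord j.base) = j' :=
    (HigherTangent.chart n j.base).left_inv hj'
  have h5 : j'.coord j.base 0 ∈ κ.target := by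
    rw [HigherTangent.coord_zero hj']
    exact κ.map_source hj'
  rw [HigherTangent.ofCoord_of_mem h5] at h4
  have h6 := congrArg HigherTangent.base h4
  rw [CurveAtZero.base_jet] at h6
  conv_lhs => rw [← h4]
  rw [hχ.chartCoord_jet (by rw [h6]; exact hj'')]
  rfl

theorem contMDiffOn_jetOfCoord (hχ : IsSmoothChart (E := E) χ) :
    ContMDiffOn 𝓘(ℝ, Fin (n + 1) → V) 𝓘(ℝ, Fin (n + 1) → E) ∞
      (hχ.jetOfCoord (n := n)) {v | v 0 ∈ χ.target} := by
  intro v hv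
  simp only [mem_ofPred_eq] at hv
  refine ContMDiffAt.contMDiffWithinAt ?_
  set j := hχ.jetOfCoord v with hjdef
  have hjb : j.base = χ.symm (v 0) := hχ.base_jetOfCoord hv
  set κ := chartAt E j.base with hκ
  have hjs : j.base ∈ κ.source := mem_chart_source E j.base
  have hG : ContDiffAt ℝ ∞ (fun y => κ (χ.symm y)) (v 0) := by
    have h1 : ContMDiffAt 𝓘(ℝ, V) 𝓘(ℝ, E) ∞ χ.symm (v 0) :=
      hχ.smooth_symm.contMDiffAt (χ.open_target.mem_nhds hv)
    have h2 : ContMDiffAt 𝓘(ℝ, E) 𝓘(ℝ, E) ∞ κ (χ.symm (v 0)) :=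
      (contMDiffOn_chart (I := 𝓘(ℝ, E)) (n := ∞) (H := E) (x := j.base)).contMDiffAt
        (κ.open_source.mem_nhds (by rwa [← hjb]))
    exact (h2.comp (v 0) h1 : ContMDiffAt _ _ _ _ _).contDiffAt
  have hcoord : ∀ w : Fin (n + 1) → V, w 0 ∈ χ.target → χ.symm (w 0) ∈ κ.source →
      (hχ.jetOfCoord w).coord j.base = fun k : Fin (n + 1) =>
        iteratedDeriv (k : ℕ) (fun s => κ (χ.symm (taylorCurve w s))) 0 := by
    intro w hw hw'
    funext k
    rw [hχ.jetOfCoord_of_mem hw, CurveAtZero.coord_jet (by rwa [hχ.curve_zero])]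
    rfl
  have h3 : ContDiffAt ℝ ∞ (fun (w : Fin (n + 1) → V) (k : Fin (n + 1)) =>
      iteratedDeriv (k : ℕ) (fun s => κ (χ.symm (taylorCurve w s))) 0) v :=
    contDiffAt_pi.2 fun k => contDiffAt_iteratedDeriv_comp_taylorCurve hG k
  have h4 : ContMDiffAt 𝓘(ℝ, Fin (n + 1) → E) 𝓘(ℝ, Fin (n + 1) → E) ∞
      (HigherTangent.ofCoord (n := n) j.base)
      ((fun k : Fin (n + 1) =>
        iteratedDeriv (k : ℕ) (fun s => κ (χ.symm (taylorCurve v s))) 0)) := by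
    refine (contMDiffOn_chart_symm (I := 𝓘(ℝ, Fin (n + 1) → E)) (n := ∞) (H := Fin (n + 1) → E)
      (x := j)).contMDiffAt ((chartAt (Fin (n + 1) → E) j).open_target.mem_nhds ?_)
    rw [← hcoord v hv (by rwa [← hjb])]
    exact (chartAt (Fin (n + 1) → E) j).map_source (mem_chart_source _ j)
  refine (h4.comp v h3.contMDiffAt).congr_of_eventuallyEq ?_
  have ho : ∀ᶠ w in 𝓝 v, w 0 ∈ χ.target :=
    (continuous_apply 0).continuousAt.eventually (χ.open_target.mem_nhds hv)
  have ho' : ∀ᶠ w in 𝓝 v, χ.symm (w 0) ∈ κ.source :=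
    ((χ.continuousAt_symm hv).comp (f := fun w : Fin (n + 1) → V => w 0)
      (continuous_apply 0).continuousAt).eventually (κ.open_source.mem_nhds
      (show χ.symm (v 0) ∈ κ.source by rwa [← hjb]))
  filter_upwards [ho, ho'] with w hw hw'
  have h5 : (hχ.jetOfCoord w).base ∈ κ.source := by rwa [hχ.base_jetOfCoord hw]
  have h6 := (HigherTangent.chart n j.base).left_inv h5
  rw [Function.comp_apply, ← hcoord w hw hw']
  exact h6.symm

variable (n) in
/-- The chart of the higher tangent bundle induced by a chart of the manifold. -/
noncomputable def adaptedChart (hχ : IsSmoothChart (E := E) χ) :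
    OpenPartialHomeomorph (HigherTangent E M n) (Fin (n + 1) → V) where
  toFun := HigherTangent.chartCoord χ
  invFun := hχ.jetOfCoord
  source := {j | j.base ∈ χ.source}
  target := {v | v 0 ∈ χ.target}
  map_source' j hj := by
    simp only [mem_ofPred_eq] at hj ⊢
    rw [hχ.chartCoord_zero hj]
    exact χ.map_source hj
  map_target' v hv := by
    simp only [mem_ofPred_eq] at hv ⊢
    rw [hχ.base_jetOfCoord hv]
    exact χ.map_target hv
  left_inv' j hj := hχ.jetOfCoord_chartCoord hj
  right_inv' v hv := hχ.chartCoord_jetOfCoord hv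
  open_source := χ.open_source.preimage HigherTangent.continuous_base
  open_target := χ.open_target.preimage (continuous_apply 0)
  continuousOn_toFun := hχ.contMDiffOn_chartCoord.continuousOn
  continuousOn_invFun := hχ.contMDiffOn_jetOfCoord.continuousOn

end IsSmoothChart

theorem HigherTangent.base_scale (t : ℝ≥0) (j : HigherTangent E M n) :
    (j.scale t).base = j.base := by
  obtain ⟨α, rfl⟩ := j.exists_jet
  exact congrArg α.toFun (mul_zero (t : ℝ))

theorem IsSmoothChart.chartCoord_scale (hχ : IsSmoothChart (E := E) χ) (t : ℝ≥0)
    {j : HigherTangent E M n} (hj : j.base ∈ χ.source) (k : Fin (n + 1)) :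
    (j.scale t).chartCoord χ k = (t : ℝ) ^ (k : ℕ) • j.chartCoord χ k := by
  have hj' := hj
  rw [← HigherTangent.base_scale t j] at hj'
  obtain ⟨α, rfl⟩ := j.exists_jet
  rw [CurveAtZero.scale_jet] at hj' ⊢
  rw [hχ.chartCoord_jet hj, hχ.chartCoord_jet hj']
  have h1 := congrFun (iteratedDeriv_comp_mul_left (t : ℝ) (fun s => χ (α.toFun s)) k) 0
  simp only [mul_zero] at h1
  exact h1

/-- The coordinates of a family of vectors, as one vector. -/
noncomputable def uncurryEquiv (n : ℕ) (ι : Type) [Fintype ι] :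
    (Fin (n + 1) → ι → ℝ) ≃L[ℝ] (Fin (n + 1) × ι → ℝ) :=
  (LinearEquiv.curry ℝ ℝ (Fin (n + 1)) ι).symm.toContinuousLinearEquiv

variable {ι : Type} [Fintype ι] {χ : OpenPartialHomeomorph M (ι → ℝ)}

variable (n) in
/-- The adapted coordinates of the higher tangent bundle, as a chart with values in `ℝᴺ`. -/
noncomputable def IsSmoothChart.adaptedCoordinates (hχ : IsSmoothChart (E := E) χ) :
    OpenPartialHomeomorph (HigherTangent E M n) (Fin (n + 1) × ι → ℝ) :=
  (hχ.adaptedChart n).trans (uncurryEquiv n ι).toHomeomorph.toOpenPartialHomeomorph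

/-- The coordinate `x⁽ᵏ⁾` has degree `k`. -/
theorem IsSmoothChart.isHomogeneousChart_adaptedCoordinates (hχ : IsSmoothChart (E := E) χ) :
    IsHomogeneousChart (EF := Fin (n + 1) → E) n HigherTangent.scale
      (fun q : Fin (n + 1) × ι => (q.1 : ℕ)) (hχ.adaptedCoordinates n) where
  smooth := by
    have h1 := (uncurryEquiv n ι).contDiff (n := ∞) |>.contMDiff
    refine (h1.comp_contMDiffOn hχ.contMDiffOn_chartCoord).mono fun j hj => ?_
    exact hj.1
  smooth_symm := by
    have h1 := (uncurryEquiv n ι).symm.contDiff (n := ∞) |>.contMDiff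
    exact hχ.contMDiffOn_jetOfCoord.comp h1.contMDiffOn fun z hz => hz.2
  weight_le q := Nat.lt_succ_iff.1 q.1.2
  saturated j := by
    simp only [adaptedCoordinates, mfld_simps, adaptedChart, mem_ofPred_eq,
      HigherTangent.base_scale]
  mapsTo t j hj := by
    simpa only [adaptedCoordinates, mfld_simps, adaptedChart, mem_ofPred_eq,
      HigherTangent.base_scale] using hj
  homogeneous t j hj q := congrFun (hχ.chartCoord_scale t hj.1 q.1) q.2
  cylinder y hy z hz := by
    have h1 : (fun i => z (0, i)) = fun i => y (0, i) := funext fun i => hz (0, i) rfl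
    have hy' : (fun i => y (0, i)) ∈ χ.target := hy.2
    refine ⟨trivial, ?_⟩
    change (fun i => z (0, i)) ∈ χ.target
    rwa [h1]

end AdaptedCoordinates

/-! ### The embedding into the higher tangent bundle -/

section WeightInclusion

variable {n : ℕ} {ι : Type} [Fintype ι] {w : ι → ℕ}

variable (n w) in
/-- The value of the adapted coordinates on the jet of an orbit: the curve with components
`t ^ (w i) * y i` has only one nonzero derivative at `0` in each component. -/
noncomputable def orbitCoord (y : ι → ℝ) (k : Fin (n + 1)) (i : ι) : ℝ :=
  if w i = k then ((k : ℕ).factorial : ℝ) * y i else 0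

theorem contDiff_orbitCoord : ContDiff ℝ ∞ (orbitCoord n w) := by
  rw [contDiff_pi]
  intro k
  rw [contDiff_pi]
  intro i
  unfold orbitCoord
  split_ifs <;> fun_prop

/-- Splitting the coordinates `c k i` into those with `k = w i`, rescaled to invert `orbitCoord`,
and the others. -/
noncomputable def orbitCoordEquiv (hw : ∀ i, w i ≤ n) :
    ((ι → ℝ) × ({q : Fin (n + 1) × ι // w q.2 ≠ q.1} → ℝ)) ≃L[ℝ] (Fin (n + 1) → ι → ℝ) :=
  LinearEquiv.toContinuousLinearEquiv
    { toFun := fun x k i => if hi : w i = k then ((k : ℕ).factorial : ℝ) * x.1 i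
        else x.2 ⟨(k, i), hi⟩
      map_add' := fun x y => by
        funext k i
        by_cases hi : w i = k <;> simp [hi, mul_add]
      map_smul' := fun a x => by
        funext k i
        by_cases hi : w i = k <;> simp [hi, mul_left_comm]
      invFun := fun c => (fun i => ((w i).factorial : ℝ)⁻¹ * c ⟨w i, Nat.lt_succ_iff.2 (hw i)⟩ i,
        fun q => c q.1.1 q.1.2)
      left_inv := fun x => by
        refine Prod.ext (funext fun i => ?_) (funext fun q => ?_)
        · have hf : ((w i).factorial : ℝ) ≠ 0 := Nat.cast_ne_zero.2 (Nat.factorial_ne_zero _)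
          simp [← mul_assoc, inv_mul_cancel₀ hf]
        · simp [q.2]
      right_inv := fun c => by
        funext k i
        by_cases hi : w i = k
        · have hk : (⟨w i, Nat.lt_succ_iff.2 (hw i)⟩ : Fin (n + 1)) = k := Fin.ext hi
          simp only [hi, dite_true]
          rw [← mul_assoc, mul_inv_cancel₀ (Nat.cast_ne_zero.2 (Nat.factorial_ne_zero _)), one_mul]
        · simp [hi] }

theorem orbitCoordEquiv_apply_zero (hw : ∀ i, w i ≤ n) (y : ι → ℝ) :
    orbitCoordEquiv hw (y, 0) = orbitCoord n w y := by
  funext k i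
  by_cases hi : w i = k
  · simp [orbitCoordEquiv, orbitCoord, hi]
  · simp [orbitCoordEquiv, orbitCoord, hi]

end WeightInclusion

section Embedding

variable {E : Type v} [NormedAddCommGroup E] [NormedSpace ℝ E]
variable {M : Type u} [TopologicalSpace M] [ChartedSpace E M]
variable {h : SmoothAction E M} {n : ℕ} {ι : Type} [Fintype ι] {w : ι → ℕ}
variable {χ : OpenPartialHomeomorph M (ι → ℝ)}

namespace IsHomogeneousChart

theorem isSmoothChart (hχ : IsHomogeneousChart (EF := E) n h.toFun w χ) :
    IsSmoothChart (E := E) χ := ⟨hχ.smooth, hχ.smooth_symm⟩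

theorem orbitCoord_mem_target (hχ : IsHomogeneousChart (EF := E) n h.toFun w χ) {y : ι → ℝ}
    (hy : y ∈ χ.target) : orbitCoord n w y 0 ∈ χ.target := by
  refine hχ.cylinder y hy _ fun i hi => ?_
  simp [orbitCoord, hi]

variable [FiniteDimensional ℝ E] [IsManifold 𝓘(ℝ, E) ∞ M] [T2Space M]

theorem base_orbitJet_mem_source (hχ : IsHomogeneousChart (EF := E) n h.toFun w χ) {p : M} :
    (h.orbitJet n p).base ∈ χ.source ↔ p ∈ χ.source := by
  rw [h.base_orbitJet, hχ.saturated]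

theorem chartCoord_orbitJet (hχ : IsHomogeneousChart (EF := E) n h.toFun w χ) {p : M}
    (hp : p ∈ χ.source) : (h.orbitJet n p).chartCoord χ = orbitCoord n w (χ p) := by
  obtain ⟨α, hα⟩ := h.exists_orbitCurve p
  have hα0 : α.toFun 0 ∈ χ.source := by
    have := hα 0
    rw [NNReal.coe_zero] at this
    rw [this]
    exact hχ.mapsTo 0 p hp
  have hsm := hχ.isSmoothChart.contDiffAt_comp hα0
  funext k i
  rw [h.orbitJet_eq n p α hα, hχ.isSmoothChart.chartCoord_jet hα0]
  have h1 := iteratedDeriv_clm_apply_const (ContinuousLinearMap.proj (R := ℝ) (φ := fun _ : ι => ℝ) i)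
    hsm k
  simp only [ContinuousLinearMap.proj_apply] at h1
  rw [← h1]
  have h2 : iteratedDeriv (k : ℕ) (fun s => χ (α.toFun s) i) 0 =
      iteratedDeriv (k : ℕ) (fun s : ℝ => χ p i * s ^ w i) 0 := by
    refine iteratedDeriv_eq_of_eventuallyEq_nonneg (contDiffAt_pi.1 hsm i) (by fun_prop) ?_ k
    filter_upwards [self_mem_nhdsWithin] with s hs
    lift s to ℝ≥0 using hs
    rw [hα, hχ.homogeneous _ p hp i, mul_comm]
  rw [h2, iteratedDeriv_const_mul_field, iteratedDeriv_fun_pow_zero, orbitCoord]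
  by_cases hi : w i = k
  · simp [hi, mul_comm]
  · simp [hi, Ne.symm hi]

variable (χ) in
/-- A local left inverse of `φₙ`: the coordinate of degree `k` of the point is read off from the
`k`-th derivative of the curve, and the other derivatives are ignored. -/
noncomputable def retraction (hχ : IsHomogeneousChart (EF := E) n h.toFun w χ)
    (j : HigherTangent E M n) : M :=
  χ.symm ((orbitCoordEquiv hχ.weight_le).symm (j.chartCoord χ)).1

theorem retraction_orbitJet (hχ : IsHomogeneousChart (EF := E) n h.toFun w χ) {p : M}
    (hp : p ∈ χ.source) : hχ.retraction χ (h.orbitJet n p) = p := by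
  rw [retraction, hχ.chartCoord_orbitJet hp, ← orbitCoordEquiv_apply_zero hχ.weight_le,
    ContinuousLinearEquiv.symm_apply_apply, χ.left_inv hp]

theorem continuousAt_retraction (hχ : IsHomogeneousChart (EF := E) n h.toFun w χ) {p : M}
    (hp : p ∈ χ.source) : ContinuousAt (hχ.retraction χ) (h.orbitJet n p) := by
  have h1 : ContinuousAt (fun j : HigherTangent E M n =>
      ((orbitCoordEquiv hχ.weight_le).symm (j.chartCoord χ)).1) (h.orbitJet n p) :=
    (continuous_fst.comp (orbitCoordEquiv hχ.weight_le).symm.continuous).continuousAt.comp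
      ((hχ.isSmoothChart.adaptedChart n).continuousAt (hχ.base_orbitJet_mem_source.2 hp))
  refine ContinuousAt.comp (g := χ.symm) (χ.continuousAt_symm ?_) h1
  rw [hχ.chartCoord_orbitJet hp, ← orbitCoordEquiv_apply_zero hχ.weight_le,
    ContinuousLinearEquiv.symm_apply_apply]
  exact χ.map_source hp

theorem orbitJet_eq_jetOfCoord (hχ : IsHomogeneousChart (EF := E) n h.toFun w χ) {p : M}
    (hp : p ∈ χ.source) :
    h.orbitJet n p = hχ.isSmoothChart.jetOfCoord (orbitCoord n w (χ p)) := by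
  rw [← hχ.chartCoord_orbitJet hp,
    hχ.isSmoothChart.jetOfCoord_chartCoord (hχ.base_orbitJet_mem_source.2 hp)]

theorem contMDiffAt_orbitJet (hχ : IsHomogeneousChart (EF := E) n h.toFun w χ) {p : M}
    (hp : p ∈ χ.source) :
    ContMDiffAt 𝓘(ℝ, E) 𝓘(ℝ, Fin (n + 1) → E) ∞ (h.orbitJet n) p := by
  have h1 := hχ.smooth.contMDiffAt (χ.open_source.mem_nhds hp)
  have h2 := (contDiff_orbitCoord (n := n) (w := w)).contMDiff.contMDiffAt (x := χ p)
  have h3 : ContMDiffAt 𝓘(ℝ, Fin (n + 1) → ι → ℝ) 𝓘(ℝ, Fin (n + 1) → E) ∞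
      (hχ.isSmoothChart.jetOfCoord (n := n)) (orbitCoord n w (χ p)) :=
    hχ.isSmoothChart.contMDiffOn_jetOfCoord.contMDiffAt
      ((hχ.isSmoothChart.adaptedChart n).open_target.mem_nhds
        (hχ.orbitCoord_mem_target (χ.map_source hp)))
  refine (h3.comp p (h2.comp p h1)).congr_of_eventuallyEq ?_
  filter_upwards [χ.open_source.mem_nhds hp] with q hq
  exact hχ.orbitJet_eq_jetOfCoord hq

/-- Over the domain of homogeneous coordinates the image of `φₙ` is cut out by the vanishing of the
adapted coordinates `(x⁽ᵏ⁾)ⁱ` for which `χⁱ` does not have the degree `k`. -/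
theorem mem_range_orbitJet_iff (hχ : IsHomogeneousChart (EF := E) n h.toFun w χ)
    {j : HigherTangent E M n} (hj : j.base ∈ χ.source) :
    j ∈ Set.range (h.orbitJet n) ↔
      ∀ q : Fin (n + 1) × ι, w q.2 ≠ q.1 → j.chartCoord χ q.1 q.2 = 0 := by
  constructor
  · rintro ⟨p, rfl⟩ q hq
    rw [hχ.chartCoord_orbitJet (hχ.base_orbitJet_mem_source.1 hj), orbitCoord, if_neg hq]
  · intro H
    set y := ((orbitCoordEquiv hχ.weight_le).symm (j.chartCoord χ)).1 with hy
    have h1 : orbitCoord n w y = j.chartCoord χ := by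
      have h2 : (orbitCoordEquiv hχ.weight_le).symm (j.chartCoord χ) = (y, 0) :=
        Prod.ext rfl (funext fun q => H q.1 q.2)
      rw [← orbitCoordEquiv_apply_zero hχ.weight_le, ← h2,
        ContinuousLinearEquiv.apply_symm_apply]
    have hyt : y ∈ χ.target := by
      refine hχ.cylinder (χ j.base) (χ.map_source hj) y fun i hi => ?_
      rw [← hχ.isSmoothChart.chartCoord_zero hj, ← h1]
      simp [orbitCoord, hi]
    refine ⟨χ.symm y, ?_⟩
    rw [hχ.orbitJet_eq_jetOfCoord (χ.map_target hyt), χ.right_inv hyt, h1,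
      hχ.isSmoothChart.jetOfCoord_chartCoord hj]

end IsHomogeneousChart

namespace SmoothAction

variable [FiniteDimensional ℝ E] [IsManifold 𝓘(ℝ, E) ∞ M] [T2Space M]

theorem isGradedSubbundle_range_orbitJet
    (hcov : ∀ p : M, ∃ χ : OpenPartialHomeomorph M (ι → ℝ), p ∈ χ.source ∧
      IsHomogeneousChart (EF := E) n h.toFun w χ) :
    IsGradedSubbundle (EF := Fin (n + 1) → E) n HigherTangent.scale
      (Set.range (h.orbitJet n)) := by
  rintro _ ⟨p, rfl⟩
  obtain ⟨χ, hp, hχ⟩ := hcov p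
  refine ⟨Fin (n + 1) × ι, inferInstance, _, hχ.isSmoothChart.adaptedCoordinates n,
    {q | w q.2 ≠ q.1}, hχ.isSmoothChart.isHomogeneousChart_adaptedCoordinates,
    ⟨hχ.base_orbitJet_mem_source.2 hp, trivial⟩, ?_⟩
  ext j
  rw [mem_inter_iff, and_comm]
  exact and_congr_right fun hj => hχ.mem_range_orbitJet_iff hj.1

theorem isEmbedding_orbitJet
    (hcov : ∀ p : M, ∃ χ : OpenPartialHomeomorph M (ι → ℝ), p ∈ χ.source ∧
      IsHomogeneousChart (EF := E) n h.toFun w χ) : Topology.IsEmbedding (h.orbitJet n) := by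
  refine ⟨Topology.isInducing_iff_nhds.2 fun p => ?_, fun p q hpq => ?_⟩
  · obtain ⟨χ, hp, hχ⟩ := hcov p
    refine le_antisymm ((hχ.contMDiffAt_orbitJet hp).continuousAt.tendsto.le_comap) fun U hU => ?_
    have h1 : Tendsto (hχ.retraction χ) (𝓝 (h.orbitJet n p)) (𝓝 p) := by
      have := hχ.continuousAt_retraction hp
      rwa [ContinuousAt, hχ.retraction_orbitJet hp] at this
    have h2 : ∀ᶠ j in 𝓝 (h.orbitJet n p), j.base ∈ χ.source :=
      (hχ.isSmoothChart.adaptedChart n).open_source.mem_nhds (hχ.base_orbitJet_mem_source.2 hp)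
    refine Filter.mem_comap.2 ⟨_, (h1.eventually hU).and h2, fun q hq => ?_⟩
    have h3 : hχ.retraction χ (h.orbitJet n q) ∈ U := hq.1
    rwa [hχ.retraction_orbitJet (hχ.base_orbitJet_mem_source.1 hq.2)] at h3
  · obtain ⟨χ, hp, hχ⟩ := hcov p
    have hq : q ∈ χ.source := by
      rw [← hχ.base_orbitJet_mem_source, ← hpq, hχ.base_orbitJet_mem_source]
      exact hp
    rw [← hχ.retraction_orbitJet hp, hpq, hχ.retraction_orbitJet hq]

theorem isSmoothEmbedding_orbitJet (L : E ≃L[ℝ] (ι → ℝ))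
    (hcov : ∀ p : M, ∃ χ : OpenPartialHomeomorph M (ι → ℝ), p ∈ χ.source ∧
      IsHomogeneousChart (EF := E) n h.toFun w χ) :
    IsSmoothEmbedding 𝓘(ℝ, E) 𝓘(ℝ, Fin (n + 1) → E) ∞ (h.orbitJet n) := by
  refine ⟨IsImmersionOfComplement.isImmersion
    (F := {q : Fin (n + 1) × ι // w q.2 ≠ q.1} → ℝ) fun p => ?_, isEmbedding_orbitJet hcov⟩
  obtain ⟨χ, hp, hχ⟩ := hcov p
  let L' : (Fin (n + 1) → ι → ℝ) ≃L[ℝ] (Fin (n + 1) → E) :=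
    ContinuousLinearEquiv.piCongrRight fun _ => L.symm
  refine IsImmersionAtOfComplement.mk_of_continuousAt (hχ.contMDiffAt_orbitJet hp).continuousAt
    ((L.prodCongr (ContinuousLinearEquiv.refl ℝ _)).trans
      ((orbitCoordEquiv hχ.weight_le).trans L'))
    (χ.trans L.symm.toHomeomorph.toOpenPartialHomeomorph)
    ((hχ.isSmoothChart.adaptedChart n).trans L'.toHomeomorph.toOpenPartialHomeomorph)
    (by simpa using hp) ⟨hχ.base_orbitJet_mem_source.2 hp, trivial⟩
    (trans_mem_maximalAtlas hχ.smooth hχ.smooth_symm L.symm)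
    (trans_mem_maximalAtlas hχ.isSmoothChart.contMDiffOn_chartCoord
      hχ.isSmoothChart.contMDiffOn_jetOfCoord L') ?_
  intro v hv
  have hv' : L v ∈ χ.target := by
    simp only [mfld_simps] at hv
    exact hv
  simp only [mfld_simps]
  change L' ((h.orbitJet n (χ.symm (L v))).chartCoord χ) =
    L' (orbitCoordEquiv hχ.weight_le (L v, 0))
  rw [hχ.chartCoord_orbitJet (χ.map_target hv'), χ.right_inv hv', orbitCoordEquiv_apply_zero]

end SmoothAction

end Embedding

end GradedGeometry

/-! ### Homogeneity structures are graded bundles -/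

theorem theorem4p1
    {E : Type*} [NormedAddCommGroup E] [NormedSpace ℝ E] [FiniteDimensional ℝ E]
    {M : Type*} [TopologicalSpace M] [ChartedSpace E M] [IsManifold 𝓘(ℝ, E) ∞ M]
    [T2Space M] [SecondCountableTopology M] [ConnectedSpace M]
    (n : ℕ) (h : SmoothAction E M) (hh : h.IsHomogeneityStructure n) :
    -- `M₀` is a submanifold and `h 0 : M → M₀` has the structure of a graded bundle of degree `n`
    (∃ (m : ℕ) (_ : ChartedSpace (EuclideanSpace ℝ (Fin m)) h.base)
      (_ : IsManifold 𝓘(ℝ, EuclideanSpace ℝ (Fin m)) ∞ h.base)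
      (d : Fin n → ℕ) (G : GradedBundle n d E (EuclideanSpace ℝ (Fin m)) h.proj),
      IsSmoothEmbedding 𝓘(ℝ, EuclideanSpace ℝ (Fin m)) 𝓘(ℝ, E) ∞ (Subtype.val : h.base → M) ∧
      -- whose homotheties are `h`
      G.homothety = h.toFun ∧
      -- and which is unique, together with its base manifold and its rank
      (∀ (B : Type*) [TopologicalSpace B] (m' : ℕ) [ChartedSpace (EuclideanSpace ℝ (Fin m')) B]
        [IsManifold 𝓘(ℝ, EuclideanSpace ℝ (Fin m')) ∞ B] (π' : M → B),
        (∀ (d' : Fin n → ℕ) (G' : GradedBundle n d' E (EuclideanSpace ℝ (Fin m')) π'),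
          G'.homothety = h.toFun → d' = d) ∧
        (∀ G' : GradedBundle n d E (EuclideanSpace ℝ (Fin m')) π', G'.homothety = h.toFun →
          ∃! Φ : Diffeomorph 𝓘(ℝ, EuclideanSpace ℝ (Fin m)) 𝓘(ℝ, EuclideanSpace ℝ (Fin m'))
              h.base B ∞,
            (∀ p, Φ (h.proj p) = π' p) ∧ G.SameStructure Φ G')) ∧
      -- `M` has an atlas of homogeneous coordinates
      (∀ p : M, ∃ χ : OpenPartialHomeomorph M (Fin m ⊕ ((j : Fin n) × Fin (d j)) → ℝ),
        p ∈ χ.source ∧ IsHomogeneousChart (EF := E) n h.toFun (weightVector m d) χ)) ∧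
    -- `φₙ` is an isomorphism onto a graded subbundle of `TⁿM`
    IsSmoothEmbedding 𝓘(ℝ, E) 𝓘(ℝ, Fin (n + 1) → E) ∞ (h.orbitJet n) ∧
    (∀ (t : ℝ≥0) (p : M), h.orbitJet n (h.toFun t p) = (h.orbitJet n p).scale t) ∧
    IsGradedSubbundle (EF := Fin (n + 1) → E) n HigherTangent.scale (Set.range (h.orbitJet n)) := by
  obtain ⟨m, d, H⟩ := hh.exists_charts
  choose χ hmem hχ using fun b : h.base => H b b.2
  have hcov : ∀ p : M, ∃ χ : OpenPartialHomeomorph M (Fin m ⊕ ((j : Fin n) × Fin (d j)) → ℝ),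
      p ∈ χ.source ∧ IsHomogeneousChart (EF := E) n h.toFun (weightVector m d) χ := fun p =>
    ⟨χ (h.proj p), ((hχ _).saturated p).1 (hmem (h.proj p)), hχ _⟩
  obtain ⟨p₀⟩ : Nonempty M := inferInstance
  obtain ⟨L⟩ := SmoothAction.nonempty_continuousLinearEquiv (hχ (h.proj p₀)) (hmem _)
  refine ⟨?_, SmoothAction.isSmoothEmbedding_orbitJet L hcov, h.orbitJet_apply n,
    SmoothAction.isGradedSubbundle_range_orbitJet hcov⟩
  let _ := baseChartedSpace hχ hmem
  have hman : IsManifold 𝓘(ℝ, EuclideanSpace ℝ (Fin m)) ∞ h.base :=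
    isManifold_baseChartedSpace hχ hmem
  have hb : HasHomogeneousBaseCharts h m d := fun b => ⟨χ b, hχ b, hmem b, rfl⟩
  refine ⟨m, inferInstance, hman, d, hb.gradedBundle, hb.isSmoothEmbedding_val L,
    hb.homothety_gradedBundle, fun B _ m' _ _ π' => ⟨fun d' G' hG' => hb.rank_eq G' hG',
      fun G' hG' => ?_⟩, hcov⟩
  obtain ⟨Φ, hΦ⟩ := hb.exists_diffeomorph G' hG'
  refine ⟨Φ, ⟨hΦ, GradedBundle.sameStructure (hb.homothety_gradedBundle.trans hG'.symm) Φ hΦ⟩,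
    fun Ψ hΨ => Diffeomorph.ext fun b => ?_⟩
  rw [← h.proj_coe b, hΦ, hΨ.1]
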